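/- All alphabets are finite, entropies and mutual informations are in bits. Let $S',T',K$ be independent random variables, $S=(S',K)$, $T=(T',K)$, and let $p(y_1y_2|x_1x_2)$ be a discrete memoryless interference channel. The memoryless source $(S,T)$ is called admissible for the channel if for every $\epsilon\in(0,1)$ and all sufficiently large $n$ there are encoders $x_1^n=f_1(s^n)$, $x_2^n=f_2(t^n)$ and decoders $\phi_1(y_1^n)$, $\phi_2(y_2^n)$ with $\Pr\{\phi_1(Y_1^n)\neq S^n\}\le\epsilon$ and $\Pr\{\phi_2(Y_2^n)\neq T^n\}\le\epsilon$. Let the joint distribution of all variables be $$p(s')p(t')p(k)\,p(w_0)p(w_1|w_0)p(w_2|w_0)\,p(x_1|w_0w_1)p(x_2|w_0w_2)\,p(y_1y_2|x_1x_2).$$ For real $R_0,R_1,R_2$ let $(\ast)$ denote the thirteen inequalities \begin{align*} R_1&<I(X_1;Y_1|W_0W_2),\\ R_2&<I(X_2;Y_2|W_0W_1),\\ R_0+R_1&<I(W_0W_2X_1;Y_1),\\ R_0+R_2&<I(W_0W_1X_2;Y_2),\\ R_1+R_2&<I(X_1;Y_1|W_0W_1W_2)+I(W_1X_2;Y_2|W_0),\\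 R_1+R_2&<I(X_2;Y_2|W_0W_1W_2)+I(W_2X_1;Y_1|W_0),\\ R_1+R_2&<I(W_2X_1;Y_1|W_0W_1)+I(W_1X_2;Y_2|W_0W_2),\\ R_0+R_1+R_2&<I(W_0W_1X_2;Y_2)+I(X_1;Y_1|W_0W_1W_2),\\ R_0+R_1+R_2&<I(W_0W_2X_1;Y_1)+I(X_2;Y_2|W_0W_1W_2),\\ 2R_1+R_2&<I(X_1;Y_1|W_0W_1W_2)+I(W_2X_1;Y_1|W_0)+I(W_1X_2;Y_2|W_0W_2),\\ R_1+2R_2&<I(X_2;Y_2|W_0W_1W_2)+I(W_1X_2;Y_2|W_0)+I(W_2X_1;Y_1|W_0W_1),\\ R_0+2R_1+R_2&<I(X_1;Y_1|W_0W_1W_2)+I(W_0W_2X_1;Y_1)+I(W_1X_2;Y_2|W_0W_2),\\ R_0+R_1+2R_2&<I(X_2;Y_2|W_0W_1W_2)+I(W_0W_1X_2;Y_2)+I(W_2X_1;Y_1|W_0W_1). \end{align*} Then: 1. If $(\ast)$ holds with $R_0=H(K)$, $R_1=H(S')$, $R_2=H(T')$, then $(S,T)$ is admissible for the channel. 2.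 $K$ is the common part of $S$ and $T$ in the sense of Gács, Körner and Witsenhausen, and $(\ast)$ with $R_0=H(K)$, $R_1=H(S')$, $R_2=H(T')$ holds if and only if the general sufficient condition for arbitrarily correlated sources holds for this joint distribution. The latter consists of the inequalities \begin{align*} H(S|K)&<I(SX_1;Y_1|W_0W_2K),\\ H(T|K)&<I(TX_2;Y_2|W_0W_1K),\\ H(S)&<I(W_0W_2SX_1;Y_1),\\ H(T)&<I(W_0W_1TX_2;Y_2),\\ H(S|K)+H(T|K)&<I(SX_1;Y_1|W_0W_1W_2K)+I(W_1TX_2;Y_2|W_0K),\\ H(S|K)+H(T|K)&<I(TX_2;Y_2|W_0W_1W_2K)+I(W_2SX_1;Y_1|W_0K),\\ H(S|K)+H(T|K)&<I(SW_2X_1;Y_1|W_0W_1K)+I(TW_1X_2;Y_2|W_0W_2K),\\ H(S|K)+H(T)&<I(W_0W_1TX_2;Y_2)+I(SX_1;Y_1|W_0W_1W_2K),\\ H(S)+H(T|K)&<I(W_0W_2SX_1;Y_1)+I(TX_2;Y_2|W_0W_1W_2K),\\ 2H(S|K)+H(T|K)&<I(SX_1;Y_1|W_0W_1W_2K)+I(SW_2X_1;Y_1|W_0K)+I(TW_1X_2;Y_2|W_0W_2K),\\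 H(S|K)+2H(T|K)&<I(TX_2;Y_2|W_0W_1W_2K)+I(TW_1X_2;Y_2|W_0K)+I(SW_2X_1;Y_1|W_0W_1K),\\ H(S)+H(S|K)+H(T|K)&<I(SX_1;Y_1|W_0W_1W_2K)+I(W_0W_2SX_1;Y_1)+I(TW_1X_2;Y_2|W_0W_2K),\\ H(T)+H(S|K)+H(T|K)&<I(TX_2;Y_2|W_0W_1W_2K)+I(W_0W_1TX_2;Y_2)+I(SW_2X_1;Y_1|W_0W_1K). \end{align*} 3. Let $\mathcal R$ be the set of all $(R_0,R_1,R_2)$ with $R_0,R_1,R_2\ge 0$ that satisfy $(\ast)$ for the distribution $p(w_0)p(w_1|w_0)p(w_2|w_0)p(x_1|w_0w_1)p(x_2|w_0w_2)p(y_1y_2|x_1x_2)$. Then $(\ast)$ with $R_0=H(K)$, $R_1=H(S')$, $R_2=H(T')$ holds if and only if $(H(K),H(S'),H(T'))\in\mathcal R$. Moreover, every $(R_0,R_1,R_2)\in\mathcal R$ is achievable for the interference channel with common information: for every $\epsilon\in(0,1)$ and all sufficiently large $n$ there is a block code of length $n$ for independent uniform messages, namely a common message with at least $2^{nR_0}$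 values known to both encoders and private messages with at least $2^{nR_1}$ and $2^{nR_2}$ values known to encoder 1 and encoder 2 respectively, such that decoder $i$ recovers the common message and the $i$-th private message with error probability at most $\epsilon$, for $i=1,2$. -/

import Mathlib

noncomputable section

namespace InterferenceChannel

/-! ### Entropy and mutual information (in bits) of discrete random variables

`P` is a probability mass function on a sample space `Ω`, and random variables are functions on `Ω`
with values in finite types. -/

section Information

variable {Ω α β γ : Type*}

/-- The probability `Pr {X = a}` as a real number. -/
def prob (P : PMF Ω) (X : Ω → α) (a : α) : ℝ := ((P.map X) a).toReal

variable [Fintype α] [Fintype β] [Fintype γ]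

/-- `H(X) = - ∑ p(x) log₂ p(x)`. -/
def entropy (P : PMF Ω) (X : Ω → α) : ℝ :=
  -∑ a, prob P X a * Real.logb 2 (prob P X a)

/-- `H(X|Z) = - ∑ p(x,z) log₂ p(x|z)`. -/
def condEntropy (P : PMF Ω) (X : Ω → α) (Z : Ω → γ) : ℝ :=
  -∑ a, ∑ c, prob P (fun ω => (X ω, Z ω)) (a, c) *
    Real.logb 2 (prob P (fun ω => (X ω, Z ω)) (a, c) / prob P Z c)

/-- `I(X;Y) = H(X) - H(X|Y)`. -/
def mutualInfo (P : PMF Ω) (X : Ω → α) (Y : Ω → β) : ℝ :=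
  entropy P X - condEntropy P X Y

/-- `I(X;Y|Z) = H(X|Z) - H(X|YZ)`. -/
def condMutualInfo (P : PMF Ω) (X : Ω → α) (Y : Ω → β) (Z : Ω → γ) : ℝ :=
  condEntropy P X Z - condEntropy P X (fun ω => (Y ω, Z ω))

end Information

/-! ### Lossless transmission of correlated sources over an interference channel

A memoryless source pair is given by a law on `𝒮 × 𝒯`, a discrete memoryless interference channel by
its transition probability `p(y₁ y₂ | x₁ x₂)`. -/

section Transmission

variable {𝒮 𝒯 𝒳₁ 𝒳₂ 𝒴₁ 𝒴₂ : Type*}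

/-- The probability of a pair of output words given a pair of input words (no memory, no
feedback). -/
def channelWordProb (ch : 𝒳₁ → 𝒳₂ → PMF (𝒴₁ × 𝒴₂)) {n : ℕ} (x₁ : Fin n → 𝒳₁) (x₂ : Fin n → 𝒳₂)
    (y₁ : Fin n → 𝒴₁) (y₂ : Fin n → 𝒴₂) : ℝ :=
  ∏ i, (ch (x₁ i) (x₂ i) (y₁ i, y₂ i)).toReal

/-- The probability of a pair of source words. -/
def sourceWordProb (src : PMF (𝒮 × 𝒯)) {n : ℕ} (s : Fin n → 𝒮) (t : Fin n → 𝒯) : ℝ :=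
  ∏ i, (src (s i, t i)).toReal

variable [Fintype 𝒮] [Fintype 𝒯] [Fintype 𝒴₁] [Fintype 𝒴₂]

open Classical in
/-- The error probability of decoder 1: the probability that the decoder output differs
from the source word `Sⁿ`. -/
def errorProb₁ (src : PMF (𝒮 × 𝒯)) (ch : 𝒳₁ → 𝒳₂ → PMF (𝒴₁ × 𝒴₂)) {n : ℕ}
    (f₁ : (Fin n → 𝒮) → (Fin n → 𝒳₁)) (f₂ : (Fin n → 𝒯) → (Fin n → 𝒳₂))
    (φ₁ : (Fin n → 𝒴₁) → (Fin n → 𝒮)) : ℝ :=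
  ∑ s, ∑ t, sourceWordProb src s t *
    ∑ y₁, ∑ y₂, if φ₁ y₁ ≠ s then channelWordProb ch (f₁ s) (f₂ t) y₁ y₂ else 0

open Classical in
/-- The error probability of decoder 2: the probability that the decoder output differs
from the source word `Tⁿ`. -/
def errorProb₂ (src : PMF (𝒮 × 𝒯)) (ch : 𝒳₁ → 𝒳₂ → PMF (𝒴₁ × 𝒴₂)) {n : ℕ}
    (f₁ : (Fin n → 𝒮) → (Fin n → 𝒳₁)) (f₂ : (Fin n → 𝒯) → (Fin n → 𝒳₂))
    (φ₂ : (Fin n → 𝒴₂) → (Fin n → 𝒯)) : ℝ :=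
  ∑ s, ∑ t, sourceWordProb src s t *
    ∑ y₁, ∑ y₂, if φ₂ y₂ ≠ t then channelWordProb ch (f₁ s) (f₂ t) y₁ y₂ else 0

/-- The source pair is admissible for the channel: for every `ε ∈ (0,1)` and all sufficiently large
`n` there is a block code of length `n` whose two error probabilities are at most `ε`. -/
def Admissible (src : PMF (𝒮 × 𝒯)) (ch : 𝒳₁ → 𝒳₂ → PMF (𝒴₁ × 𝒴₂)) : Prop :=
  ∀ ε : ℝ, 0 < ε → ε < 1 → ∃ N : ℕ, ∀ n : ℕ, N ≤ n →
    ∃ (f₁ : (Fin n → 𝒮) → (Fin n → 𝒳₁)) (f₂ : (Fin n → 𝒯) → (Fin n → 𝒳₂))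
      (φ₁ : (Fin n → 𝒴₁) → (Fin n → 𝒮)) (φ₂ : (Fin n → 𝒴₂) → (Fin n → 𝒯)),
      max (errorProb₁ src ch f₁ f₂ φ₁) (errorProb₂ src ch f₁ f₂ φ₂) ≤ ε

/-- `f(S) = g(T)` is the common part of `(S,T)` in the sense of Gács, Körner and Witsenhausen:
`f(S) = g(T)` with probability one, and every other `f'(S) = g'(T)` with this property is almost
surely a function of it. (As `𝒮` and `𝒯` are finite, values in `ℕ` are no restriction.) -/
def IsCommonPart {𝒦 : Type*} (src : PMF (𝒮 × 𝒯)) (f : 𝒮 → 𝒦) (g : 𝒯 → 𝒦) : Prop :=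
  (∀ s t, src (s, t) ≠ 0 → f s = g t) ∧
    ∀ (f' : 𝒮 → ℕ) (g' : 𝒯 → ℕ), (∀ s t, src (s, t) ≠ 0 → f' s = g' t) →
      ∃ h : 𝒦 → ℕ, ∀ s t, src (s, t) ≠ 0 → f' s = h (f s)

end Transmission

/-! ### Joint distributions -/

/-- The values of the auxiliary variables, the channel inputs and the channel outputs. -/
structure ChannelVars (𝒲₀ 𝒲₁ 𝒲₂ 𝒳₁ 𝒳₂ 𝒴₁ 𝒴₂ : Type*) where
  w₀ : 𝒲₀
  w₁ : 𝒲₁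
  w₂ : 𝒲₂
  x₁ : 𝒳₁
  x₂ : 𝒳₂
  y₁ : 𝒴₁
  y₂ : 𝒴₂

/-- The values of all variables, the sources included. -/
structure AllVars (𝒮 𝒯 𝒲₀ 𝒲₁ 𝒲₂ 𝒳₁ 𝒳₂ 𝒴₁ 𝒴₂ : Type*) extends
    ChannelVars 𝒲₀ 𝒲₁ 𝒲₂ 𝒳₁ 𝒳₂ 𝒴₁ 𝒴₂ where
  s : 𝒮
  t : 𝒯

section Laws

variable {𝒮 𝒯 𝒦 𝒲₀ 𝒲₁ 𝒲₂ 𝒳₁ 𝒳₂ 𝒴₁ 𝒴₂ : Type*}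

/-- `p(s,t) p(w₀) p(w₁|w₀) p(w₂|w₀) p(x₁|s w₁ w₀) p(x₂|t w₂ w₀) p(y₁ y₂|x₁ x₂)`. -/
def jointLaw (src : PMF (𝒮 × 𝒯)) (pW₀ : PMF 𝒲₀) (pW₁ : 𝒲₀ → PMF 𝒲₁) (pW₂ : 𝒲₀ → PMF 𝒲₂)
    (pX₁ : 𝒮 → 𝒲₁ → 𝒲₀ → PMF 𝒳₁) (pX₂ : 𝒯 → 𝒲₂ → 𝒲₀ → PMF 𝒳₂)
    (ch : 𝒳₁ → 𝒳₂ → PMF (𝒴₁ × 𝒴₂)) : PMF (AllVars 𝒮 𝒯 𝒲₀ 𝒲₁ 𝒲₂ 𝒳₁ 𝒳₂ 𝒴₁ 𝒴₂) :=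
  src.bind fun st => pW₀.bind fun w₀ => (pW₁ w₀).bind fun w₁ => (pW₂ w₀).bind fun w₂ =>
    (pX₁ st.1 w₁ w₀).bind fun x₁ => (pX₂ st.2 w₂ w₀).bind fun x₂ => (ch x₁ x₂).bind fun y =>
      PMF.pure
        { s := st.1, t := st.2, w₀ := w₀, w₁ := w₁, w₂ := w₂, x₁ := x₁, x₂ := x₂,
          y₁ := y.1, y₂ := y.2 }

/-- `p(w₀) p(w₁|w₀) p(w₂|w₀) p(x₁|w₀ w₁) p(x₂|w₀ w₂) p(y₁ y₂|x₁ x₂)`. -/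
def channelLaw (pW₀ : PMF 𝒲₀) (pW₁ : 𝒲₀ → PMF 𝒲₁) (pW₂ : 𝒲₀ → PMF 𝒲₂)
    (pX₁ : 𝒲₀ → 𝒲₁ → PMF 𝒳₁) (pX₂ : 𝒲₀ → 𝒲₂ → PMF 𝒳₂)
    (ch : 𝒳₁ → 𝒳₂ → PMF (𝒴₁ × 𝒴₂)) : PMF (ChannelVars 𝒲₀ 𝒲₁ 𝒲₂ 𝒳₁ 𝒳₂ 𝒴₁ 𝒴₂) :=
  pW₀.bind fun w₀ => (pW₁ w₀).bind fun w₁ => (pW₂ w₀).bind fun w₂ =>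
    (pX₁ w₀ w₁).bind fun x₁ => (pX₂ w₀ w₂).bind fun x₂ => (ch x₁ x₂).bind fun y =>
      PMF.pure
        { w₀ := w₀, w₁ := w₁, w₂ := w₂, x₁ := x₁, x₂ := x₂, y₁ := y.1, y₂ := y.2 }

/-- The law of `(S,T) = ((S',K),(T',K))` for independent `S'`, `T'`, `K`. -/
def decomposedSource {𝒮' 𝒯' : Type*} (pS' : PMF 𝒮') (pT' : PMF 𝒯') (pK : PMF 𝒦) :
    PMF ((𝒮' × 𝒦) × (𝒯' × 𝒦)) :=
  pS'.bind fun s' => pT'.bind fun t' => pK.bind fun k => PMF.pure ((s', k), (t', k))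

end Laws

/-! ### The conditions -/

/-- The condition for lossless transmission of an arbitrarily correlated source pair with common
part `K = f(S) = g(T)`: the thirteen inequalities for the joint law
`p(s,t) p(w₀) p(w₁|w₀) p(w₂|w₀) p(x₁|s w₁ w₀) p(x₂|t w₂ w₀) p(y₁ y₂|x₁ x₂)`. -/
def CorrelatedSourceCondition {𝒮 𝒯 𝒦 𝒲₀ 𝒲₁ 𝒲₂ 𝒳₁ 𝒳₂ 𝒴₁ 𝒴₂ : Type*} [Fintype 𝒮] [Fintype 𝒯]
    [Fintype 𝒦] [Fintype 𝒲₀] [Fintype 𝒲₁] [Fintype 𝒲₂] [Fintype 𝒳₁] [Fintype 𝒳₂] [Fintype 𝒴₁]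
    [Fintype 𝒴₂] (src : PMF (𝒮 × 𝒯)) (f : 𝒮 → 𝒦) (g : 𝒯 → 𝒦)
    (pW₀ : PMF 𝒲₀) (pW₁ : 𝒲₀ → PMF 𝒲₁) (pW₂ : 𝒲₀ → PMF 𝒲₂)
    (pX₁ : 𝒮 → 𝒲₁ → 𝒲₀ → PMF 𝒳₁) (pX₂ : 𝒯 → 𝒲₂ → 𝒲₀ → PMF 𝒳₂)
    (ch : 𝒳₁ → 𝒳₂ → PMF (𝒴₁ × 𝒴₂)) : Prop :=
  let P := jointLaw src pW₀ pW₁ pW₂ pX₁ pX₂ ch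
  -- the source entropies
  let HS := entropy P (fun ω => ω.s)
  let HT := entropy P (fun ω => ω.t)
  let HSK := condEntropy P (fun ω => ω.s) (fun ω => f ω.s)
  let HTK := condEntropy P (fun ω => ω.t) (fun ω => f ω.s)
  -- `I(S X₁; Y₁ | W₀ W₁ W₂ K)` and `I(T X₂; Y₂ | W₀ W₁ W₂ K)`
  let a₁ := condMutualInfo P (fun ω => (ω.s, ω.x₁)) (fun ω => ω.y₁)
    (fun ω => (ω.w₀, ω.w₁, ω.w₂, f ω.s))
  let a₂ := condMutualInfo P (fun ω => (ω.t, ω.x₂)) (fun ω => ω.y₂)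
    (fun ω => (ω.w₀, ω.w₁, ω.w₂, f ω.s))
  -- `I(S X₁; Y₁ | W₀ W₂ K)` and `I(T X₂; Y₂ | W₀ W₁ K)`
  let b₁ := condMutualInfo P (fun ω => (ω.s, ω.x₁)) (fun ω => ω.y₁)
    (fun ω => (ω.w₀, ω.w₂, f ω.s))
  let b₂ := condMutualInfo P (fun ω => (ω.t, ω.x₂)) (fun ω => ω.y₂)
    (fun ω => (ω.w₀, ω.w₁, f ω.s))
  -- `I(S W₂ X₁; Y₁ | W₀ W₁ K)` and `I(T W₁ X₂; Y₂ | W₀ W₂ K)`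
  let c₁ := condMutualInfo P (fun ω => (ω.s, ω.w₂, ω.x₁)) (fun ω => ω.y₁)
    (fun ω => (ω.w₀, ω.w₁, f ω.s))
  let c₂ := condMutualInfo P (fun ω => (ω.t, ω.w₁, ω.x₂)) (fun ω => ω.y₂)
    (fun ω => (ω.w₀, ω.w₂, f ω.s))
  -- `I(W₂ S X₁; Y₁ | W₀ K)` and `I(W₁ T X₂; Y₂ | W₀ K)`
  let d₁ := condMutualInfo P (fun ω => (ω.w₂, ω.s, ω.x₁)) (fun ω => ω.y₁)
    (fun ω => (ω.w₀, f ω.s))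
  let d₂ := condMutualInfo P (fun ω => (ω.w₁, ω.t, ω.x₂)) (fun ω => ω.y₂)
    (fun ω => (ω.w₀, f ω.s))
  -- `I(W₀ W₂ S X₁; Y₁)` and `I(W₀ W₁ T X₂; Y₂)`
  let e₁ := mutualInfo P (fun ω => (ω.w₀, ω.w₂, ω.s, ω.x₁)) (fun ω => ω.y₁)
  let e₂ := mutualInfo P (fun ω => (ω.w₀, ω.w₁, ω.t, ω.x₂)) (fun ω => ω.y₂)
  IsCommonPart src f g ∧
    HSK < b₁ ∧
    HTK < b₂ ∧
    HS < e₁ ∧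
    HT < e₂ ∧
    HSK + HTK < a₁ + d₂ ∧
    HSK + HTK < a₂ + d₁ ∧
    HSK + HTK < c₁ + c₂ ∧
    HSK + HT < e₂ + a₁ ∧
    HS + HTK < e₁ + a₂ ∧
    2 * HSK + HTK < a₁ + d₁ + c₂ ∧
    HSK + 2 * HTK < a₂ + d₂ + c₁ ∧
    HS + HSK + HTK < a₁ + e₁ + c₂ ∧
    HT + HSK + HTK < a₂ + e₂ + c₁

/-- The thirteen inequalities without source variables in the mutual informations, for random
variables `W₀, W₁, W₂, X₁, X₂, Y₁, Y₂` on a sample space with law `P` and real numbers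
`R₀, R₁, R₂`. -/
def ThirteenInequalities {Ω 𝒲₀ 𝒲₁ 𝒲₂ 𝒳₁ 𝒳₂ 𝒴₁ 𝒴₂ : Type*} [Fintype 𝒲₀] [Fintype 𝒲₁] [Fintype 𝒲₂]
    [Fintype 𝒳₁] [Fintype 𝒳₂] [Fintype 𝒴₁] [Fintype 𝒴₂] (P : PMF Ω)
    (W₀ : Ω → 𝒲₀) (W₁ : Ω → 𝒲₁) (W₂ : Ω → 𝒲₂) (X₁ : Ω → 𝒳₁) (X₂ : Ω → 𝒳₂)
    (Y₁ : Ω → 𝒴₁) (Y₂ : Ω → 𝒴₂) (R₀ R₁ R₂ : ℝ) : Prop :=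
  -- `I(X₁; Y₁ | W₀ W₁ W₂)` and `I(X₂; Y₂ | W₀ W₁ W₂)`
  let a₁ := condMutualInfo P X₁ Y₁ (fun ω => (W₀ ω, W₁ ω, W₂ ω))
  let a₂ := condMutualInfo P X₂ Y₂ (fun ω => (W₀ ω, W₁ ω, W₂ ω))
  -- `I(X₁; Y₁ | W₀ W₂)` and `I(X₂; Y₂ | W₀ W₁)`
  let b₁ := condMutualInfo P X₁ Y₁ (fun ω => (W₀ ω, W₂ ω))
  let b₂ := condMutualInfo P X₂ Y₂ (fun ω => (W₀ ω, W₁ ω))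
  -- `I(W₂ X₁; Y₁ | W₀ W₁)` and `I(W₁ X₂; Y₂ | W₀ W₂)`
  let c₁ := condMutualInfo P (fun ω => (W₂ ω, X₁ ω)) Y₁ (fun ω => (W₀ ω, W₁ ω))
  let c₂ := condMutualInfo P (fun ω => (W₁ ω, X₂ ω)) Y₂ (fun ω => (W₀ ω, W₂ ω))
  -- `I(W₂ X₁; Y₁ | W₀)` and `I(W₁ X₂; Y₂ | W₀)`
  let d₁ := condMutualInfo P (fun ω => (W₂ ω, X₁ ω)) Y₁ W₀
  let d₂ := condMutualInfo P (fun ω => (W₁ ω, X₂ ω)) Y₂ W₀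
  -- `I(W₀ W₂ X₁; Y₁)` and `I(W₀ W₁ X₂; Y₂)`
  let e₁ := mutualInfo P (fun ω => (W₀ ω, W₂ ω, X₁ ω)) Y₁
  let e₂ := mutualInfo P (fun ω => (W₀ ω, W₁ ω, X₂ ω)) Y₂
  R₁ < b₁ ∧
    R₂ < b₂ ∧
    R₀ + R₁ < e₁ ∧
    R₀ + R₂ < e₂ ∧
    R₁ + R₂ < a₁ + d₂ ∧
    R₁ + R₂ < a₂ + d₁ ∧
    R₁ + R₂ < c₁ + c₂ ∧
    R₀ + R₁ + R₂ < e₂ + a₁ ∧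
    R₀ + R₁ + R₂ < e₁ + a₂ ∧
    2 * R₁ + R₂ < a₁ + d₁ + c₂ ∧
    R₁ + 2 * R₂ < a₂ + d₂ + c₁ ∧
    R₀ + 2 * R₁ + R₂ < a₁ + e₁ + c₂ ∧
    R₀ + R₁ + 2 * R₂ < a₂ + e₂ + c₁

/-! ### Interference channels with common information -/

section CommonInformation

/-- The rate region of the interference channel with common information that belongs to the law
`p(w₀) p(w₁|w₀) p(w₂|w₀) p(x₁|w₀ w₁) p(x₂|w₀ w₂) p(y₁ y₂|x₁ x₂)`. -/
def commonInfoRegion {𝒲₀ 𝒲₁ 𝒲₂ 𝒳₁ 𝒳₂ 𝒴₁ 𝒴₂ : Type*} [Fintype 𝒲₀] [Fintype 𝒲₁] [Fintype 𝒲₂]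
    [Fintype 𝒳₁] [Fintype 𝒳₂] [Fintype 𝒴₁] [Fintype 𝒴₂]
    (pW₀ : PMF 𝒲₀) (pW₁ : 𝒲₀ → PMF 𝒲₁) (pW₂ : 𝒲₀ → PMF 𝒲₂)
    (pX₁ : 𝒲₀ → 𝒲₁ → PMF 𝒳₁) (pX₂ : 𝒲₀ → 𝒲₂ → PMF 𝒳₂)
    (ch : 𝒳₁ → 𝒳₂ → PMF (𝒴₁ × 𝒴₂)) : Set (ℝ × ℝ × ℝ) :=
  {R | 0 ≤ R.1 ∧ 0 ≤ R.2.1 ∧ 0 ≤ R.2.2 ∧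
    ThirteenInequalities (channelLaw pW₀ pW₁ pW₂ pX₁ pX₂ ch)
      (fun ω => ω.w₀) (fun ω => ω.w₁) (fun ω => ω.w₂) (fun ω => ω.x₁) (fun ω => ω.x₂)
      (fun ω => ω.y₁) (fun ω => ω.y₂) R.1 R.2.1 R.2.2}

variable {𝒳₁ 𝒳₂ 𝒴₁ 𝒴₂ : Type*} [Fintype 𝒴₁] [Fintype 𝒴₂]

open Classical in
/-- The average probability, over uniformly distributed independent messages `m₀, m₁, m₂`, that
decoder 1 does not recover the common message `m₀` and the private message `m₁`. -/
def messageErrorProb₁ (ch : 𝒳₁ → 𝒳₂ → PMF (𝒴₁ × 𝒴₂)) {n M₀ M₁ M₂ : ℕ}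
    (f₁ : Fin M₀ → Fin M₁ → (Fin n → 𝒳₁)) (f₂ : Fin M₀ → Fin M₂ → (Fin n → 𝒳₂))
    (φ₁ : (Fin n → 𝒴₁) → Fin M₀ × Fin M₁) : ℝ :=
  (∑ m₀, ∑ m₁, ∑ m₂, ∑ y₁, ∑ y₂,
    if φ₁ y₁ ≠ (m₀, m₁) then channelWordProb ch (f₁ m₀ m₁) (f₂ m₀ m₂) y₁ y₂ else 0) /
      ((M₀ : ℝ) * M₁ * M₂)

open Classical in
/-- The average probability, over uniformly distributed independent messages `m₀, m₁, m₂`, that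
decoder 2 does not recover the common message `m₀` and the private message `m₂`. -/
def messageErrorProb₂ (ch : 𝒳₁ → 𝒳₂ → PMF (𝒴₁ × 𝒴₂)) {n M₀ M₁ M₂ : ℕ}
    (f₁ : Fin M₀ → Fin M₁ → (Fin n → 𝒳₁)) (f₂ : Fin M₀ → Fin M₂ → (Fin n → 𝒳₂))
    (φ₂ : (Fin n → 𝒴₂) → Fin M₀ × Fin M₂) : ℝ :=
  (∑ m₀, ∑ m₁, ∑ m₂, ∑ y₁, ∑ y₂,
    if φ₂ y₂ ≠ (m₀, m₂) then channelWordProb ch (f₁ m₀ m₁) (f₂ m₀ m₂) y₁ y₂ else 0) /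
      ((M₀ : ℝ) * M₁ * M₂)

/-- `(R₀, R₁, R₂)` is achievable for the interference channel with common information: for every
`ε ∈ (0,1)` and all sufficiently large `n` there is a block code of length `n` with at least
`2 ^ (n R₀)` common messages (known to both encoders) and at least `2 ^ (n R₁)` and `2 ^ (n R₂)`
private messages, whose two error probabilities are at most `ε`. -/
def CommonInfoAchievable (ch : 𝒳₁ → 𝒳₂ → PMF (𝒴₁ × 𝒴₂)) (R₀ R₁ R₂ : ℝ) : Prop :=
  ∀ ε : ℝ, 0 < ε → ε < 1 → ∃ N : ℕ, ∀ n : ℕ, N ≤ n →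
    ∃ M₀ M₁ M₂ : ℕ, (2 : ℝ) ^ ((n : ℝ) * R₀) ≤ M₀ ∧ (2 : ℝ) ^ ((n : ℝ) * R₁) ≤ M₁ ∧
      (2 : ℝ) ^ ((n : ℝ) * R₂) ≤ M₂ ∧
      ∃ (f₁ : Fin M₀ → Fin M₁ → (Fin n → 𝒳₁)) (f₂ : Fin M₀ → Fin M₂ → (Fin n → 𝒳₂))
        (φ₁ : (Fin n → 𝒴₁) → Fin M₀ × Fin M₁) (φ₂ : (Fin n → 𝒴₂) → Fin M₀ × Fin M₂),
        max (messageErrorProb₁ ch f₁ f₂ φ₁) (messageErrorProb₂ ch f₁ f₂ φ₂) ≤ ε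

end CommonInformation

end InterferenceChannel

end

/-! The coding scheme is superposition with rate splitting. Each common message has a word in `W₀`;
given it, user `i` has cloud centers in `Wᵢ` (rate `Sᵢ`) and around each center satellites in `Xᵢ`
(rate `Tᵢ`), with `Rᵢ = Sᵢ + Tᵢ`. Receiver 1 looks for a common message, a cloud and a satellite of
user 1, and some cloud of user 2, for which p(y|w₀w₂x₁) exceeds prescribed multiples of p(y|w₀w₁w₂),
p(y|w₀w₂), p(y|w₀w₁), p(y|w₀) and p(y). A mistake in user 2's cloud alone is no error. The five
kinds of error require T₁ < a₁, S₁+T₁ < b₁, T₁+S₂ < c₁, S₁+T₁+S₂ < d₁, R₀+S₁+T₁+S₂ < e₁, where a₁,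
…, e₁ are the mutual informations of the thirteen inequalities, and receiver 2 adds the mirror
images (`randomCodable_of_decodable`). A change of measure (`sum_mul_accept_le`) bounds the chance
of a false acceptance by the reciprocal of a threshold; Chebyshev's inequality shows that the
transmitted words pass (`eventually_miss_le`).

Elimination of S₁, S₂ (`RateConditions.exists_splitting`) needs, besides the thirteen inequalities
and a ≤ c, b ≤ d, the bounds R₁ < a₁+c₂ and R₂ < a₂+c₁, which are not assumed. If R₁ ≥ a₁+c₂, then
W₁ is useless to receiver 2: with W₁ made trivial, user 1 sending satellites only and user 2 clouds
only, the thirteen inequalities already give all that decoding needs (`Region.randomCodable_of_le`).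

For the source, the strict inequalities leave room to raise all rates by some δ, so K, S', T' can be
compressed separately to H+δ bits per symbol. The indices are not uniform; this is harmless because
the random coding bound holds for every single message, hence on average under any message law.

For the equivalence with the general condition, the inputs do not depend on the sources, so S and T
drop out of every mutual information, while H(S|K)=H(S'), H(S)=H(K)+H(S') and likewise for T. All
mutual informations are computed as differences of expected log-likelihoods of the output
(`IsKernel`), hence depend only on the law of the channel variables; this also gives the statement
on the region with common information. -/

noncomputable section

set_option linter.unusedSectionVars false

namespace InterferenceChannel

/-! ### Probability weights on finite types -/

section FiniteLaws

variable {α β γ ι : Type*} [Fintype α] [Fintype β] [Fintype γ] [Fintype ι] [DecidableEq ι]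

/-- A probability weight on a finite type. -/
structure IsLaw (q : α → ℝ) : Prop where
  nonneg : ∀ a, 0 ≤ q a
  sum_eq_one : ∑ a, q a = 1

/-- The expectation of `f` with respect to the weight `q`. -/
def mean (q : α → ℝ) (f : α → ℝ) : ℝ := ∑ a, q a * f a

theorem IsLaw.mean_const {q : α → ℝ} (hq : IsLaw q) (c : ℝ) : mean q (fun _ => c) = c := by
  simp [mean, ← Finset.sum_mul, hq.sum_eq_one]

theorem mean_congr_of_pos {q f g : α → ℝ} (hq : ∀ a, 0 ≤ q a) (h : ∀ a, 0 < q a → f a = g a) :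
    mean q f = mean q g := by
  refine Finset.sum_congr rfl fun a _ => ?_
  rcases (hq a).eq_or_lt with h0 | h0
  · simp [← h0]
  · rw [h a h0]

theorem mean_mono_of_pos {q f g : α → ℝ} (hq : ∀ a, 0 ≤ q a) (h : ∀ a, 0 < q a → f a ≤ g a) :
    mean q f ≤ mean q g := by
  refine Finset.sum_le_sum fun a _ => ?_
  rcases (hq a).eq_or_lt with h0 | h0
  · simp [← h0]
  · exact mul_le_mul_of_nonneg_left (h a h0) h0.le

theorem mean_mono {q f g : α → ℝ} (hq : ∀ a, 0 ≤ q a) (h : ∀ a, f a ≤ g a) :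
    mean q f ≤ mean q g := mean_mono_of_pos hq fun a _ => h a

theorem IsLaw.mean_le {q : α → ℝ} (hq : IsLaw q) {f : α → ℝ} {c : ℝ} (h : ∀ a, f a ≤ c) :
    mean q f ≤ c := (mean_mono hq.nonneg h).trans_eq (hq.mean_const c)

theorem mean_nonneg {q f : α → ℝ} (hq : ∀ a, 0 ≤ q a) (h : ∀ a, 0 ≤ f a) : 0 ≤ mean q f :=
  Finset.sum_nonneg fun a _ => mul_nonneg (hq a) (h a)

theorem mean_pos_of_pos {q f : α → ℝ} (hq : ∀ a, 0 ≤ q a) (hf : ∀ a, 0 ≤ f a) {a : α}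
    (ha : 0 < q a) (hfa : 0 < f a) : 0 < mean q f :=
  (mul_pos ha hfa).trans_le
    (Finset.single_le_sum (f := fun a => q a * f a) (fun a _ => mul_nonneg (hq a) (hf a))
      (Finset.mem_univ a))

theorem mean_add (q f g : α → ℝ) : mean q (fun a => f a + g a) = mean q f + mean q g := by
  simp [mean, mul_add, Finset.sum_add_distrib]

theorem mean_sub (q f g : α → ℝ) : mean q (fun a => f a - g a) = mean q f - mean q g := by
  simp [mean, mul_sub, Finset.sum_sub_distrib]

theorem mean_mul_left (q : α → ℝ) (c : ℝ) (f : α → ℝ) :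
    mean q (fun a => c * f a) = c * mean q f := by
  simp only [mean, Finset.mul_sum]
  exact Finset.sum_congr rfl fun a _ => by ring

theorem mean_mul_right (q : α → ℝ) (c : ℝ) (f : α → ℝ) :
    mean q (fun a => f a * c) = mean q f * c := by
  simp only [mean, Finset.sum_mul]
  exact Finset.sum_congr rfl fun a _ => by ring

theorem mean_finset_sum {κ : Type*} (s : Finset κ) (q : α → ℝ) (f : κ → α → ℝ) :
    mean q (fun a => ∑ k ∈ s, f k a) = ∑ k ∈ s, mean q (f k) := by
  simp only [mean, Finset.mul_sum]
  exact Finset.sum_comm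

theorem mean_comm (p : α → ℝ) (q : β → ℝ) (f : α → β → ℝ) :
    mean p (fun a => mean q fun b => f a b) = mean q fun b => mean p fun a => f a b := by
  simp only [mean, Finset.mul_sum]
  rw [Finset.sum_comm]
  exact Finset.sum_congr rfl fun a _ => Finset.sum_congr rfl fun b _ => by ring

theorem mean_equiv (e : α ≃ β) (q f : β → ℝ) :
    mean (fun a => q (e a)) (fun a => f (e a)) = mean q f :=
  Fintype.sum_equiv e _ _ fun _ => rfl

/-- A weight that averages `f` to at most `c` has a point with `f ≤ c`. -/
theorem IsLaw.exists_le_of_mean_le {q f : α → ℝ} (hq : IsLaw q) {c : ℝ} (h : mean q f ≤ c) :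
    ∃ a, f a ≤ c := by
  by_contra! hc
  have h1 : mean q (fun a => f a - c) ≤ 0 := by
    rw [mean_sub, hq.mean_const]; linarith
  have h2 : ∀ a, q a * (f a - c) = 0 := by
    have := (Finset.sum_eq_zero_iff_of_nonneg
      (fun a _ => mul_nonneg (hq.nonneg a) (sub_nonneg.2 (hc a).le))).1
      (le_antisymm h1 (mean_nonneg hq.nonneg fun a => sub_nonneg.2 (hc a).le))
    exact fun a => this a (Finset.mem_univ a)
  have h3 : ∀ a, q a = 0 := fun a =>
    (mul_eq_zero.1 (h2 a)).resolve_right (sub_pos.2 (hc a)).ne'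
  have := hq.sum_eq_one
  simp [h3] at this

/-- The weight of a family of independent variables. -/
def indep (q : ι → α → ℝ) : (ι → α) → ℝ := fun f => ∏ i, q i (f i)

theorem mean_indep_prod (q g : ι → α → ℝ) :
    mean (indep q) (fun f => ∏ i, g i (f i)) = ∏ i, mean (q i) (g i) := by
  simp only [mean, indep, ← Finset.prod_mul_distrib]
  rw [Finset.prod_univ_sum]
  simp

theorem isLaw_indep {q : ι → α → ℝ} (hq : ∀ i, IsLaw (q i)) : IsLaw (indep q) where
  nonneg f := Finset.prod_nonneg fun i _ => (hq i).nonneg _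
  sum_eq_one := by
    have := mean_indep_prod q (fun _ _ => 1)
    simpa [mean, (hq _).sum_eq_one] using this

/-- Fubini for one coordinate against all others; the one- and two-coordinate marginals below follow
from it. -/
theorem mean_indep_split (q : ι → α → ℝ) (i : ι) (F : (ι → α) → ℝ) :
    mean (indep q) F = mean (q i) fun a =>
      mean (indep fun j : {j // j ≠ i} => q j) fun f =>
        F ((Equiv.funSplitAt i α).symm (a, f)) := by
  simp only [mean, Finset.mul_sum]
  rw [← Fintype.sum_prod_type', ← Equiv.sum_comp (Equiv.funSplitAt i α).symm]
  refine Finset.sum_congr rfl fun x _ => ?_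
  have h : indep q ((Equiv.funSplitAt i α).symm x) =
      q i x.1 * indep (fun j : {j // j ≠ i} => q j) x.2 := by
    simp only [indep]
    rw [← Finset.mul_prod_erase _ _ (Finset.mem_univ i)]
    congr 1
    · simp [Equiv.funSplitAt, Equiv.piSplitAt]
    · rw [Finset.prod_subtype (p := fun j => j ≠ i) (Finset.univ.erase i) (by simp)
        (fun j => q j ((Equiv.funSplitAt i α).symm x j))]
      refine Finset.prod_congr rfl fun j _ => ?_
      simp [Equiv.funSplitAt, Equiv.piSplitAt, j.2]
  rw [h]; ring

theorem mean_indep_apply {q : ι → α → ℝ} (hq : ∀ i, IsLaw (q i)) (i : ι) (g : α → ℝ) :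
    mean (indep q) (fun f => g (f i)) = mean (q i) g := by
  rw [mean_indep_split q i]
  congr 1
  funext a
  simp [Equiv.funSplitAt, Equiv.piSplitAt, (isLaw_indep fun j : {j // j ≠ i} => hq j).mean_const]

theorem mean_indep_apply₂ {q : ι → α → ℝ} (hq : ∀ i, IsLaw (q i)) {i j : ι} (hij : j ≠ i)
    (g : α → α → ℝ) :
    mean (indep q) (fun f => g (f i) (f j)) =
      mean (q i) fun a => mean (q j) fun b => g a b := by
  rw [mean_indep_split q i]
  congr 1
  funext a
  rw [← mean_indep_apply (fun k : {j // j ≠ i} => hq k) ⟨j, hij⟩ (g a)]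
  simp [Equiv.funSplitAt, Equiv.piSplitAt, hij]

/-- The weight of a pair whose second component has a conditional law. -/
def compound (p : α → ℝ) (q : α → β → ℝ) : α × β → ℝ := fun x => p x.1 * q x.1 x.2

theorem mean_compound (p : α → ℝ) (q : α → β → ℝ) (f : α × β → ℝ) :
    mean (compound p q) f = mean p fun a => mean (q a) fun b => f (a, b) := by
  simp only [mean, compound, Fintype.sum_prod_type, Finset.mul_sum, mul_assoc]

theorem isLaw_compound {p : α → ℝ} {q : α → β → ℝ} (hp : IsLaw p) (hq : ∀ a, IsLaw (q a)) :
    IsLaw (compound p q) where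
  nonneg x := mul_nonneg (hp.nonneg _) ((hq _).nonneg _)
  sum_eq_one := by
    have := mean_compound p q (fun _ => 1)
    simp only [(hq _).mean_const, hp.mean_const] at this
    simpa [mean] using this

/-- Drawing a whole word and then a second word letter by letter given the first is the same as
drawing independent pairs of letters. -/
theorem mean_indep_compound (p : ι → α → ℝ) (q : ι → α → β → ℝ) (F : (ι → α) → (ι → β) → ℝ) :
    (mean (indep p) fun a =>
      mean (indep fun i => q i (a i)) fun b => F a b) =
      mean (indep fun i => compound (p i) (q i)) fun ω =>
        F (fun i => (ω i).1) (fun i => (ω i).2) := by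
  simp only [mean, Finset.mul_sum]
  rw [← Fintype.sum_prod_type',
    ← Equiv.sum_comp (Equiv.arrowProdEquivProdArrow ι (fun _ => α) (fun _ => β))]
  refine Finset.sum_congr rfl fun ω _ => ?_
  simp only [indep, compound, Finset.prod_mul_distrib,
    Equiv.arrowProdEquivProdArrow]
  simp [mul_assoc]

open Classical in
/-- Chebyshev's inequality for the lower tail of a sum of independent copies. -/
theorem mean_lower_tail_le {q : α → ℝ} (hq : IsLaw q) (f : α → ℝ) {n : ℕ} (hn : 0 < n) {δ : ℝ}
    (hδ : 0 < δ) :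
    mean (indep fun _ : Fin n => q)
        (fun ω => if ∑ i, f (ω i) < n * (mean q f - δ) then 1 else 0) ≤
      mean q (fun a => (f a - mean q f) ^ 2) / (n * δ ^ 2) := by
  set μ := mean q f with hμ
  have hn' : (0 : ℝ) < n := Nat.cast_pos.2 hn
  have hL : IsLaw (indep fun _ : Fin n => q) := isLaw_indep fun _ => hq
  -- The indicator is at most the squared deviation over (nδ)². The square is kept as a double sum
  -- so that the mean can be taken pair by pair.
  have h1 : ∀ ω : Fin n → α, (if ∑ i, f (ω i) < n * (μ - δ) then (1 : ℝ) else 0) ≤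
      (∑ i, ∑ j, (f (ω i) - μ) * (f (ω j) - μ)) * (1 / (n * δ) ^ 2) := by
    intro ω
    rw [← Finset.sum_mul_sum]
    have hsum : ∑ i, (f (ω i) - μ) = ∑ i, f (ω i) - n * μ := by
      simp [Finset.sum_sub_distrib]
    rw [hsum]
    split_ifs with h
    · rw [mul_one_div, le_div_iff₀ (by positivity)]
      have : (n : ℝ) * δ ≤ n * μ - ∑ i, f (ω i) := by linarith
      nlinarith [mul_pos hn' hδ]
    · exact mul_nonneg (mul_self_nonneg _) (by positivity)
  refine (mean_mono hL.nonneg h1).trans_eq ?_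
  rw [mean_mul_right, mean_finset_sum]
  simp only [mean_finset_sum]
  -- Distinct coordinates are uncorrelated, so only the n diagonal variances survive.
  have h2 : ∀ i j : Fin n, mean (indep fun _ : Fin n => q)
      (fun ω => (f (ω i) - μ) * (f (ω j) - μ)) =
      if i = j then mean q (fun a => (f a - μ) ^ 2) else 0 := by
    intro i j
    split_ifs with h
    · subst h
      rw [← mean_indep_apply (fun _ => hq) i (fun a => (f a - μ) ^ 2)]
      simp only [sq]
    · rw [mean_indep_apply₂ (fun _ => hq) (Ne.symm h) (fun a b => (f a - μ) * (f b - μ))]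
      simp only [mean_mul_left, mean_sub, hq.mean_const, ← hμ, sub_self, mul_zero]
  simp only [h2, Finset.sum_ite_eq, Finset.mem_univ, if_true, Finset.sum_const, Finset.card_univ,
    Fintype.card_fin, nsmul_eq_mul]
  field_simp

open Classical in
/-- The weak law of large numbers for the lower tail. -/
theorem eventually_mean_lower_tail_le {q : α → ℝ} (hq : IsLaw q) (f : α → ℝ) {δ ε : ℝ}
    (hδ : 0 < δ) (hε : 0 < ε) :
    ∀ᶠ n : ℕ in Filter.atTop, mean (indep fun _ : Fin n => q)
        (fun ω => if ∑ i, f (ω i) < n * (mean q f - δ) then 1 else 0) ≤ ε := by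
  have h : Filter.Tendsto (fun n : ℕ => mean q (fun a => (f a - mean q f) ^ 2) / (n * δ ^ 2))
      Filter.atTop (nhds 0) := by
    apply Filter.Tendsto.div_atTop tendsto_const_nhds
    exact (tendsto_natCast_atTop_atTop).atTop_mul_const (by positivity)
  filter_upwards [h.eventually_le_const hε, Filter.eventually_gt_atTop 0] with n h1 hn
  exact (mean_lower_tail_le hq f hn hδ).trans h1

end FiniteLaws

/-! ### Superposition coding with a threshold decoder, for a single use of the channel -/

/-- The weights `p(w₀) p(w₁|w₀) p(w₂|w₀) p(x₁|w₀ w₁) p(x₂|w₀ w₂)` of the codeword symbols. -/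
structure InputLaw (𝒲₀ 𝒲₁ 𝒲₂ 𝒳₁ 𝒳₂ : Type*) [Fintype 𝒲₀] [Fintype 𝒲₁] [Fintype 𝒲₂]
    [Fintype 𝒳₁] [Fintype 𝒳₂] where
  q₀ : 𝒲₀ → ℝ
  q₁ : 𝒲₀ → 𝒲₁ → ℝ
  q₂ : 𝒲₀ → 𝒲₂ → ℝ
  r₁ : 𝒲₀ → 𝒲₁ → 𝒳₁ → ℝ
  r₂ : 𝒲₀ → 𝒲₂ → 𝒳₂ → ℝ
  law₀ : IsLaw q₀
  law₁ : ∀ w, IsLaw (q₁ w)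
  law₂ : ∀ w, IsLaw (q₂ w)
  lawX₁ : ∀ w v, IsLaw (r₁ w v)
  lawX₂ : ∀ w v, IsLaw (r₂ w v)

namespace InputLaw

section Outputs

variable {𝒲₀ 𝒲₁ 𝒲₂ 𝒳₁ 𝒳₂ 𝒴 : Type*} [Fintype 𝒲₀] [Fintype 𝒲₁] [Fintype 𝒲₂]
    [Fintype 𝒳₁] [Fintype 𝒳₂] [Fintype 𝒴] (L : InputLaw 𝒲₀ 𝒲₁ 𝒲₂ 𝒳₁ 𝒳₂)

/-- The input law with the roles of the two users exchanged. -/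
def swap : InputLaw 𝒲₀ 𝒲₂ 𝒲₁ 𝒳₂ 𝒳₁ where
  q₀ := L.q₀
  q₁ := L.q₂
  q₂ := L.q₁
  r₁ := L.r₂
  r₂ := L.r₁
  law₀ := L.law₀
  law₁ := L.law₂
  law₂ := L.law₁
  lawX₁ := L.lawX₂
  lawX₂ := L.lawX₁

variable (V : 𝒳₁ → 𝒳₂ → 𝒴 → ℝ)

/-- `p(y|w₀ w₂ x₁)`. -/
def outWX (w₀ : 𝒲₀) (w₂ : 𝒲₂) (x₁ : 𝒳₁) (y : 𝒴) : ℝ := mean (L.r₂ w₀ w₂) fun x₂ => V x₁ x₂ y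

/-- `p(y|w₀ w₁ w₂)`. -/
def outWWW (w₀ : 𝒲₀) (w₁ : 𝒲₁) (w₂ : 𝒲₂) (y : 𝒴) : ℝ :=
  mean (L.r₁ w₀ w₁) fun x₁ => L.outWX V w₀ w₂ x₁ y

/-- `p(y|w₀ w₂)`. -/
def outW₂ (w₀ : 𝒲₀) (w₂ : 𝒲₂) (y : 𝒴) : ℝ := mean (L.q₁ w₀) fun w₁ => L.outWWW V w₀ w₁ w₂ y

/-- `p(y|w₀ w₁)`. -/
def outW₁ (w₀ : 𝒲₀) (w₁ : 𝒲₁) (y : 𝒴) : ℝ := mean (L.q₂ w₀) fun w₂ => L.outWWW V w₀ w₁ w₂ y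

/-- `p(y|w₀)`. -/
def outW₀ (w₀ : 𝒲₀) (y : 𝒴) : ℝ := mean (L.q₁ w₀) fun w₁ => L.outW₁ V w₀ w₁ y

/-- `p(y)`. -/
def out (y : 𝒴) : ℝ := mean L.q₀ fun w₀ => L.outW₀ V w₀ y

/-- The values of the variables that decoder 1 compares reach the five thresholds. -/
def Accept (a b c d e : ℝ) (w₀ : 𝒲₀) (w₁ : 𝒲₁) (x₁ : 𝒳₁) (w₂ : 𝒲₂) (y : 𝒴) : Prop :=
  a * L.outWWW V w₀ w₁ w₂ y ≤ L.outWX V w₀ w₂ x₁ y ∧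
  b * L.outW₂ V w₀ w₂ y ≤ L.outWX V w₀ w₂ x₁ y ∧
  c * L.outW₁ V w₀ w₁ y ≤ L.outWX V w₀ w₂ x₁ y ∧
  d * L.outW₀ V w₀ y ≤ L.outWX V w₀ w₂ x₁ y ∧
  e * L.out V y ≤ L.outWX V w₀ w₂ x₁ y

open Classical in
/-- The indicator function of acceptance. -/
def accept (a b c d e : ℝ) (w₀ : 𝒲₀) (w₁ : 𝒲₁) (x₁ : 𝒳₁) (w₂ : 𝒲₂) (y : 𝒴) : ℝ :=
  if L.Accept V a b c d e w₀ w₁ x₁ w₂ y then 1 else 0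

variable {V} (hV : ∀ x₁ x₂, IsLaw (V x₁ x₂))
include hV

theorem isLaw_outWX (w₀ : 𝒲₀) (w₂ : 𝒲₂) (x₁ : 𝒳₁) : IsLaw (L.outWX V w₀ w₂ x₁) where
  nonneg y := mean_nonneg (L.lawX₂ _ _).nonneg fun x₂ => (hV _ _).nonneg _
  sum_eq_one := by
    simp only [outWX, ← mean_finset_sum, (hV _ _).sum_eq_one, (L.lawX₂ _ _).mean_const]

theorem isLaw_outWWW (w₀ : 𝒲₀) (w₁ : 𝒲₁) (w₂ : 𝒲₂) : IsLaw (L.outWWW V w₀ w₁ w₂) where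
  nonneg y := mean_nonneg (L.lawX₁ _ _).nonneg fun x₂ => (L.isLaw_outWX hV _ _ _).nonneg _
  sum_eq_one := by
    simp only [outWWW, ← mean_finset_sum, (L.isLaw_outWX hV _ _ _).sum_eq_one,
      (L.lawX₁ _ _).mean_const]

theorem isLaw_outW₂ (w₀ : 𝒲₀) (w₂ : 𝒲₂) : IsLaw (L.outW₂ V w₀ w₂) where
  nonneg y := mean_nonneg (L.law₁ _).nonneg fun x₂ => (L.isLaw_outWWW hV _ _ _).nonneg _
  sum_eq_one := by
    simp only [outW₂, ← mean_finset_sum, (L.isLaw_outWWW hV _ _ _).sum_eq_one,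
      (L.law₁ _).mean_const]

theorem isLaw_outW₁ (w₀ : 𝒲₀) (w₁ : 𝒲₁) : IsLaw (L.outW₁ V w₀ w₁) where
  nonneg y := mean_nonneg (L.law₂ _).nonneg fun x₂ => (L.isLaw_outWWW hV _ _ _).nonneg _
  sum_eq_one := by
    simp only [outW₁, ← mean_finset_sum, (L.isLaw_outWWW hV _ _ _).sum_eq_one,
      (L.law₂ _).mean_const]

theorem isLaw_outW₀ (w₀ : 𝒲₀) : IsLaw (L.outW₀ V w₀) where
  nonneg y := mean_nonneg (L.law₁ _).nonneg fun x₂ => (L.isLaw_outW₁ hV _ _).nonneg _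
  sum_eq_one := by
    simp only [outW₀, ← mean_finset_sum, (L.isLaw_outW₁ hV _ _).sum_eq_one,
      (L.law₁ _).mean_const]

omit hV in
theorem accept_nonneg (a b c d e : ℝ) (w₀ : 𝒲₀) (w₁ : 𝒲₁) (x₁ : 𝒳₁) (w₂ : 𝒲₂) (y : 𝒴) :
    0 ≤ L.accept V a b c d e w₀ w₁ x₁ w₂ y := by
  unfold accept; split_ifs <;> simp

/-- Change of measure: weights `D` that acceptance bounds by `p(y|w₀ w₂ x₁) / θ` are accepted with
total weight at most `1 / θ`. -/
theorem sum_mul_accept_le {a b c d e θ : ℝ} (hθ : 0 < θ) (w₀ : 𝒲₀) (w₁ : 𝒲₁) (x₁ : 𝒳₁) (w₂ : 𝒲₂)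
    {D : 𝒴 → ℝ} (hD : ∀ y, L.Accept V a b c d e w₀ w₁ x₁ w₂ y → θ * D y ≤ L.outWX V w₀ w₂ x₁ y) :
    ∑ y, D y * L.accept V a b c d e w₀ w₁ x₁ w₂ y ≤ 1 / θ := by
  calc ∑ y, D y * L.accept V a b c d e w₀ w₁ x₁ w₂ y
      ≤ ∑ y, L.outWX V w₀ w₂ x₁ y * (1 / θ) := by
        refine Finset.sum_le_sum fun y _ => ?_
        unfold accept
        split_ifs with h
        · rw [mul_one_div, le_div_iff₀ hθ, mul_one, mul_comm]
          exact hD y h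
        · rw [mul_zero]
          exact mul_nonneg ((L.isLaw_outWX hV _ _ _).nonneg _) (by positivity)
    _ = 1 / θ := by rw [← Finset.sum_mul, (L.isLaw_outWX hV _ _ _).sum_eq_one, one_mul]

variable {a b c d e : ℝ}

/-- The tested words are fixed, and the output comes from words that agree with them only in (w₀,
w₁, w₂). Averaged over the rest, its law is `outWWW`, the denominator of the first test. In the four
companions less is shared and another denominator appears. -/
theorem mean_accept_le_a (ha : 0 < a) (w₀ : 𝒲₀) (w₁ : 𝒲₁) (x₁ : 𝒳₁) (w₂ : 𝒲₂) :
    (mean (L.r₁ w₀ w₁) fun x₁' => mean (L.r₂ w₀ w₂) fun x₂' => mean (V x₁' x₂') fun y =>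
      L.accept V a b c d e w₀ w₁ x₁ w₂ y) ≤ 1 / a := by
  -- Only the innermost average, over outputs, is unfolded. The sum over y then moves to the front
  -- and the remaining averages of V assemble into the denominator of the test.
  simp only [fun x₁ x₂ => mean.eq_1 (V x₁ x₂), mean_finset_sum, mean_mul_right]
  exact L.sum_mul_accept_le hV ha w₀ w₁ x₁ w₂ fun y h => h.1

theorem mean_accept_le_b (hb : 0 < b) (w₀ : 𝒲₀) (w₁ : 𝒲₁) (x₁ : 𝒳₁) (w₂ : 𝒲₂) :
    (mean (L.q₁ w₀) fun w₁' => mean (L.r₁ w₀ w₁') fun x₁' => mean (L.r₂ w₀ w₂) fun x₂' =>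
      mean (V x₁' x₂') fun y => L.accept V a b c d e w₀ w₁ x₁ w₂ y) ≤ 1 / b := by
  simp only [fun x₁ x₂ => mean.eq_1 (V x₁ x₂), mean_finset_sum, mean_mul_right]
  exact L.sum_mul_accept_le hV hb w₀ w₁ x₁ w₂ fun y h => h.2.1

theorem mean_accept_le_c (hc : 0 < c) (w₀ : 𝒲₀) (w₁ : 𝒲₁) (x₁ : 𝒳₁) (w₂ : 𝒲₂) :
    (mean (L.q₂ w₀) fun w₂' => mean (L.r₁ w₀ w₁) fun x₁' => mean (L.r₂ w₀ w₂') fun x₂' =>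
      mean (V x₁' x₂') fun y => L.accept V a b c d e w₀ w₁ x₁ w₂ y) ≤ 1 / c := by
  simp only [fun x₁ x₂ => mean.eq_1 (V x₁ x₂), mean_finset_sum, mean_mul_right]
  exact L.sum_mul_accept_le hV hc w₀ w₁ x₁ w₂ fun y h => h.2.2.1

theorem mean_accept_le_d (hd : 0 < d) (w₀ : 𝒲₀) (w₁ : 𝒲₁) (x₁ : 𝒳₁) (w₂ : 𝒲₂) :
    (mean (L.q₁ w₀) fun w₁' => mean (L.q₂ w₀) fun w₂' => mean (L.r₁ w₀ w₁') fun x₁' =>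
      mean (L.r₂ w₀ w₂') fun x₂' => mean (V x₁' x₂') fun y =>
        L.accept V a b c d e w₀ w₁ x₁ w₂ y) ≤ 1 / d := by
  simp only [fun x₁ x₂ => mean.eq_1 (V x₁ x₂), mean_finset_sum, mean_mul_right]
  exact L.sum_mul_accept_le hV hd w₀ w₁ x₁ w₂ fun y h => h.2.2.2.1

theorem mean_accept_le_e (he : 0 < e) (w₀ : 𝒲₀) (w₁ : 𝒲₁) (x₁ : 𝒳₁) (w₂ : 𝒲₂) :
    (mean L.q₀ fun w₀' => mean (L.q₁ w₀') fun w₁' => mean (L.q₂ w₀') fun w₂' =>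
      mean (L.r₁ w₀' w₁') fun x₁' => mean (L.r₂ w₀' w₂') fun x₂' => mean (V x₁' x₂') fun y =>
        L.accept V a b c d e w₀ w₁ x₁ w₂ y) ≤ 1 / e := by
  simp only [fun x₁ x₂ => mean.eq_1 (V x₁ x₂), mean_finset_sum, mean_mul_right]
  exact L.sum_mul_accept_le hV he w₀ w₁ x₁ w₂ fun y h => h.2.2.2.2

end Outputs

end InputLaw

/-! ### Random codebooks -/

section UserCode

variable {𝒮 𝒯 𝒲 𝒳 : Type*} [Fintype 𝒮] [DecidableEq 𝒮] [Fintype 𝒯] [DecidableEq 𝒯] [Fintype 𝒲]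
  [Fintype 𝒳]

/-- The law of the codewords of one user for a fixed common message: cloud centers `w(s)` and
satellites `x(s,t)`. -/
def userLaw (q : 𝒲 → ℝ) (r : 𝒲 → 𝒳 → ℝ) : (𝒮 → 𝒲 × (𝒯 → 𝒳)) → ℝ :=
  indep fun _ => compound q fun w => indep fun _ => r w

variable {q : 𝒲 → ℝ} {r : 𝒲 → 𝒳 → ℝ} (hq : IsLaw q) (hr : ∀ w, IsLaw (r w))
include hq hr

omit [Fintype 𝒮] [DecidableEq 𝒮] in
theorem isLaw_cloud : IsLaw (compound q fun w => indep fun _ : 𝒯 => r w) :=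
  isLaw_compound hq fun w => isLaw_indep fun _ => hr w

theorem isLaw_userLaw : IsLaw (userLaw q r : (𝒮 → 𝒲 × (𝒯 → 𝒳)) → ℝ) :=
  isLaw_indep fun _ => isLaw_cloud hq hr

theorem mean_userLaw (s : 𝒮) (t : 𝒯) (h : 𝒲 → 𝒳 → ℝ) :
    mean (userLaw q r) (fun u : 𝒮 → 𝒲 × (𝒯 → 𝒳) => h (u s).1 ((u s).2 t)) =
      mean q fun w => mean (r w) fun x => h w x := by
  unfold userLaw
  rw [mean_indep_apply (fun _ => isLaw_cloud hq hr) s fun v : 𝒲 × (𝒯 → 𝒳) => h v.1 (v.2 t),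
    mean_compound]
  congr 1; funext w
  exact mean_indep_apply (fun _ => hr w) t (h w)

/-- Codewords in different clouds are independent. The competitor is averaged outermost, since the
bounds on false acceptance hold for each fixed competitor. -/
theorem mean_userLaw_ne_cloud {s s' : 𝒮} (hs : s' ≠ s) (t t' : 𝒯) (h : 𝒲 → 𝒳 → 𝒲 → 𝒳 → ℝ) :
    mean (userLaw q r) (fun u : 𝒮 → 𝒲 × (𝒯 → 𝒳) =>
        h (u s).1 ((u s).2 t) (u s').1 ((u s').2 t')) =
      mean q fun w' => mean (r w') fun x' => mean q fun w => mean (r w) fun x => h w x w' x' := by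
  unfold userLaw
  rw [mean_indep_apply₂ (fun _ => isLaw_cloud hq hr) hs.symm
    fun v' v : 𝒲 × (𝒯 → 𝒳) => h v.1 (v.2 t) v'.1 (v'.2 t'), mean_compound]
  congr 1; funext w'
  rw [← mean_indep_apply (fun _ => hr w') t']
  congr 1; funext f
  rw [mean_compound]
  congr 1; funext w
  exact mean_indep_apply (fun _ => hr w) t fun x => h w x w' (f t')

/-- Two satellites of one cloud are independent only conditionally on their common center w. -/
theorem mean_userLaw_ne_satellite (s : 𝒮) {t t' : 𝒯} (ht : t' ≠ t) (h : 𝒲 → 𝒳 → 𝒳 → ℝ) :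
    mean (userLaw q r) (fun u : 𝒮 → 𝒲 × (𝒯 → 𝒳) => h (u s).1 ((u s).2 t) ((u s).2 t')) =
      mean q fun w => mean (r w) fun x' => mean (r w) fun x => h w x x' := by
  unfold userLaw
  rw [mean_indep_apply (fun _ => isLaw_cloud hq hr) s
    fun v : 𝒲 × (𝒯 → 𝒳) => h v.1 (v.2 t) (v.2 t'), mean_compound]
  congr 1; funext w
  exact mean_indep_apply₂ (fun _ => hr w) ht.symm fun x' x => h w x x'

end UserCode

theorem card_univ_erase {κ : Type*} [Fintype κ] [DecidableEq κ] (k : κ) :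
    (Finset.univ.erase k).card = Fintype.card κ - 1 := by
  rw [Finset.card_erase_of_mem (Finset.mem_univ _), Finset.card_univ]

/-- A sum over all index tuples that differ from a given one in `M × S × T`, sorted by the
components that differ. -/
theorem one_le_sum_ne {M S T S' : Type*} [Fintype M] [DecidableEq M] [Fintype S] [DecidableEq S]
    [Fintype T] [DecidableEq T] [Fintype S'] [DecidableEq S'] {A : M → S → T → S' → ℝ}
    (hn : ∀ m s t s', 0 ≤ A m s t s') {m₀ m₀' : M} {s₁ s₁' : S} {t₁ t₁' : T} (s₂ : S') {s₂' : S'}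
    (hs₂' : A m₀' s₁' t₁' s₂' = 1) (hne : (m₀', s₁', t₁') ≠ (m₀, s₁, t₁)) :
    1 ≤ (∑ t₁' ∈ Finset.univ.erase t₁, A m₀ s₁ t₁' s₂) +
      (∑ s₁' ∈ Finset.univ.erase s₁, ∑ t₁', A m₀ s₁' t₁' s₂) +
      (∑ t₁' ∈ Finset.univ.erase t₁, ∑ s₂' ∈ Finset.univ.erase s₂, A m₀ s₁ t₁' s₂') +
      (∑ s₁' ∈ Finset.univ.erase s₁, ∑ t₁', ∑ s₂' ∈ Finset.univ.erase s₂, A m₀ s₁' t₁' s₂') +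
      (∑ m₀' ∈ Finset.univ.erase m₀, ∑ s₁', ∑ t₁', ∑ s₂', A m₀' s₁' t₁' s₂') := by
  have h1 : 0 ≤ ∑ t₁' ∈ Finset.univ.erase t₁, A m₀ s₁ t₁' s₂ :=
    Finset.sum_nonneg fun _ _ => hn _ _ _ _
  have h2 : 0 ≤ ∑ s₁' ∈ Finset.univ.erase s₁, ∑ t₁', A m₀ s₁' t₁' s₂ :=
    Finset.sum_nonneg fun _ _ => Finset.sum_nonneg fun _ _ => hn _ _ _ _
  have h3 : 0 ≤ ∑ t₁' ∈ Finset.univ.erase t₁, ∑ s₂' ∈ Finset.univ.erase s₂, A m₀ s₁ t₁' s₂' :=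
    Finset.sum_nonneg fun _ _ => Finset.sum_nonneg fun _ _ => hn _ _ _ _
  have h4 : 0 ≤ ∑ s₁' ∈ Finset.univ.erase s₁, ∑ t₁', ∑ s₂' ∈ Finset.univ.erase s₂,
      A m₀ s₁' t₁' s₂' :=
    Finset.sum_nonneg fun _ _ => Finset.sum_nonneg fun _ _ => Finset.sum_nonneg fun _ _ =>
      hn _ _ _ _
  have h5 : 0 ≤ ∑ m₀' ∈ Finset.univ.erase m₀, ∑ s₁', ∑ t₁', ∑ s₂', A m₀' s₁' t₁' s₂' :=
    Finset.sum_nonneg fun _ _ => Finset.sum_nonneg fun _ _ => Finset.sum_nonneg fun _ _ =>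
      Finset.sum_nonneg fun _ _ => hn _ _ _ _
  by_cases hm : m₀' = m₀
  swap
  · have := Finset.single_le_sum (f := fun m₀' => ∑ s₁', ∑ t₁', ∑ s₂', A m₀' s₁' t₁' s₂')
      (fun _ _ => Finset.sum_nonneg fun _ _ => Finset.sum_nonneg fun _ _ =>
        Finset.sum_nonneg fun _ _ => hn _ _ _ _)
      (Finset.mem_erase.2 ⟨hm, Finset.mem_univ _⟩)
    have h6 := Finset.single_le_sum (f := fun s₁' => ∑ t₁', ∑ s₂', A m₀' s₁' t₁' s₂')
      (fun _ _ => Finset.sum_nonneg fun _ _ => Finset.sum_nonneg fun _ _ => hn _ _ _ _)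
      (Finset.mem_univ s₁')
    have h7 := Finset.single_le_sum (f := fun t₁' => ∑ s₂', A m₀' s₁' t₁' s₂')
      (fun _ _ => Finset.sum_nonneg fun _ _ => hn _ _ _ _) (Finset.mem_univ t₁')
    have h8 := Finset.single_le_sum (f := fun s₂' => A m₀' s₁' t₁' s₂')
      (fun _ _ => hn _ _ _ _) (Finset.mem_univ s₂')
    linarith
  subst hm
  by_cases hs : s₁' = s₁
  swap
  · by_cases hs' : s₂' = s₂
    · subst hs'
      have := Finset.single_le_sum (f := fun s₁' => ∑ t₁', A m₀' s₁' t₁' s₂')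
        (fun _ _ => Finset.sum_nonneg fun _ _ => hn _ _ _ _)
        (Finset.mem_erase.2 ⟨hs, Finset.mem_univ _⟩)
      have h6 := Finset.single_le_sum (f := fun t₁' => A m₀' s₁' t₁' s₂')
        (fun _ _ => hn _ _ _ _) (Finset.mem_univ t₁')
      linarith
    · have := Finset.single_le_sum
        (f := fun s₁' => ∑ t₁', ∑ s₂' ∈ Finset.univ.erase s₂, A m₀' s₁' t₁' s₂')
        (fun _ _ => Finset.sum_nonneg fun _ _ => Finset.sum_nonneg fun _ _ => hn _ _ _ _)
        (Finset.mem_erase.2 ⟨hs, Finset.mem_univ _⟩)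
      have h6 := Finset.single_le_sum
        (f := fun t₁' => ∑ s₂' ∈ Finset.univ.erase s₂, A m₀' s₁' t₁' s₂')
        (fun _ _ => Finset.sum_nonneg fun _ _ => hn _ _ _ _) (Finset.mem_univ t₁')
      have h7 := Finset.single_le_sum (f := fun s₂' => A m₀' s₁' t₁' s₂')
        (fun _ _ => hn _ _ _ _) (Finset.mem_erase.2 ⟨hs', Finset.mem_univ _⟩)
      linarith
  subst hs
  -- With the common message and the cloud correct, the satellite must be wrong: an accepted tuple
  -- that differs only in the cloud of user 2 is not an error.
  have ht : t₁' ≠ t₁ := fun h => hne (by rw [h])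
  by_cases hs' : s₂' = s₂
  · subst hs'
    have := Finset.single_le_sum (f := fun t₁' => A m₀' s₁' t₁' s₂')
      (fun _ _ => hn _ _ _ _) (Finset.mem_erase.2 ⟨ht, Finset.mem_univ _⟩)
    linarith
  · have := Finset.single_le_sum
      (f := fun t₁' => ∑ s₂' ∈ Finset.univ.erase s₂, A m₀' s₁' t₁' s₂')
      (fun _ _ => Finset.sum_nonneg fun _ _ => hn _ _ _ _)
      (Finset.mem_erase.2 ⟨ht, Finset.mem_univ _⟩)
    have h7 := Finset.single_le_sum (f := fun s₂' => A m₀' s₁' t₁' s₂')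
      (fun _ _ => hn _ _ _ _) (Finset.mem_erase.2 ⟨hs', Finset.mem_univ _⟩)
    linarith

namespace InputLaw

section OneShot

variable {𝒲₀ 𝒲₁ 𝒲₂ 𝒳₁ 𝒳₂ 𝒴 M₀ S₁ T₁ S₂ T₂ : Type*} [Fintype 𝒲₀] [Fintype 𝒲₁] [Fintype 𝒲₂]
  [Fintype 𝒳₁] [Fintype 𝒳₂] [Fintype 𝒴]
  [Fintype S₁] [DecidableEq S₁] [Fintype T₁] [DecidableEq T₁]
  [Fintype S₂] [DecidableEq S₂] [Fintype T₂] [DecidableEq T₂]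
  (L : InputLaw 𝒲₀ 𝒲₁ 𝒲₂ 𝒳₁ 𝒳₂)

/-- The law of all codewords that belong to one common message. -/
def cellLaw : 𝒲₀ × (S₁ → 𝒲₁ × (T₁ → 𝒳₁)) × (S₂ → 𝒲₂ × (T₂ → 𝒳₂)) → ℝ :=
  compound L.q₀ fun w => compound (userLaw (L.q₁ w) (L.r₁ w)) fun _ => userLaw (L.q₂ w) (L.r₂ w)

theorem isLaw_user₁ (w : 𝒲₀) :
    IsLaw (userLaw (L.q₁ w) (L.r₁ w) : (S₁ → 𝒲₁ × (T₁ → 𝒳₁)) → ℝ) :=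
  isLaw_userLaw (L.law₁ w) (L.lawX₁ w)

theorem isLaw_user₂ (w : 𝒲₀) :
    IsLaw (userLaw (L.q₂ w) (L.r₂ w) : (S₂ → 𝒲₂ × (T₂ → 𝒳₂)) → ℝ) :=
  isLaw_userLaw (L.law₂ w) (L.lawX₂ w)

theorem isLaw_cellLaw :
    IsLaw (L.cellLaw : 𝒲₀ × (S₁ → 𝒲₁ × (T₁ → 𝒳₁)) × (S₂ → 𝒲₂ × (T₂ → 𝒳₂)) → ℝ) :=
  isLaw_compound L.law₀ fun w => isLaw_compound (L.isLaw_user₁ w) fun _ => L.isLaw_user₂ w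

variable (V : 𝒳₁ → 𝒳₂ → 𝒴 → ℝ) (a b c d e : ℝ)

/-- The probability that the transmitted codewords are not accepted. -/
def miss : ℝ :=
  mean L.q₀ fun w₀ => mean (L.q₁ w₀) fun w₁ => mean (L.r₁ w₀ w₁) fun x₁ =>
    mean (L.q₂ w₀) fun w₂ => mean (L.r₂ w₀ w₂) fun x₂ => mean (V x₁ x₂) fun y =>
      1 - L.accept V a b c d e w₀ w₁ x₁ w₂ y

/-- Acceptance of the codewords with given indices in a cell. -/
def cellAccept (z : 𝒲₀ × (S₁ → 𝒲₁ × (T₁ → 𝒳₁)) × (S₂ → 𝒲₂ × (T₂ → 𝒳₂))) (s₁ : S₁) (t₁ : T₁)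
    (s₂ : S₂) (y : 𝒴) : ℝ :=
  L.accept V a b c d e z.1 (z.2.1 s₁).1 ((z.2.1 s₁).2 t₁) (z.2.2 s₂).1 y

/-- The law of the output for the codewords with given indices in a cell. -/
def cellOut (V : 𝒳₁ → 𝒳₂ → 𝒴 → ℝ) (z : 𝒲₀ × (S₁ → 𝒲₁ × (T₁ → 𝒳₁)) × (S₂ → 𝒲₂ × (T₂ → 𝒳₂)))
    (s₁ : S₁) (t₁ : T₁) (s₂ : S₂) (t₂ : T₂) : 𝒴 → ℝ :=
  V ((z.2.1 s₁).2 t₁) ((z.2.2 s₂).2 t₂)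

theorem mean_cell_miss (s₁ : S₁) (t₁ : T₁) (s₂ : S₂) (t₂ : T₂) :
    (mean L.cellLaw fun z => mean (cellOut V z s₁ t₁ s₂ t₂) fun y =>
      1 - L.cellAccept V a b c d e z s₁ t₁ s₂ y) = L.miss V a b c d e := by
  simp only [cellLaw, mean_compound, cellOut, cellAccept, miss]
  congr 1; funext w₀
  rw [← mean_userLaw (L.law₁ w₀) (L.lawX₁ w₀) s₁ t₁]
  congr 1; funext u
  exact mean_userLaw (L.law₂ w₀) (L.lawX₂ w₀) s₂ t₂ fun w₂ x₂ => mean (V _ x₂) fun y =>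
    1 - L.accept V a b c d e w₀ _ _ w₂ y

variable {V a b c d e} (hV : ∀ x₁ x₂, IsLaw (V x₁ x₂))
include hV

theorem mean_cell_satellite_le (ha : 0 < a) (s₁ : S₁) {t₁ t₁' : T₁} (ht : t₁' ≠ t₁) (s₂ : S₂)
    (t₂ : T₂) :
    (mean L.cellLaw fun z => mean (cellOut V z s₁ t₁ s₂ t₂) fun y =>
      L.cellAccept V a b c d e z s₁ t₁' s₂ y) ≤ 1 / a := by
  simp only [cellLaw, mean_compound, cellOut, cellAccept]
  refine L.law₀.mean_le fun w₀ => ?_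
  simp only [fun u : S₁ → 𝒲₁ × (T₁ → 𝒳₁) => mean_userLaw (L.law₂ w₀) (L.lawX₂ w₀) s₂ t₂
    fun w₂ x₂ => mean (V ((u s₁).2 t₁) x₂) fun y =>
      L.accept V a b c d e w₀ (u s₁).1 ((u s₁).2 t₁') w₂ y]
  rw [mean_comm]
  refine (L.law₂ _).mean_le fun w₂ => ?_
  rw [mean_userLaw_ne_satellite (L.law₁ w₀) (L.lawX₁ w₀) s₁ ht
    fun w₁ x₁ x₁' => mean (L.r₂ w₀ w₂) fun x₂ => mean (V x₁ x₂) fun y =>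
      L.accept V a b c d e w₀ w₁ x₁' w₂ y]
  exact (L.law₁ _).mean_le fun w₁ => (L.lawX₁ _ _).mean_le fun x₁ =>
    L.mean_accept_le_a hV ha w₀ w₁ x₁ w₂

theorem mean_cell_cloud_le (hb : 0 < b) {s₁ s₁' : S₁} (hs : s₁' ≠ s₁) (t₁ t₁' : T₁) (s₂ : S₂)
    (t₂ : T₂) :
    (mean L.cellLaw fun z => mean (cellOut V z s₁ t₁ s₂ t₂) fun y =>
      L.cellAccept V a b c d e z s₁' t₁' s₂ y) ≤ 1 / b := by
  simp only [cellLaw, mean_compound, cellOut, cellAccept]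
  refine L.law₀.mean_le fun w₀ => ?_
  simp only [fun u : S₁ → 𝒲₁ × (T₁ → 𝒳₁) => mean_userLaw (L.law₂ w₀) (L.lawX₂ w₀) s₂ t₂
    fun w₂ x₂ => mean (V ((u s₁).2 t₁) x₂) fun y =>
      L.accept V a b c d e w₀ (u s₁').1 ((u s₁').2 t₁') w₂ y]
  rw [mean_comm]
  refine (L.law₂ _).mean_le fun w₂ => ?_
  rw [mean_userLaw_ne_cloud (L.law₁ w₀) (L.lawX₁ w₀) hs t₁ t₁'
    fun w₁ x₁ w₁' x₁' => mean (L.r₂ w₀ w₂) fun x₂ => mean (V x₁ x₂) fun y =>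
      L.accept V a b c d e w₀ w₁' x₁' w₂ y]
  exact (L.law₁ _).mean_le fun w₁ => (L.lawX₁ _ _).mean_le fun x₁ =>
    L.mean_accept_le_b hV hb w₀ w₁ x₁ w₂

theorem mean_cell_satellite_cloud_le (hc : 0 < c) (s₁ : S₁) {t₁ t₁' : T₁} (ht : t₁' ≠ t₁)
    {s₂ s₂' : S₂} (hs : s₂' ≠ s₂) (t₂ : T₂) :
    (mean L.cellLaw fun z => mean (cellOut V z s₁ t₁ s₂ t₂) fun y =>
      L.cellAccept V a b c d e z s₁ t₁' s₂' y) ≤ 1 / c := by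
  simp only [cellLaw, mean_compound, cellOut, cellAccept]
  refine L.law₀.mean_le fun w₀ => ?_
  -- Decoder 1 never looks at satellites of user 2, so the satellite index of the competing cloud is
  -- immaterial and `t₂` is used for it too.
  simp only [fun u : S₁ → 𝒲₁ × (T₁ → 𝒳₁) => mean_userLaw_ne_cloud (L.law₂ w₀) (L.lawX₂ w₀) hs t₂ t₂
    fun w₂ x₂ w₂' _ => mean (V ((u s₁).2 t₁) x₂) fun y =>
      L.accept V a b c d e w₀ (u s₁).1 ((u s₁).2 t₁') w₂' y]
  rw [mean_comm]
  refine (L.law₂ _).mean_le fun w₂' => ?_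
  rw [mean_comm]
  refine (L.lawX₂ _ _).mean_le fun x₂' => ?_
  rw [mean_userLaw_ne_satellite (L.law₁ w₀) (L.lawX₁ w₀) s₁ ht
    fun w₁ x₁ x₁' => mean (L.q₂ w₀) fun w₂ => mean (L.r₂ w₀ w₂) fun x₂ => mean (V x₁ x₂) fun y =>
      L.accept V a b c d e w₀ w₁ x₁' w₂' y]
  refine (L.law₁ _).mean_le fun w₁ => (L.lawX₁ _ _).mean_le fun x₁ => ?_
  rw [mean_comm]
  exact L.mean_accept_le_c hV hc w₀ w₁ x₁ w₂'

theorem mean_cell_cloud_cloud_le (hd : 0 < d) {s₁ s₁' : S₁} (hs₁ : s₁' ≠ s₁) (t₁ t₁' : T₁)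
    {s₂ s₂' : S₂} (hs : s₂' ≠ s₂) (t₂ : T₂) :
    (mean L.cellLaw fun z => mean (cellOut V z s₁ t₁ s₂ t₂) fun y =>
      L.cellAccept V a b c d e z s₁' t₁' s₂' y) ≤ 1 / d := by
  simp only [cellLaw, mean_compound, cellOut, cellAccept]
  refine L.law₀.mean_le fun w₀ => ?_
  simp only [fun u : S₁ → 𝒲₁ × (T₁ → 𝒳₁) => mean_userLaw_ne_cloud (L.law₂ w₀) (L.lawX₂ w₀) hs t₂ t₂
    fun w₂ x₂ w₂' _ => mean (V ((u s₁).2 t₁) x₂) fun y =>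
      L.accept V a b c d e w₀ (u s₁').1 ((u s₁').2 t₁') w₂' y]
  rw [mean_comm]
  refine (L.law₂ _).mean_le fun w₂' => ?_
  rw [mean_comm]
  refine (L.lawX₂ _ _).mean_le fun x₂' => ?_
  rw [mean_userLaw_ne_cloud (L.law₁ w₀) (L.lawX₁ w₀) hs₁ t₁ t₁'
    fun w₁ x₁ w₁' x₁' => mean (L.q₂ w₀) fun w₂ => mean (L.r₂ w₀ w₂) fun x₂ =>
      mean (V x₁ x₂) fun y => L.accept V a b c d e w₀ w₁' x₁' w₂' y]
  refine (L.law₁ _).mean_le fun w₁ => (L.lawX₁ _ _).mean_le fun x₁ => ?_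
  simp only [fun w₁ => mean_comm (L.r₁ w₀ w₁) (L.q₂ w₀)]
  exact L.mean_accept_le_d hV hd w₀ w₁ x₁ w₂'

theorem mean_cell_other_le (he : 0 < e) (s₁ s₁' : S₁) (t₁ t₁' : T₁) (s₂ s₂' : S₂) (t₂ : T₂) :
    (mean L.cellLaw fun z' : 𝒲₀ × (S₁ → 𝒲₁ × (T₁ → 𝒳₁)) × (S₂ → 𝒲₂ × (T₂ → 𝒳₂)) =>
      mean L.cellLaw fun z => mean (cellOut V z s₁ t₁ s₂ t₂) fun y =>
        L.cellAccept V a b c d e z' s₁' t₁' s₂' y) ≤ 1 / e := by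
  refine L.isLaw_cellLaw.mean_le fun z' => ?_
  simp only [cellLaw, mean_compound, cellOut, cellAccept]
  -- The competing cell is independent of the transmitted one, so its codewords may be frozen; the
  -- output then has law p(y).
  generalize z'.1 = w₀', (z'.2.1 s₁').1 = w₁', (z'.2.1 s₁').2 t₁' = x₁', (z'.2.2 s₂').1 = w₂'
  refine le_trans (le_of_eq ?_) (L.mean_accept_le_e (a := a) (b := b) (c := c)
    (d := d) hV he w₀' w₁' x₁' w₂')
  congr 1; funext w₀
  simp only [fun w₁ => mean_comm (L.q₂ w₀) (L.r₁ w₀ w₁)]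
  rw [← mean_userLaw (L.law₁ w₀) (L.lawX₁ w₀) s₁ t₁]
  congr 1; funext u
  exact mean_userLaw (L.law₂ w₀) (L.lawX₂ w₀) s₂ t₂ fun w₂ x₂ => mean (V _ x₂) fun y =>
    L.accept V a b c d e w₀' w₁' x₁' w₂' y

variable [Fintype M₀] [DecidableEq M₀] [Nonempty M₀] [Nonempty S₁] [Nonempty T₁]

omit hV

open Classical in
/-- The threshold decoder. -/
def decode (V : 𝒳₁ → 𝒳₂ → 𝒴 → ℝ) (a b c d e : ℝ)
    (C : M₀ → 𝒲₀ × (S₁ → 𝒲₁ × (T₁ → 𝒳₁)) × (S₂ → 𝒲₂ × (T₂ → 𝒳₂))) (y : 𝒴) : M₀ × S₁ × T₁ :=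
  if h : ∃ m : M₀ × S₁ × T₁, ∃ s₂, L.cellAccept V a b c d e (C m.1) m.2.1 m.2.2 s₂ y = 1 then
    h.choose else Classical.arbitrary _

theorem cellAccept_nonneg (z : 𝒲₀ × (S₁ → 𝒲₁ × (T₁ → 𝒳₁)) × (S₂ → 𝒲₂ × (T₂ → 𝒳₂)))
    (s₁ : S₁) (t₁ : T₁) (s₂ : S₂) (y : 𝒴) : 0 ≤ L.cellAccept V a b c d e z s₁ t₁ s₂ y :=
  L.accept_nonneg _ _ _ _ _ _ _ _ _ _

theorem cellAccept_eq_zero_or_one (z : 𝒲₀ × (S₁ → 𝒲₁ × (T₁ → 𝒳₁)) × (S₂ → 𝒲₂ × (T₂ → 𝒳₂)))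
    (s₁ : S₁) (t₁ : T₁) (s₂ : S₂) (y : 𝒴) :
    L.cellAccept V a b c d e z s₁ t₁ s₂ y = 0 ∨ L.cellAccept V a b c d e z s₁ t₁ s₂ y = 1 := by
  unfold cellAccept accept; split_ifs <;> simp

open Classical in
/-- The union bound for the threshold decoder. -/
theorem decode_error_le (C : M₀ → 𝒲₀ × (S₁ → 𝒲₁ × (T₁ → 𝒳₁)) × (S₂ → 𝒲₂ × (T₂ → 𝒳₂)))
    (m₀ : M₀) (s₁ : S₁) (t₁ : T₁) (s₂ : S₂) (y : 𝒴) :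
    (if L.decode V a b c d e C y ≠ (m₀, s₁, t₁) then (1 : ℝ) else 0) ≤
      (1 - L.cellAccept V a b c d e (C m₀) s₁ t₁ s₂ y) +
      (∑ t₁' ∈ Finset.univ.erase t₁, L.cellAccept V a b c d e (C m₀) s₁ t₁' s₂ y) +
      (∑ s₁' ∈ Finset.univ.erase s₁, ∑ t₁', L.cellAccept V a b c d e (C m₀) s₁' t₁' s₂ y) +
      (∑ t₁' ∈ Finset.univ.erase t₁, ∑ s₂' ∈ Finset.univ.erase s₂,
        L.cellAccept V a b c d e (C m₀) s₁ t₁' s₂' y) +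
      (∑ s₁' ∈ Finset.univ.erase s₁, ∑ t₁', ∑ s₂' ∈ Finset.univ.erase s₂,
        L.cellAccept V a b c d e (C m₀) s₁' t₁' s₂' y) +
      (∑ m₀' ∈ Finset.univ.erase m₀, ∑ s₁', ∑ t₁', ∑ s₂',
        L.cellAccept V a b c d e (C m₀') s₁' t₁' s₂' y) := by
  have hn : ∀ m s t s', 0 ≤ L.cellAccept V a b c d e (C m) s t s' y :=
    fun m s t s' => L.cellAccept_nonneg _ _ _ _ _
  have h0 : 0 ≤ 1 - L.cellAccept V a b c d e (C m₀) s₁ t₁ s₂ y := by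
    rcases L.cellAccept_eq_zero_or_one (V := V) (a := a) (b := b) (c := c) (d := d) (e := e)
      (C m₀) s₁ t₁ s₂ y with h | h <;> rw [h] <;> norm_num
  have hE : ∀ (F : Finset S₁) (G : Finset T₁) (H : Finset S₂), 0 ≤ ∑ s ∈ F, ∑ t ∈ G, ∑ s' ∈ H,
      L.cellAccept V a b c d e (C m₀) s t s' y := fun F G H => Finset.sum_nonneg fun _ _ =>
    Finset.sum_nonneg fun _ _ => Finset.sum_nonneg fun _ _ => hn _ _ _ _
  split_ifs with hne
  swap
  · refine add_nonneg (add_nonneg (add_nonneg (add_nonneg (add_nonneg h0 ?_) ?_) ?_) ?_) ?_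
    · exact Finset.sum_nonneg fun _ _ => hn _ _ _ _
    · exact Finset.sum_nonneg fun _ _ => Finset.sum_nonneg fun _ _ => hn _ _ _ _
    · exact Finset.sum_nonneg fun _ _ => Finset.sum_nonneg fun _ _ => hn _ _ _ _
    · exact hE _ _ _
    · exact Finset.sum_nonneg fun _ _ => Finset.sum_nonneg fun _ _ => Finset.sum_nonneg fun _ _ =>
        Finset.sum_nonneg fun _ _ => hn _ _ _ _
  -- If anything is accepted, the output of the decoder is accepted, so an error exhibits a wrong
  -- accepted tuple. If nothing is accepted, the transmitted tuple is rejected and the first term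
  -- equals 1.
  by_cases hex : ∃ m : M₀ × S₁ × T₁, ∃ s₂, L.cellAccept V a b c d e (C m.1) m.2.1 m.2.2 s₂ y = 1
  · have hdec : L.decode V a b c d e C y = hex.choose := dif_pos hex
    obtain ⟨s₂', hs₂'⟩ := hex.choose_spec
    rw [← hdec] at hs₂'
    have := one_le_sum_ne (A := fun m s t s' => L.cellAccept V a b c d e (C m) s t s' y) hn s₂
      hs₂' hne
    linarith
  · have : L.cellAccept V a b c d e (C m₀) s₁ t₁ s₂ y = 0 :=
      (L.cellAccept_eq_zero_or_one _ _ _ _ _).resolve_right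
        fun h => hex ⟨(m₀, s₁, t₁), s₂, h⟩
    rw [this]
    have h1 : 0 ≤ ∑ t₁' ∈ Finset.univ.erase t₁, L.cellAccept V a b c d e (C m₀) s₁ t₁' s₂ y :=
      Finset.sum_nonneg fun _ _ => hn _ _ _ _
    have h2 : 0 ≤ ∑ s₁' ∈ Finset.univ.erase s₁, ∑ t₁',
        L.cellAccept V a b c d e (C m₀) s₁' t₁' s₂ y :=
      Finset.sum_nonneg fun _ _ => Finset.sum_nonneg fun _ _ => hn _ _ _ _
    have h3 : 0 ≤ ∑ t₁' ∈ Finset.univ.erase t₁, ∑ s₂' ∈ Finset.univ.erase s₂,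
        L.cellAccept V a b c d e (C m₀) s₁ t₁' s₂' y :=
      Finset.sum_nonneg fun _ _ => Finset.sum_nonneg fun _ _ => hn _ _ _ _
    have h4 := hE (Finset.univ.erase s₁) Finset.univ (Finset.univ.erase s₂)
    have h5 : 0 ≤ ∑ m₀' ∈ Finset.univ.erase m₀, ∑ s₁', ∑ t₁', ∑ s₂',
        L.cellAccept V a b c d e (C m₀') s₁' t₁' s₂' y :=
      Finset.sum_nonneg fun _ _ => Finset.sum_nonneg fun _ _ => Finset.sum_nonneg fun _ _ =>
        Finset.sum_nonneg fun _ _ => hn _ _ _ _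
    linarith

open Classical in
/-- The error probability of the threshold decoder for a given message, averaged over the random
codebooks. -/
theorem mean_decode_error_le (hV : ∀ x₁ x₂, IsLaw (V x₁ x₂)) (ha : 0 < a) (hb : 0 < b)
    (hc : 0 < c) (hd : 0 < d) (he : 0 < e) (m₀ : M₀) (s₁ : S₁) (t₁ : T₁) (s₂ : S₂) (t₂ : T₂) :
    (mean (indep fun _ : M₀ => L.cellLaw) fun C => mean (cellOut V (C m₀) s₁ t₁ s₂ t₂) fun y =>
      if L.decode V a b c d e C y ≠ (m₀, s₁, t₁) then (1 : ℝ) else 0) ≤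
      L.miss V a b c d e + (Fintype.card T₁ - 1 : ℕ) * (1 / a) +
      (Fintype.card S₁ - 1 : ℕ) * (Fintype.card T₁ * (1 / b)) +
      (Fintype.card T₁ - 1 : ℕ) * ((Fintype.card S₂ - 1 : ℕ) * (1 / c)) +
      (Fintype.card S₁ - 1 : ℕ) * (Fintype.card T₁ * ((Fintype.card S₂ - 1 : ℕ) * (1 / d))) +
      (Fintype.card M₀ - 1 : ℕ) *
        (Fintype.card S₁ * (Fintype.card T₁ * (Fintype.card S₂ * (1 / e)))) := by
  have hlaw : ∀ _ : M₀, IsLaw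
      (L.cellLaw : 𝒲₀ × (S₁ → 𝒲₁ × (T₁ → 𝒳₁)) × (S₂ → 𝒲₂ × (T₂ → 𝒳₂)) → ℝ) :=
    fun _ => L.isLaw_cellLaw
  refine (mean_mono (isLaw_indep hlaw).nonneg fun C =>
    mean_mono (hV _ _).nonneg fun y => L.decode_error_le C m₀ s₁ t₁ s₂ y).trans ?_
  simp only [mean_add, mean_finset_sum]
  have hcell := fun h => mean_indep_apply hlaw m₀ h
  gcongr ?_ + ?_ + ?_ + ?_ + ?_ + ?_
  · exact (hcell fun z => mean (cellOut V z s₁ t₁ s₂ t₂) fun y =>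
      1 - L.cellAccept V a b c d e z s₁ t₁ s₂ y).trans_le (L.mean_cell_miss V a b c d e _ _ _ _).le
  · rw [← card_univ_erase t₁]
    refine Finset.sum_le_card_nsmul _ _ _ (fun t₁' ht => ?_) |>.trans_eq (nsmul_eq_mul _ _)
    exact (hcell fun z => mean (cellOut V z s₁ t₁ s₂ t₂) fun y =>
      L.cellAccept V a b c d e z s₁ t₁' s₂ y).trans_le
      (L.mean_cell_satellite_le hV ha s₁ (Finset.ne_of_mem_erase ht) s₂ t₂)
  · rw [← card_univ_erase s₁]
    refine Finset.sum_le_card_nsmul _ _ _ (fun s₁' hs => ?_) |>.trans_eq (nsmul_eq_mul _ _)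
    refine Finset.sum_le_card_nsmul _ _ _ (fun t₁' _ => ?_) |>.trans_eq (nsmul_eq_mul _ _)
    exact (hcell fun z => mean (cellOut V z s₁ t₁ s₂ t₂) fun y =>
      L.cellAccept V a b c d e z s₁' t₁' s₂ y).trans_le
      (L.mean_cell_cloud_le hV hb (Finset.ne_of_mem_erase hs) t₁ t₁' s₂ t₂)
  · rw [← card_univ_erase t₁, ← card_univ_erase s₂]
    refine Finset.sum_le_card_nsmul _ _ _ (fun t₁' ht => ?_) |>.trans_eq (nsmul_eq_mul _ _)
    refine Finset.sum_le_card_nsmul _ _ _ (fun s₂' hs => ?_) |>.trans_eq (nsmul_eq_mul _ _)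
    exact (hcell fun z => mean (cellOut V z s₁ t₁ s₂ t₂) fun y =>
      L.cellAccept V a b c d e z s₁ t₁' s₂' y).trans_le
      (L.mean_cell_satellite_cloud_le hV hc s₁ (Finset.ne_of_mem_erase ht)
        (Finset.ne_of_mem_erase hs) t₂)
  · rw [← card_univ_erase s₁, ← card_univ_erase s₂]
    refine Finset.sum_le_card_nsmul _ _ _ (fun s₁' hs₁ => ?_) |>.trans_eq (nsmul_eq_mul _ _)
    refine Finset.sum_le_card_nsmul _ _ _ (fun t₁' _ => ?_) |>.trans_eq (nsmul_eq_mul _ _)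
    refine Finset.sum_le_card_nsmul _ _ _ (fun s₂' hs => ?_) |>.trans_eq (nsmul_eq_mul _ _)
    exact (hcell fun z => mean (cellOut V z s₁ t₁ s₂ t₂) fun y =>
      L.cellAccept V a b c d e z s₁' t₁' s₂' y).trans_le
      (L.mean_cell_cloud_cloud_le hV hd (Finset.ne_of_mem_erase hs₁) t₁ t₁'
        (Finset.ne_of_mem_erase hs) t₂)
  · rw [← card_univ_erase m₀]
    refine Finset.sum_le_card_nsmul _ _ _ (fun m₀' hm => ?_) |>.trans_eq (nsmul_eq_mul _ _)
    refine Finset.sum_le_card_nsmul _ _ _ (fun s₁' _ => ?_) |>.trans_eq (nsmul_eq_mul _ _)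
    refine Finset.sum_le_card_nsmul _ _ _ (fun t₁' _ => ?_) |>.trans_eq (nsmul_eq_mul _ _)
    refine Finset.sum_le_card_nsmul _ _ _ (fun s₂' _ => ?_) |>.trans_eq (nsmul_eq_mul _ _)
    -- Cells of different common messages are independent, so here even the right private indices
    -- count as a fresh competitor.
    exact (mean_indep_apply₂ hlaw (Finset.ne_of_mem_erase hm).symm fun z' z =>
      mean (cellOut V z s₁ t₁ s₂ t₂) fun y =>
        L.cellAccept V a b c d e z' s₁' t₁' s₂' y).trans_le
      (L.mean_cell_other_le hV he s₁ s₁' t₁ t₁' s₂ s₂' t₂)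

end OneShot

end InputLaw

/-! ### Block coding -/

namespace InputLaw

section Rates

variable {𝒲₀ 𝒲₁ 𝒲₂ 𝒳₁ 𝒳₂ 𝒴 : Type*} [Fintype 𝒲₀] [Fintype 𝒲₁] [Fintype 𝒲₂]
    [Fintype 𝒳₁] [Fintype 𝒳₂] [Fintype 𝒴] (L : InputLaw 𝒲₀ 𝒲₁ 𝒲₂ 𝒳₁ 𝒳₂)
    (V : 𝒳₁ → 𝒳₂ → 𝒴 → ℝ)

/-- The law of all variables. -/
def joint : ((((𝒲₀ × 𝒲₁) × 𝒳₁) × 𝒲₂) × 𝒳₂) × 𝒴 → ℝ :=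
  compound (compound (compound (compound (compound L.q₀ L.q₁) fun z => L.r₁ z.1 z.2)
    fun z => L.q₂ z.1.1) fun z => L.r₂ z.1.1.1 z.2) fun z => V z.1.1.2 z.2

theorem mean_joint (f : ((((𝒲₀ × 𝒲₁) × 𝒳₁) × 𝒲₂) × 𝒳₂) × 𝒴 → ℝ) :
    mean (L.joint V) f = mean L.q₀ fun w₀ => mean (L.q₁ w₀) fun w₁ => mean (L.r₁ w₀ w₁) fun x₁ =>
      mean (L.q₂ w₀) fun w₂ => mean (L.r₂ w₀ w₂) fun x₂ => mean (V x₁ x₂) fun y =>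
        f (((((w₀, w₁), x₁), w₂), x₂), y) := by
  simp only [joint, mean_compound]

/-- `-H(Y|W₀ W₂ X₁)`. -/
def negWX : ℝ := mean (L.joint V) fun z => Real.logb 2 (L.outWX V z.1.1.1.1.1 z.1.1.2 z.1.1.1.2 z.2)

/-- `-H(Y|W₀ W₁ W₂)`. -/
def negWWW : ℝ :=
  mean (L.joint V) fun z => Real.logb 2 (L.outWWW V z.1.1.1.1.1 z.1.1.1.1.2 z.1.1.2 z.2)

/-- `-H(Y|W₀ W₂)`. -/
def negW₂ : ℝ := mean (L.joint V) fun z => Real.logb 2 (L.outW₂ V z.1.1.1.1.1 z.1.1.2 z.2)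

/-- `-H(Y|W₀ W₁)`. -/
def negW₁ : ℝ := mean (L.joint V) fun z => Real.logb 2 (L.outW₁ V z.1.1.1.1.1 z.1.1.1.1.2 z.2)

/-- `-H(Y|W₀)`. -/
def negW₀ : ℝ := mean (L.joint V) fun z => Real.logb 2 (L.outW₀ V z.1.1.1.1.1 z.2)

/-- `-H(Y)`. -/
def negOut : ℝ := mean (L.joint V) fun z => Real.logb 2 (L.out V z.2)

/-- The power of an input law: independent copies. -/
def pow (n : ℕ) : InputLaw (Fin n → 𝒲₀) (Fin n → 𝒲₁) (Fin n → 𝒲₂) (Fin n → 𝒳₁) (Fin n → 𝒳₂) where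
  q₀ := indep fun _ => L.q₀
  q₁ w₀ := indep fun i => L.q₁ (w₀ i)
  q₂ w₀ := indep fun i => L.q₂ (w₀ i)
  r₁ w₀ w₁ := indep fun i => L.r₁ (w₀ i) (w₁ i)
  r₂ w₀ w₂ := indep fun i => L.r₂ (w₀ i) (w₂ i)
  law₀ := isLaw_indep fun _ => L.law₀
  law₁ _ := isLaw_indep fun _ => L.law₁ _
  law₂ _ := isLaw_indep fun _ => L.law₂ _
  lawX₁ _ _ := isLaw_indep fun _ => L.lawX₁ _ _
  lawX₂ _ _ := isLaw_indep fun _ => L.lawX₂ _ _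

/-- The memoryless extension of a channel. -/
def channelPow (V : 𝒳₁ → 𝒳₂ → 𝒴 → ℝ) (n : ℕ) (x₁ : Fin n → 𝒳₁) (x₂ : Fin n → 𝒳₂) :
    (Fin n → 𝒴) → ℝ := indep fun i => V (x₁ i) (x₂ i)

variable (n : ℕ)

theorem outWX_pow (w₀ : Fin n → 𝒲₀) (w₂ : Fin n → 𝒲₂) (x₁ : Fin n → 𝒳₁) (y : Fin n → 𝒴) :
    (L.pow n).outWX (channelPow V n) w₀ w₂ x₁ y = ∏ i, L.outWX V (w₀ i) (w₂ i) (x₁ i) (y i) :=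
  mean_indep_prod (fun i => L.r₂ (w₀ i) (w₂ i)) fun i x₂ => V (x₁ i) x₂ (y i)

theorem outWWW_pow (w₀ : Fin n → 𝒲₀) (w₁ : Fin n → 𝒲₁) (w₂ : Fin n → 𝒲₂) (y : Fin n → 𝒴) :
    (L.pow n).outWWW (channelPow V n) w₀ w₁ w₂ y = ∏ i, L.outWWW V (w₀ i) (w₁ i) (w₂ i) (y i) := by
  unfold outWWW
  simp only [outWX_pow]
  exact mean_indep_prod (fun i => L.r₁ (w₀ i) (w₁ i)) fun i x₁ => L.outWX V (w₀ i) (w₂ i) x₁ (y i)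

theorem outW₂_pow (w₀ : Fin n → 𝒲₀) (w₂ : Fin n → 𝒲₂) (y : Fin n → 𝒴) :
    (L.pow n).outW₂ (channelPow V n) w₀ w₂ y = ∏ i, L.outW₂ V (w₀ i) (w₂ i) (y i) := by
  unfold outW₂
  simp only [outWWW_pow]
  exact mean_indep_prod (fun i => L.q₁ (w₀ i)) fun i w₁ => L.outWWW V (w₀ i) w₁ (w₂ i) (y i)

theorem outW₁_pow (w₀ : Fin n → 𝒲₀) (w₁ : Fin n → 𝒲₁) (y : Fin n → 𝒴) :
    (L.pow n).outW₁ (channelPow V n) w₀ w₁ y = ∏ i, L.outW₁ V (w₀ i) (w₁ i) (y i) := by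
  unfold outW₁
  simp only [outWWW_pow]
  exact mean_indep_prod (fun i => L.q₂ (w₀ i)) fun i w₂ => L.outWWW V (w₀ i) (w₁ i) w₂ (y i)

theorem outW₀_pow (w₀ : Fin n → 𝒲₀) (y : Fin n → 𝒴) :
    (L.pow n).outW₀ (channelPow V n) w₀ y = ∏ i, L.outW₀ V (w₀ i) (y i) := by
  unfold outW₀
  simp only [outW₁_pow]
  exact mean_indep_prod (fun i => L.q₁ (w₀ i)) fun i w₁ => L.outW₁ V (w₀ i) w₁ (y i)

theorem out_pow (y : Fin n → 𝒴) :
    (L.pow n).out (channelPow V n) y = ∏ i, L.out V (y i) := by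
  unfold out
  simp only [outW₀_pow]
  exact mean_indep_prod (fun _ => L.q₀) fun i w₀ => L.outW₀ V w₀ (y i)

/-- The n-letter experiment, generated one kind of word after another, is n independent copies of
the single-letter one. Each application of `mean_indep_compound` absorbs one further layer. -/
theorem mean_pow_joint (F : (Fin n → 𝒲₀) → (Fin n → 𝒲₁) → (Fin n → 𝒳₁) → (Fin n → 𝒲₂) →
    (Fin n → 𝒳₂) → (Fin n → 𝒴) → ℝ) :
    (mean (indep fun _ => L.q₀) fun w₀ => mean (indep fun i => L.q₁ (w₀ i)) fun w₁ =>
      mean (indep fun i => L.r₁ (w₀ i) (w₁ i)) fun x₁ => mean (indep fun i => L.q₂ (w₀ i)) fun w₂ =>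
        mean (indep fun i => L.r₂ (w₀ i) (w₂ i)) fun x₂ =>
          mean (indep fun i => V (x₁ i) (x₂ i)) fun y => F w₀ w₁ x₁ w₂ x₂ y) =
      mean (indep fun _ : Fin n => L.joint V) fun ω =>
        F (fun i => (ω i).1.1.1.1.1) (fun i => (ω i).1.1.1.1.2) (fun i => (ω i).1.1.1.2)
          (fun i => (ω i).1.1.2) (fun i => (ω i).1.2) (fun i => (ω i).2) := by
  rw [mean_indep_compound (fun _ => L.q₀) (fun _ => L.q₁) fun w₀ w₁ =>
    mean (indep fun i => L.r₁ (w₀ i) (w₁ i)) fun x₁ => mean (indep fun i => L.q₂ (w₀ i)) fun w₂ =>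
      mean (indep fun i => L.r₂ (w₀ i) (w₂ i)) fun x₂ =>
        mean (indep fun i => V (x₁ i) (x₂ i)) fun y => F w₀ w₁ x₁ w₂ x₂ y]
  beta_reduce
  rw [mean_indep_compound (fun _ : Fin n => compound L.q₀ L.q₁) (fun _ z => L.r₁ z.1 z.2)
    fun z x₁ => mean (indep fun i => L.q₂ (z i).1) fun w₂ =>
      mean (indep fun i => L.r₂ (z i).1 (w₂ i)) fun x₂ =>
        mean (indep fun i => V (x₁ i) (x₂ i)) fun y =>
          F (fun i => (z i).1) (fun i => (z i).2) x₁ w₂ x₂ y]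
  beta_reduce
  rw [mean_indep_compound (fun _ : Fin n => compound (compound L.q₀ L.q₁) fun z => L.r₁ z.1 z.2)
    (fun _ z => L.q₂ z.1.1)
    fun z w₂ => mean (indep fun i => L.r₂ (z i).1.1 (w₂ i)) fun x₂ =>
        mean (indep fun i => V (z i).2 (x₂ i)) fun y =>
          F (fun i => (z i).1.1) (fun i => (z i).1.2) (fun i => (z i).2) w₂ x₂ y]
  beta_reduce
  rw [mean_indep_compound (fun _ : Fin n => compound (compound (compound L.q₀ L.q₁)
      fun z => L.r₁ z.1 z.2) fun z => L.q₂ z.1.1)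
    (fun _ z => L.r₂ z.1.1.1 z.2)
    fun z x₂ => mean (indep fun i => V (z i).1.2 (x₂ i)) fun y =>
          F (fun i => (z i).1.1.1) (fun i => (z i).1.1.2) (fun i => (z i).1.2)
            (fun i => (z i).2) x₂ y]
  beta_reduce
  exact mean_indep_compound (fun _ : Fin n => compound (compound (compound (compound L.q₀ L.q₁)
      fun z => L.r₁ z.1 z.2) fun z => L.q₂ z.1.1) fun z => L.r₂ z.1.1.1 z.2)
    (fun _ z => V z.1.1.2 z.2) fun z y => F (fun i => (z i).1.1.1.1) (fun i => (z i).1.1.1.2)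
      (fun i => (z i).1.1.2) (fun i => (z i).1.2) (fun i => (z i).2) y

theorem miss_pow (a b c d e : ℝ) :
    (L.pow n).miss (channelPow V n) a b c d e =
      mean (indep fun _ : Fin n => L.joint V) fun ω =>
        1 - (L.pow n).accept (channelPow V n) a b c d e (fun i => (ω i).1.1.1.1.1)
          (fun i => (ω i).1.1.1.1.2) (fun i => (ω i).1.1.1.2) (fun i => (ω i).1.1.2)
          (fun i => (ω i).2) :=
  L.mean_pow_joint V n fun w₀ w₁ x₁ w₂ _ y =>
    1 - (L.pow n).accept (channelPow V n) a b c d e w₀ w₁ x₁ w₂ y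

variable {V} (hV : ∀ x₁ x₂, IsLaw (V x₁ x₂))
include hV

theorem isLaw_joint : IsLaw (L.joint V) :=
  isLaw_compound (isLaw_compound (isLaw_compound (isLaw_compound (isLaw_compound L.law₀ L.law₁)
    fun _ => L.lawX₁ _ _) fun _ => L.law₂ _) fun _ => L.lawX₂ _ _) fun _ => hV _ _

/-- Along outcomes of positive weight all likelihoods are positive, so the convention log 0 = 0
never interferes. -/
theorem pos_of_joint_pos {w₀ : 𝒲₀} {w₁ : 𝒲₁} {x₁ : 𝒳₁} {w₂ : 𝒲₂} {x₂ : 𝒳₂} {y : 𝒴}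
    (h : 0 < L.joint V (((((w₀, w₁), x₁), w₂), x₂), y)) :
    0 < L.outWX V w₀ w₂ x₁ y ∧ 0 < L.outWWW V w₀ w₁ w₂ y ∧ 0 < L.outW₂ V w₀ w₂ y ∧
      0 < L.outW₁ V w₀ w₁ y ∧ 0 < L.outW₀ V w₀ y ∧ 0 < L.out V y := by
  simp only [joint, compound] at h
  have hne := h.ne'
  simp only [mul_ne_zero_iff] at hne
  obtain ⟨⟨⟨⟨⟨h0, h1⟩, hx1⟩, h2⟩, hx2⟩, hy⟩ := hne
  have p0 := (L.law₀.nonneg _).lt_of_ne' h0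
  have p1 := ((L.law₁ _).nonneg _).lt_of_ne' h1
  have p2 := ((L.law₂ _).nonneg _).lt_of_ne' h2
  have px1 := ((L.lawX₁ _ _).nonneg _).lt_of_ne' hx1
  have px2 := ((L.lawX₂ _ _).nonneg _).lt_of_ne' hx2
  have py := ((hV _ _).nonneg _).lt_of_ne' hy
  have a1 : 0 < L.outWX V w₀ w₂ x₁ y :=
    mean_pos_of_pos (L.lawX₂ _ _).nonneg (fun _ => (hV _ _).nonneg _) px2 py
  have a2 : 0 < L.outWWW V w₀ w₁ w₂ y :=
    mean_pos_of_pos (L.lawX₁ _ _).nonneg (fun _ => (L.isLaw_outWX hV _ _ _).nonneg _) px1 a1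
  have a3 : 0 < L.outW₂ V w₀ w₂ y :=
    mean_pos_of_pos (L.law₁ _).nonneg (fun _ => (L.isLaw_outWWW hV _ _ _).nonneg _) p1 a2
  have a4 : 0 < L.outW₁ V w₀ w₁ y :=
    mean_pos_of_pos (L.law₂ _).nonneg (fun _ => (L.isLaw_outWWW hV _ _ _).nonneg _) p2 a2
  have a5 : 0 < L.outW₀ V w₀ y :=
    mean_pos_of_pos (L.law₁ _).nonneg (fun _ => (L.isLaw_outW₁ hV _ _).nonneg _) p1 a4
  exact ⟨a1, a2, a3, a4, a5,
    mean_pos_of_pos L.law₀.nonneg (fun _ => (L.isLaw_outW₀ hV _).nonneg _) p0 a5⟩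

omit hV in
/-- A failed threshold test, in terms of the logarithms. -/
theorem sum_logb_lt {n : ℕ} {N D : Fin n → ℝ} (hN : ∀ i, 0 < N i) (hD : ∀ i, 0 < D i) {r : ℝ}
    (h : ¬ (2 : ℝ) ^ ((n : ℝ) * r) * ∏ i, D i ≤ ∏ i, N i) :
    ∑ i, (Real.logb 2 (N i) - Real.logb 2 (D i)) < n * r := by
  rw [not_le] at h
  have hDp : 0 < ∏ i, D i := Finset.prod_pos fun i _ => hD i
  have hNp : 0 < ∏ i, N i := Finset.prod_pos fun i _ => hN i
  have h2 : (0 : ℝ) < (2 : ℝ) ^ ((n : ℝ) * r) := by positivity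
  have := Real.logb_lt_logb (b := 2) (by norm_num) hNp h
  rw [Real.logb_mul h2.ne' hDp.ne', Real.logb_rpow (by norm_num) (by norm_num),
    Real.logb_prod _ _ fun i _ => (hN i).ne', Real.logb_prod _ _ fun i _ => (hD i).ne'] at this
  rw [Finset.sum_sub_distrib]
  linarith

omit hV in
theorem one_sub_indicator_le {G P₁ P₂ P₃ P₄ P₅ : Prop} [Decidable G] [Decidable P₁] [Decidable P₂]
    [Decidable P₃] [Decidable P₄] [Decidable P₅] (h : ¬G → P₁ ∨ P₂ ∨ P₃ ∨ P₄ ∨ P₅) :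
    1 - (if G then (1 : ℝ) else 0) ≤ (if P₁ then 1 else 0) + (if P₂ then 1 else 0) +
      (if P₃ then 1 else 0) + (if P₄ then 1 else 0) + (if P₅ then 1 else 0) := by
  by_cases hG : G
  · simp only [if_pos hG, sub_self]; positivity
  · rcases h hG with h | h | h | h | h <;> simp only [if_pos h, if_neg hG, sub_zero] <;>
      linarith [show (0 : ℝ) ≤ if P₁ then 1 else 0 by positivity,
        show (0 : ℝ) ≤ if P₂ then 1 else 0 by positivity,
        show (0 : ℝ) ≤ if P₃ then 1 else 0 by positivity,
        show (0 : ℝ) ≤ if P₄ then 1 else 0 by positivity,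
        show (0 : ℝ) ≤ if P₅ then 1 else 0 by positivity]

/-- The transmitted codewords pass the threshold tests with high probability. -/
theorem eventually_miss_le {δa δb δc δd δe ε : ℝ} (ha : 0 < δa) (hb : 0 < δb) (hc : 0 < δc)
    (hd : 0 < δd) (he : 0 < δe) (hε : 0 < ε) :
    ∀ᶠ n : ℕ in Filter.atTop, (L.pow n).miss (channelPow V n)
      ((2 : ℝ) ^ ((n : ℝ) * (L.negWX V - L.negWWW V - δa)))
      ((2 : ℝ) ^ ((n : ℝ) * (L.negWX V - L.negW₂ V - δb)))
      ((2 : ℝ) ^ ((n : ℝ) * (L.negWX V - L.negW₁ V - δc)))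
      ((2 : ℝ) ^ ((n : ℝ) * (L.negWX V - L.negW₀ V - δd)))
      ((2 : ℝ) ^ ((n : ℝ) * (L.negWX V - L.negOut V - δe))) ≤ ε := by
  classical
  have hJ := L.isLaw_joint hV
  -- Each of the five tests may fail with probability ε/5. Under the joint law the log-likelihood
  -- ratio has as its mean the difference of the two negative entropies, so the weak law places it
  -- above the threshold exponent.
  have key := fun (D : ((((𝒲₀ × 𝒲₁) × 𝒳₁) × 𝒲₂) × 𝒳₂) × 𝒴 → ℝ) {δ : ℝ} (hδ : 0 < δ) =>
    eventually_mean_lower_tail_le hJ (fun z =>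
      Real.logb 2 (L.outWX V z.1.1.1.1.1 z.1.1.2 z.1.1.1.2 z.2) - Real.logb 2 (D z)) hδ
      (show 0 < ε / 5 by positivity)
  filter_upwards [key (fun z => L.outWWW V z.1.1.1.1.1 z.1.1.1.1.2 z.1.1.2 z.2) ha,
    key (fun z => L.outW₂ V z.1.1.1.1.1 z.1.1.2 z.2) hb,
    key (fun z => L.outW₁ V z.1.1.1.1.1 z.1.1.1.1.2 z.2) hc,
    key (fun z => L.outW₀ V z.1.1.1.1.1 z.2) hd, key (fun z => L.out V z.2) he]
    with n h1 h2 h3 h4 h5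
  simp only [mean_sub] at h1 h2 h3 h4 h5
  have hsum := add_le_add (add_le_add (add_le_add (add_le_add h1 h2) h3) h4) h5
  simp only [← mean_add] at hsum
  rw [miss_pow]
  refine le_trans (mean_mono_of_pos (isLaw_indep fun _ => hJ).nonneg fun ω hω => ?_)
    (hsum.trans_eq (by ring))
  have hpos : ∀ i, 0 < L.joint V (ω i) := fun i =>
    (hJ.nonneg _).lt_of_ne' (Finset.prod_ne_zero_iff.1 hω.ne' i (Finset.mem_univ i))
  have hp := fun i => L.pos_of_joint_pos hV (hpos i)
  unfold accept Accept
  simp only [outWX_pow, outWWW_pow, outW₂_pow, outW₁_pow, outW₀_pow, out_pow]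
  refine one_sub_indicator_le fun h => ?_
  by_contra hcon
  simp only [not_or] at hcon
  obtain ⟨g1, g2, g3, g4, g5⟩ := hcon
  refine h ⟨?_, ?_, ?_, ?_, ?_⟩
  · exact by_contra fun g => g1 (sum_logb_lt (fun i => (hp i).1) (fun i => (hp i).2.1) g)
  · exact by_contra fun g => g2 (sum_logb_lt (fun i => (hp i).1) (fun i => (hp i).2.2.1) g)
  · exact by_contra fun g => g3 (sum_logb_lt (fun i => (hp i).1) (fun i => (hp i).2.2.2.1) g)
  · exact by_contra fun g => g4 (sum_logb_lt (fun i => (hp i).1) (fun i => (hp i).2.2.2.2.1) g)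
  · exact by_contra fun g => g5 (sum_logb_lt (fun i => (hp i).1) (fun i => (hp i).2.2.2.2.2) g)

end Rates

end InputLaw

/-! ### Message counts -/

section Counts

/-- The number `⌈2 ^ (n R)⌉` of messages of rate `R`. -/
def msgCount (R : ℝ) (n : ℕ) : ℕ := ⌈(2 : ℝ) ^ ((n : ℝ) * R)⌉₊

theorem le_msgCount (R : ℝ) (n : ℕ) : (2 : ℝ) ^ ((n : ℝ) * R) ≤ msgCount R n := Nat.le_ceil _

theorem msgCount_pos (R : ℝ) (n : ℕ) : 0 < msgCount R n := Nat.ceil_pos.2 (by positivity)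

instance (R : ℝ) (n : ℕ) : NeZero (msgCount R n) := ⟨(msgCount_pos R n).ne'⟩

theorem msgCount_sub_one_le (R : ℝ) (n : ℕ) :
    ((msgCount R n - 1 : ℕ) : ℝ) ≤ (2 : ℝ) ^ ((n : ℝ) * R) := by
  have h := Nat.ceil_lt_add_one (a := (2 : ℝ) ^ ((n : ℝ) * R)) (by positivity)
  rw [Nat.cast_sub (msgCount_pos R n)]
  unfold msgCount
  push_cast
  linarith

theorem msgCount_le {R : ℝ} (hR : 0 ≤ R) (n : ℕ) :
    (msgCount R n : ℝ) ≤ 2 * (2 : ℝ) ^ ((n : ℝ) * R) := by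
  have h := Nat.ceil_lt_add_one (a := (2 : ℝ) ^ ((n : ℝ) * R)) (by positivity)
  have h1 : (1 : ℝ) ≤ (2 : ℝ) ^ ((n : ℝ) * R) :=
    Real.one_le_rpow (by norm_num) (by positivity)
  unfold msgCount
  linarith

theorem msgCount_zero (n : ℕ) : msgCount 0 n = 1 := by simp [msgCount]

/-- Fewer than `2 ^ (n A)` competitors at rate `T < A` are negligible. -/
theorem exists_slack_of_lt {T A C : ℝ} (h : T < A) {x : ℕ → ℝ}
    (hx : ∀ n, x n ≤ C * (2 : ℝ) ^ ((n : ℝ) * T)) :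
    ∃ δ > 0, ∀ ε > 0, ∀ᶠ n : ℕ in Filter.atTop,
      x n * (1 / (2 : ℝ) ^ ((n : ℝ) * (A - δ))) ≤ ε := by
  -- Half of the gap goes into the threshold; the other half makes the bound decay like 2 ^ (-n (A -
  -- T) / 2).
  refine ⟨(A - T) / 2, by linarith, fun ε hε => ?_⟩
  have hr0 : 0 < (2 : ℝ) ^ (-((A - T) / 2)) := by positivity
  have hr1 : (2 : ℝ) ^ (-((A - T) / 2)) < 1 :=
    Real.rpow_lt_one_of_one_lt_of_neg (by norm_num) (by linarith)
  have ht : Filter.Tendsto (fun n : ℕ => C * ((2 : ℝ) ^ (-((A - T) / 2))) ^ n) Filter.atTop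
      (nhds (C * 0)) := (tendsto_pow_atTop_nhds_zero_of_lt_one hr0.le hr1).const_mul C
  rw [mul_zero] at ht
  filter_upwards [ht.eventually_le_const hε] with n hn
  refine le_trans (mul_le_mul_of_nonneg_right (hx n) (by positivity)) (le_trans (le_of_eq ?_) hn)
  rw [mul_assoc, mul_one_div, ← Real.rpow_sub (by norm_num), ← Real.rpow_natCast,
    ← Real.rpow_mul (by norm_num)]
  congr 2
  ring

/-- A set with a single message has no competitor, so its test needs no condition on A, which may
even be zero or negative. The value δ = 1 is arbitrary. -/
theorem exists_slack_of_eq_zero {A : ℝ} {x : ℕ → ℝ} (hx : ∀ n, x n = 0) :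
    ∃ δ > 0, ∀ ε > 0, ∀ᶠ n : ℕ in Filter.atTop,
      x n * (1 / (2 : ℝ) ^ ((n : ℝ) * (A - δ))) ≤ ε :=
  ⟨1, one_pos, fun ε hε => Filter.Eventually.of_forall fun n => by rw [hx, zero_mul]; exact hε.le⟩

end Counts

/-! ### Reliability of the threshold decoder at given rates -/

namespace InputLaw

section Coding

variable {𝒲₀ 𝒲₁ 𝒲₂ 𝒳₁ 𝒳₂ 𝒴 𝒴₁ 𝒴₂ : Type*} [Fintype 𝒲₀] [Fintype 𝒲₁] [Fintype 𝒲₂]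
    [Fintype 𝒳₁] [Fintype 𝒳₂] [Fintype 𝒴] [Fintype 𝒴₁] [Fintype 𝒴₂]
    (L : InputLaw 𝒲₀ 𝒲₁ 𝒲₂ 𝒳₁ 𝒳₂)

/-- The rates at which decoder 1 recovers the common message (rate `R₀`), the cloud center
(rate `S₁`) and the satellite (rate `T₁`) of user 1, in the presence of cloud centers of user 2 of
rate `S₂`. A message set of rate zero has a single element. -/
structure Decodable (V : 𝒳₁ → 𝒳₂ → 𝒴 → ℝ) (R₀ S₁ T₁ S₂ : ℝ) : Prop where
  satellite : T₁ = 0 ∨ T₁ < L.negWX V - L.negWWW V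
  cloud : S₁ = 0 ∨ S₁ + T₁ < L.negWX V - L.negW₂ V
  satellite_cloud : T₁ = 0 ∨ S₂ = 0 ∨ T₁ + S₂ < L.negWX V - L.negW₁ V
  cloud_cloud : S₁ = 0 ∨ S₂ = 0 ∨ S₁ + T₁ + S₂ < L.negWX V - L.negW₀ V
  all : R₀ + S₁ + T₁ + S₂ < L.negWX V - L.negOut V

/-- The error probability of the threshold decoder tends to zero. -/
theorem Decodable.eventually_error_le {L : InputLaw 𝒲₀ 𝒲₁ 𝒲₂ 𝒳₁ 𝒳₂} {V : 𝒳₁ → 𝒳₂ → 𝒴 → ℝ}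
    (hV : ∀ x₁ x₂, IsLaw (V x₁ x₂)) {R₀ S₁ T₁ S₂ : ℝ} (h : L.Decodable V R₀ S₁ T₁ S₂)
    (hS₁ : 0 ≤ S₁) (hT₁ : 0 ≤ T₁) (hS₂ : 0 ≤ S₂) {ε : ℝ} (hε : 0 < ε) :
    ∀ᶠ n : ℕ in Filter.atTop, ∃ a b c d e : ℝ, 0 < a ∧ 0 < b ∧ 0 < c ∧ 0 < d ∧ 0 < e ∧
      (L.pow n).miss (channelPow V n) a b c d e + (msgCount T₁ n - 1 : ℕ) * (1 / a) +
        (msgCount S₁ n - 1 : ℕ) * (msgCount T₁ n * (1 / b)) +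
        (msgCount T₁ n - 1 : ℕ) * ((msgCount S₂ n - 1 : ℕ) * (1 / c)) +
        (msgCount S₁ n - 1 : ℕ) * (msgCount T₁ n * ((msgCount S₂ n - 1 : ℕ) * (1 / d))) +
        (msgCount R₀ n - 1 : ℕ) * (msgCount S₁ n * (msgCount T₁ n * (msgCount S₂ n * (1 / e))))
        ≤ ε := by
  have hp : ∀ (R : ℝ) (n : ℕ), 0 < (2 : ℝ) ^ ((n : ℝ) * R) := fun R n => by positivity
  have hz : ∀ n, ((msgCount 0 n - 1 : ℕ) : ℝ) = 0 := fun n => by simp [msgCount_zero]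
  have hle := fun R n => msgCount_sub_one_le R n
  -- In these five estimates a factor `msgCount` costs a 2 for rounding up, a factor `msgCount - 1`
  -- costs nothing. Hence the constants 1, 2, 1, 2 and 8.
  obtain ⟨δa, ha, ka⟩ : ∃ δ > 0, ∀ ε > 0, ∀ᶠ n : ℕ in Filter.atTop,
      ((msgCount T₁ n - 1 : ℕ) : ℝ) *
        (1 / (2 : ℝ) ^ ((n : ℝ) * (L.negWX V - L.negWWW V - δ))) ≤ ε := by
    rcases h.satellite with h | h
    · exact exists_slack_of_eq_zero fun n => by rw [h, hz]
    · exact exists_slack_of_lt (C := 1) h fun n => by rw [one_mul]; exact hle _ _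
  obtain ⟨δb, hb, kb⟩ : ∃ δ > 0, ∀ ε > 0, ∀ᶠ n : ℕ in Filter.atTop,
      ((msgCount S₁ n - 1 : ℕ) * msgCount T₁ n : ℝ) *
        (1 / (2 : ℝ) ^ ((n : ℝ) * (L.negWX V - L.negW₂ V - δ))) ≤ ε := by
    rcases h.cloud with h | h
    · exact exists_slack_of_eq_zero fun n => by rw [h, hz, zero_mul]
    · refine exists_slack_of_lt (C := 2) h fun n => ?_
      refine (mul_le_mul (hle _ _) (msgCount_le hT₁ n) (by positivity) (hp _ _).le).trans_eq ?_
      rw [mul_add, Real.rpow_add (by norm_num)]; ring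
  obtain ⟨δc, hc, kc⟩ : ∃ δ > 0, ∀ ε > 0, ∀ᶠ n : ℕ in Filter.atTop,
      ((msgCount T₁ n - 1 : ℕ) * (msgCount S₂ n - 1 : ℕ) : ℝ) *
        (1 / (2 : ℝ) ^ ((n : ℝ) * (L.negWX V - L.negW₁ V - δ))) ≤ ε := by
    rcases h.satellite_cloud with h | h | h
    · exact exists_slack_of_eq_zero fun n => by rw [h, hz, zero_mul]
    · exact exists_slack_of_eq_zero fun n => by rw [h, hz, mul_zero]
    · refine exists_slack_of_lt (C := 1) h fun n => ?_
      refine (mul_le_mul (hle _ _) (hle _ _) (by positivity) (hp _ _).le).trans_eq ?_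
      rw [mul_add, Real.rpow_add (by norm_num)]; ring
  obtain ⟨δd, hd, kd⟩ : ∃ δ > 0, ∀ ε > 0, ∀ᶠ n : ℕ in Filter.atTop,
      ((msgCount S₁ n - 1 : ℕ) * msgCount T₁ n * (msgCount S₂ n - 1 : ℕ) : ℝ) *
        (1 / (2 : ℝ) ^ ((n : ℝ) * (L.negWX V - L.negW₀ V - δ))) ≤ ε := by
    rcases h.cloud_cloud with h | h | h
    · exact exists_slack_of_eq_zero fun n => by rw [h, hz, zero_mul, zero_mul]
    · exact exists_slack_of_eq_zero fun n => by rw [h, hz, mul_zero]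
    · refine exists_slack_of_lt (C := 2) h fun n => ?_
      refine (mul_le_mul (mul_le_mul (hle _ _) (msgCount_le hT₁ n) (by positivity) (hp _ _).le)
        (hle _ _) (by positivity) (by positivity)).trans_eq ?_
      rw [mul_add, Real.rpow_add (by norm_num), mul_add, Real.rpow_add (by norm_num)]; ring
  obtain ⟨δe, he, ke⟩ : ∃ δ > 0, ∀ ε > 0, ∀ᶠ n : ℕ in Filter.atTop,
      ((msgCount R₀ n - 1 : ℕ) * msgCount S₁ n * msgCount T₁ n * msgCount S₂ n : ℝ) *
        (1 / (2 : ℝ) ^ ((n : ℝ) * (L.negWX V - L.negOut V - δ))) ≤ ε := by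
    refine exists_slack_of_lt (C := 8) h.all fun n => ?_
    refine (mul_le_mul (mul_le_mul (mul_le_mul (hle _ _) (msgCount_le hS₁ n) (by positivity)
      (hp _ _).le) (msgCount_le hT₁ n) (by positivity) (by positivity)) (msgCount_le hS₂ n)
      (by positivity) (by positivity)).trans_eq ?_
    rw [mul_add, Real.rpow_add (by norm_num), mul_add, Real.rpow_add (by norm_num), mul_add,
      Real.rpow_add (by norm_num)]; ring
  have h6 : 0 < ε / 6 := by positivity
  filter_upwards [L.eventually_miss_le hV ha hb hc hd he h6, ka _ h6, kb _ h6, kc _ h6, kd _ h6,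
    ke _ h6] with n g0 g1 g2 g3 g4 g5
  refine ⟨_, _, _, _, _, hp (L.negWX V - L.negWWW V - δa) n, hp (L.negWX V - L.negW₂ V - δb) n,
    hp (L.negWX V - L.negW₁ V - δc) n, hp (L.negWX V - L.negW₀ V - δd) n,
    hp (L.negWX V - L.negOut V - δe) n, ?_⟩
  simp only [← mul_assoc]
  linarith

end Coding

end InputLaw

/-! ### From random codebooks to one codebook for both receivers -/

section ExistsCode

open Classical in
/-- The probability that `φ` does not recover `m` from the channel output. -/
def decodeError {𝒳₁ 𝒳₂ 𝒴 M : Type*} [Fintype 𝒴] (V : 𝒳₁ → 𝒳₂ → 𝒴 → ℝ) (x₁ : 𝒳₁)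
    (x₂ : 𝒳₂) (φ : 𝒴 → M) (m : M) : ℝ :=
  mean (V x₁ x₂) fun y => if φ y ≠ m then 1 else 0

/-- Exchange of the two users in a cell of a codebook. -/
def swapCell {A B C : Type*} : A × B × C ≃ A × C × B :=
  Equiv.prodCongr (Equiv.refl _) (Equiv.prodComm _ _)

variable {𝒲₀ 𝒲₁ 𝒲₂ 𝒳₁ 𝒳₂ 𝒴₁ 𝒴₂ : Type*} [Fintype 𝒲₀] [Fintype 𝒲₁] [Fintype 𝒲₂]
    [Fintype 𝒳₁] [Fintype 𝒳₂] [Fintype 𝒴₁] [Fintype 𝒴₂]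

/-- Some codebook is as good as the average over the random codebooks. -/
theorem InputLaw.exists_code (L : InputLaw 𝒲₀ 𝒲₁ 𝒲₂ 𝒳₁ 𝒳₂) {V₁ : 𝒳₁ → 𝒳₂ → 𝒴₁ → ℝ}
    {V₂ : 𝒳₂ → 𝒳₁ → 𝒴₂ → ℝ} (hV₁ : ∀ x₁ x₂, IsLaw (V₁ x₁ x₂)) (hV₂ : ∀ x₂ x₁, IsLaw (V₂ x₂ x₁))
    {m₀ s₁ t₁ s₂ t₂ : ℕ} [NeZero m₀] [NeZero s₁] [NeZero t₁] [NeZero s₂] [NeZero t₂]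
    {a b c d e a' b' c' d' e' B B' : ℝ} (ha : 0 < a) (hb : 0 < b) (hc : 0 < c) (hd : 0 < d)
    (he : 0 < e) (ha' : 0 < a') (hb' : 0 < b') (hc' : 0 < c') (hd' : 0 < d') (he' : 0 < e')
    (hle : L.miss V₁ a b c d e + (t₁ - 1 : ℕ) * (1 / a) + (s₁ - 1 : ℕ) * (t₁ * (1 / b)) +
      (t₁ - 1 : ℕ) * ((s₂ - 1 : ℕ) * (1 / c)) +
      (s₁ - 1 : ℕ) * (t₁ * ((s₂ - 1 : ℕ) * (1 / d))) +
      (m₀ - 1 : ℕ) * (s₁ * (t₁ * (s₂ * (1 / e)))) ≤ B)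
    (hle' : L.swap.miss V₂ a' b' c' d' e' + (t₂ - 1 : ℕ) * (1 / a') +
      (s₂ - 1 : ℕ) * (t₂ * (1 / b')) + (t₂ - 1 : ℕ) * ((s₁ - 1 : ℕ) * (1 / c')) +
      (s₂ - 1 : ℕ) * (t₂ * ((s₁ - 1 : ℕ) * (1 / d'))) +
      (m₀ - 1 : ℕ) * (s₂ * (t₂ * (s₁ * (1 / e')))) ≤ B')
    {μ : Fin m₀ × Fin (s₁ * t₁) × Fin (s₂ * t₂) → ℝ} (hμ : IsLaw μ) :
    ∃ (f₁ : Fin m₀ → Fin (s₁ * t₁) → 𝒳₁) (f₂ : Fin m₀ → Fin (s₂ * t₂) → 𝒳₂)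
      (φ₁ : 𝒴₁ → Fin m₀ × Fin (s₁ * t₁)) (φ₂ : 𝒴₂ → Fin m₀ × Fin (s₂ * t₂)),
      mean μ (fun m => decodeError V₁ (f₁ m.1 m.2.1) (f₂ m.1 m.2.2) φ₁ (m.1, m.2.1) +
        decodeError V₂ (f₂ m.1 m.2.2) (f₁ m.1 m.2.1) φ₂ (m.1, m.2.2)) ≤ B + B' := by
  classical
  let Cell := 𝒲₀ × (Fin s₁ → 𝒲₁ × (Fin t₁ → 𝒳₁)) ×
    (Fin s₂ → 𝒲₂ × (Fin t₂ → 𝒳₂))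
  let Q : (Fin m₀ → Cell) → ℝ := indep fun _ => L.cellLaw
  have hQ : IsLaw Q := isLaw_indep fun _ => L.isLaw_cellLaw
  let i₁ : Fin (s₁ * t₁) → Fin s₁ × Fin t₁ := finProdFinEquiv.symm
  let i₂ : Fin (s₂ * t₂) → Fin s₂ × Fin t₂ := finProdFinEquiv.symm
  let f₁ : (Fin m₀ → Cell) → Fin m₀ → Fin (s₁ * t₁) → 𝒳₁ :=
    fun C m k => ((C m).2.1 (i₁ k).1).2 (i₁ k).2
  let f₂ : (Fin m₀ → Cell) → Fin m₀ → Fin (s₂ * t₂) → 𝒳₂ :=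
    fun C m k => ((C m).2.2 (i₂ k).1).2 (i₂ k).2
  let φ₁ : (Fin m₀ → Cell) → 𝒴₁ → Fin m₀ × Fin (s₁ * t₁) := fun C y =>
    Prod.map id finProdFinEquiv
      (L.decode V₁ a b c d e C y)
  let φ₂ : (Fin m₀ → Cell) → 𝒴₂ → Fin m₀ × Fin (s₂ * t₂) := fun C y =>
    Prod.map id finProdFinEquiv
      (L.swap.decode V₂ a' b' c' d' e' (fun m => swapCell (C m)) y)
  have hne : ∀ {s t : ℕ} (z : Fin m₀ × Fin s × Fin t) (m : Fin m₀) (k : Fin (s * t)),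
      Prod.map id finProdFinEquiv z ≠ (m, k) ↔
        z ≠ (m, (finProdFinEquiv.symm k).1, (finProdFinEquiv.symm k).2) := by
    rintro s t ⟨z, x⟩ m k
    simp only [Prod.map, id_eq, ne_eq, Prod.mk.injEq, not_iff_not, Prod.mk.eta]
    rw [Equiv.eq_symm_apply]
  have key₁ : ∀ m k₁ k₂, mean Q (fun C => decodeError V₁ (f₁ C m k₁) (f₂ C m k₂) (φ₁ C) (m, k₁)) ≤
      B := by
    intro m k₁ k₂
    refine le_trans ?_ hle
    have := L.mean_decode_error_le
      hV₁ ha hb hc hd he m (i₁ k₁).1 (i₁ k₁).2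
      (i₂ k₂).1 (i₂ k₂).2
    simp only [Fintype.card_fin] at this
    refine le_trans (le_of_eq ?_) this
    simp only [decodeError, φ₁, hne]
    rfl
  have key₂ : ∀ m k₁ k₂, mean Q (fun C => decodeError V₂ (f₂ C m k₂) (f₁ C m k₁) (φ₂ C) (m, k₂)) ≤
      B' := by
    intro m k₁ k₂
    refine le_trans ?_ hle'
    have := L.swap.mean_decode_error_le
      hV₂ ha' hb' hc' hd' he' m (i₂ k₂).1
      (i₂ k₂).2 (i₁ k₁).1 (i₁ k₁).2
    simp only [Fintype.card_fin] at this
    refine le_trans (le_of_eq ?_) this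
    -- Decoder 2 works on the codebook with the users exchanged. Given w₀ the codewords of the users
    -- are independent, so the exchange carries the codebook law of `L` to that of `L.swap`.
    rw [← mean_equiv (Equiv.arrowCongr (Equiv.refl (Fin m₀)) swapCell)]
    simp only [decodeError, φ₂, hne]
    congr 1
    funext C
    refine Finset.prod_congr rfl fun m _ => ?_
    simp only [InputLaw.cellLaw, compound, swapCell]
    exact congrArg _ (mul_comm _ _)
  -- One codebook has to serve both decoders, hence the sum of the two errors. As `key₁` and `key₂`
  -- hold for each message separately, μ can be any law.
  have hmean : mean Q (fun C => mean μ fun m =>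
      decodeError V₁ (f₁ C m.1 m.2.1) (f₂ C m.1 m.2.2) (φ₁ C) (m.1, m.2.1) +
        decodeError V₂ (f₂ C m.1 m.2.2) (f₁ C m.1 m.2.1) (φ₂ C) (m.1, m.2.2)) ≤ B + B' := by
    rw [mean_comm]
    refine hμ.mean_le fun m => ?_
    rw [mean_add]
    linarith [key₁ m.1 m.2.1 m.2.2, key₂ m.1 m.2.1 m.2.2]
  obtain ⟨C, hC⟩ := hQ.exists_le_of_mean_le hmean
  exact ⟨f₁ C, f₂ C, φ₁ C, φ₂ C, hC⟩

end ExistsCode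

/-! ### Codes for arbitrary message laws -/

section RandomCodable

variable {𝒳₁ 𝒳₂ 𝒴₁ 𝒴₂ : Type*} [Fintype 𝒴₁] [Fintype 𝒴₂]

/-- For every law of the messages there are codes of the given rates with small total error
probability. `V₁` and `V₂` are the marginal channels to the two receivers. -/
def RandomCodable (V₁ : 𝒳₁ → 𝒳₂ → 𝒴₁ → ℝ) (V₂ : 𝒳₂ → 𝒳₁ → 𝒴₂ → ℝ) (R₀ R₁ R₂ : ℝ) : Prop :=
  ∀ ε > 0, ∀ᶠ n : ℕ in Filter.atTop, ∃ M₀ M₁ M₂ : ℕ, (2 : ℝ) ^ ((n : ℝ) * R₀) ≤ M₀ ∧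
    (2 : ℝ) ^ ((n : ℝ) * R₁) ≤ M₁ ∧ (2 : ℝ) ^ ((n : ℝ) * R₂) ≤ M₂ ∧
    ∀ μ : Fin M₀ × Fin M₁ × Fin M₂ → ℝ, IsLaw μ →
      ∃ (f₁ : Fin M₀ → Fin M₁ → (Fin n → 𝒳₁)) (f₂ : Fin M₀ → Fin M₂ → (Fin n → 𝒳₂))
        (φ₁ : (Fin n → 𝒴₁) → Fin M₀ × Fin M₁) (φ₂ : (Fin n → 𝒴₂) → Fin M₀ × Fin M₂),
        mean μ (fun m => decodeError (InputLaw.channelPow V₁ n) (f₁ m.1 m.2.1) (f₂ m.1 m.2.2) φ₁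
            (m.1, m.2.1) +
          decodeError (InputLaw.channelPow V₂ n) (f₂ m.1 m.2.2) (f₁ m.1 m.2.1) φ₂ (m.1, m.2.2)) ≤ ε

theorem RandomCodable.swap {V₁ : 𝒳₁ → 𝒳₂ → 𝒴₁ → ℝ} {V₂ : 𝒳₂ → 𝒳₁ → 𝒴₂ → ℝ} {R₀ R₁ R₂ : ℝ}
    (h : RandomCodable V₁ V₂ R₀ R₁ R₂) : RandomCodable V₂ V₁ R₀ R₂ R₁ := by
  intro ε hε
  filter_upwards [h ε hε] with n ⟨M₀, M₁, M₂, h0, h1, h2, hc⟩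
  refine ⟨M₀, M₂, M₁, h0, h2, h1, fun μ hμ => ?_⟩
  let e : Fin M₀ × Fin M₁ × Fin M₂ ≃ Fin M₀ × Fin M₂ × Fin M₁ :=
    Equiv.prodCongr (Equiv.refl _) (Equiv.prodComm _ _)
  obtain ⟨f₁, f₂, φ₁, φ₂, hf⟩ := hc (fun m => μ (e m))
    ⟨fun m => hμ.nonneg _, by rw [Equiv.sum_comp e]; exact hμ.sum_eq_one⟩
  refine ⟨f₂, f₁, φ₂, φ₁, ?_⟩
  rw [← mean_equiv e]
  simpa only [e, Equiv.prodCongr_apply, Equiv.coe_refl, Equiv.coe_prodComm, Prod.map_fst,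
    Prod.map_snd, id_eq, Prod.swap, add_comm] using hf

variable {𝒲₀ 𝒲₁ 𝒲₂ : Type*} [Fintype 𝒲₀] [Fintype 𝒲₁] [Fintype 𝒲₂] [Fintype 𝒳₁] [Fintype 𝒳₂]

/-- The random coding theorem. -/
theorem randomCodable_of_decodable (L : InputLaw 𝒲₀ 𝒲₁ 𝒲₂ 𝒳₁ 𝒳₂) {V₁ : 𝒳₁ → 𝒳₂ → 𝒴₁ → ℝ}
    {V₂ : 𝒳₂ → 𝒳₁ → 𝒴₂ → ℝ} (hV₁ : ∀ x₁ x₂, IsLaw (V₁ x₁ x₂)) (hV₂ : ∀ x₂ x₁, IsLaw (V₂ x₂ x₁))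
    {R₀ S₁ T₁ S₂ T₂ : ℝ} (hS₁ : 0 ≤ S₁) (hT₁ : 0 ≤ T₁) (hS₂ : 0 ≤ S₂) (hT₂ : 0 ≤ T₂)
    (h₁ : L.Decodable V₁ R₀ S₁ T₁ S₂) (h₂ : L.swap.Decodable V₂ R₀ S₂ T₂ S₁) :
    RandomCodable V₁ V₂ R₀ (S₁ + T₁) (S₂ + T₂) := by
  classical
  intro ε hε
  filter_upwards [h₁.eventually_error_le hV₁ hS₁ hT₁ hS₂ (half_pos hε),
    h₂.eventually_error_le hV₂ hS₂ hT₂ hS₁ (half_pos hε)] with n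
    ⟨a, b, c, d, e, ha, hb, hc, hd, he, hle⟩ ⟨a', b', c', d', e', ha', hb', hc', hd', he', hle'⟩
  have hsum : ∀ S T : ℝ, (2 : ℝ) ^ ((n : ℝ) * (S + T)) ≤ (msgCount S n * msgCount T n : ℕ) := by
    intro S T
    rw [mul_add, Real.rpow_add (by norm_num), Nat.cast_mul]
    exact mul_le_mul (le_msgCount _ _) (le_msgCount _ _) (by positivity) (by positivity)
  refine ⟨msgCount R₀ n, msgCount S₁ n * msgCount T₁ n, msgCount S₂ n * msgCount T₂ n,
    le_msgCount _ _, hsum _ _, hsum _ _, fun μ hμ => ?_⟩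
  have := (L.pow n).exists_code (V₁ := InputLaw.channelPow V₁ n) (V₂ := InputLaw.channelPow V₂ n)
    (fun x₁ x₂ => isLaw_indep fun i => hV₁ (x₁ i) (x₂ i))
    (fun x₁ x₂ => isLaw_indep fun i => hV₂ (x₁ i) (x₂ i)) ha hb hc hd he ha' hb' hc' hd' he' hle
    hle' hμ
  rwa [add_halves] at this

end RandomCodable

/-! ### From the thirteen inequalities to rate splitting -/

section Elimination

/-- The thirteen inequalities between rates and mutual informations. -/
def RateConditions (a₁ b₁ c₁ d₁ e₁ a₂ b₂ c₂ d₂ e₂ R₀ R₁ R₂ : ℝ) : Prop :=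
  R₁ < b₁ ∧
    R₂ < b₂ ∧
    R₀ + R₁ < e₁ ∧
    R₀ + R₂ < e₂ ∧
    R₁ + R₂ < a₁ + d₂ ∧
    R₁ + R₂ < a₂ + d₁ ∧
    R₁ + R₂ < c₁ + c₂ ∧
    R₀ + R₁ + R₂ < e₂ + a₁ ∧
    R₀ + R₁ + R₂ < e₁ + a₂ ∧
    2 * R₁ + R₂ < a₁ + d₁ + c₂ ∧
    R₁ + 2 * R₂ < a₂ + d₂ + c₁ ∧
    R₀ + 2 * R₁ + R₂ < a₁ + e₁ + c₂ ∧
    R₀ + R₁ + 2 * R₂ < a₂ + e₂ + c₁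

variable {a₁ b₁ c₁ d₁ e₁ a₂ b₂ c₂ d₂ e₂ R₀ R₁ R₂ : ℝ}

theorem RateConditions.swap (h : RateConditions a₁ b₁ c₁ d₁ e₁ a₂ b₂ c₂ d₂ e₂ R₀ R₁ R₂) :
    RateConditions a₂ b₂ c₂ d₂ e₂ a₁ b₁ c₁ d₁ e₁ R₀ R₂ R₁ := by
  obtain ⟨h1, h2, h3, h4, h5, h6, h7, h8, h9, h10, h11, h12, h13⟩ := h
  refine ⟨h2, h1, h4, h3, ?_, ?_, ?_, ?_, ?_, ?_, ?_, ?_, ?_⟩ <;> linarith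

/-- Finitely many strict inequalities survive a small increase of the rates. The slack pays for
compressing the sources to slightly more than their entropies. -/
theorem RateConditions.exists_slack (h : RateConditions a₁ b₁ c₁ d₁ e₁ a₂ b₂ c₂ d₂ e₂ R₀ R₁ R₂) :
    ∃ δ > 0, RateConditions a₁ b₁ c₁ d₁ e₁ a₂ b₂ c₂ d₂ e₂ (R₀ + δ) (R₁ + δ) (R₂ + δ) := by
  have key : ∀ k : ℝ, ∀ {x y : ℝ}, x < y → ∀ᶠ δ in nhdsWithin (0 : ℝ) (Set.Ioi 0),
      x + k * δ < y := by
    intro k x y hxy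
    have : Filter.Tendsto (fun δ : ℝ => x + k * δ) (nhdsWithin 0 (Set.Ioi 0)) (nhds (x + k * 0)) :=
      (Continuous.tendsto (by fun_prop) 0).mono_left nhdsWithin_le_nhds
    rw [mul_zero, add_zero] at this
    exact this.eventually_lt_const hxy
  obtain ⟨h1, h2, h3, h4, h5, h6, h7, h8, h9, h10, h11, h12, h13⟩ := h
  have hall : ∀ᶠ δ in nhdsWithin (0 : ℝ) (Set.Ioi 0),
      RateConditions a₁ b₁ c₁ d₁ e₁ a₂ b₂ c₂ d₂ e₂ (R₀ + δ) (R₁ + δ) (R₂ + δ) := by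
    -- The multiplier of δ is the sum of the coefficients of the rates in the inequality.
    filter_upwards [key 1 h1, key 1 h2, key 2 h3, key 2 h4, key 2 h5, key 2 h6, key 2 h7, key 3 h8,
      key 3 h9, key 3 h10, key 3 h11, key 4 h12, key 4 h13] with δ g1 g2 g3 g4 g5 g6 g7 g8 g9 g10
      g11 g12 g13
    refine ⟨?_, ?_, ?_, ?_, ?_, ?_, ?_, ?_, ?_, ?_, ?_, ?_, ?_⟩ <;> linarith
  obtain ⟨δ, hδ, hpos⟩ := (hall.and self_mem_nhdsWithin).exists
  exact ⟨δ, hpos, hδ⟩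

/-- A cloud rate lies in the closed interval [0, R] and obeys strict decoding bounds L, U. The
midpoint of (max L 0, U), cut off at R, satisfies everything. -/
theorem exists_mem_Icc_Ioo {L U R : ℝ} (hR : 0 ≤ R) (hU : 0 < U) (hLU : L < U) (hLR : L < R) :
    ∃ S, 0 ≤ S ∧ S ≤ R ∧ L < S ∧ S < U := by
  refine ⟨min R ((max L 0 + U) / 2), ?_, min_le_left _ _, ?_, ?_⟩
  · exact le_min hR (by linarith [le_max_right L 0])
  · exact lt_min hLR (by linarith [le_max_left L 0])
  · have : max L 0 < U := max_lt hLU hU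
    exact (min_le_right _ _).trans_lt (by linarith)

/-- Fourier–Motzkin elimination of the rates of the cloud centers. -/
theorem RateConditions.exists_splitting
    (h : RateConditions a₁ b₁ c₁ d₁ e₁ a₂ b₂ c₂ d₂ e₂ R₀ R₁ R₂)
    (hR₁ : 0 ≤ R₁) (hR₂ : 0 ≤ R₂) (hac₁ : a₁ ≤ c₁) (hac₂ : a₂ ≤ c₂) (hbd₁ : b₁ ≤ d₁)
    (hbd₂ : b₂ ≤ d₂) (h₁ : R₁ < a₁ + c₂) (h₂ : R₂ < a₂ + c₁) :
    ∃ S₁ S₂ : ℝ, 0 ≤ S₁ ∧ S₁ ≤ R₁ ∧ 0 ≤ S₂ ∧ S₂ ≤ R₂ ∧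
      (R₁ - S₁ = 0 ∨ R₁ - S₁ < a₁ ∧ R₁ - S₁ + S₂ < c₁) ∧ R₁ + S₂ < d₁ ∧ R₀ + R₁ + S₂ < e₁ ∧
      (R₂ - S₂ = 0 ∨ R₂ - S₂ < a₂ ∧ R₂ - S₂ + S₁ < c₂) ∧ R₂ + S₁ < d₂ ∧ R₀ + R₂ + S₁ < e₂ := by
  obtain ⟨h1, h2, h3, h4, h5, h6, h7, h8, h9, h10, h11, h12, h13⟩ := h
  -- When aᵢ ≤ 0 no satellite rate can satisfy 0 ≤ Tᵢ < aᵢ. Everything then goes into the clouds,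
  -- and Tᵢ = 0 makes the two satellite conditions void.
  rcases le_or_gt a₁ 0 with p₁ | p₁ <;> rcases le_or_gt a₂ 0 with p₂ | p₂
  · refine ⟨R₁, R₂, hR₁, le_rfl, hR₂, le_rfl, Or.inl (sub_self _), ?_, ?_, Or.inl (sub_self _),
      ?_, ?_⟩ <;> linarith
  · obtain ⟨S₂, g1, g2, g3, g4⟩ := exists_mem_Icc_Ioo
      (L := max (R₂ - a₂) (R₁ + R₂ - c₂)) (U := min (d₁ - R₁) (e₁ - R₀ - R₁)) hR₂
      (lt_min (by linarith) (by linarith))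
      (max_lt (lt_min (by linarith) (by linarith)) (lt_min (by linarith) (by linarith)))
      (max_lt (by linarith) (by linarith))
    obtain ⟨g3, g5⟩ := max_lt_iff.1 g3
    obtain ⟨g4, g6⟩ := lt_min_iff.1 g4
    refine ⟨R₁, S₂, hR₁, le_rfl, g1, g2, Or.inl (sub_self _), ?_, ?_, Or.inr ⟨?_, ?_⟩, ?_, ?_⟩ <;>
      linarith
  · obtain ⟨S₁, g1, g2, g3, g4⟩ := exists_mem_Icc_Ioo
      (L := max (R₁ - a₁) (R₁ + R₂ - c₁)) (U := min (d₂ - R₂) (e₂ - R₀ - R₂)) hR₁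
      (lt_min (by linarith) (by linarith))
      (max_lt (lt_min (by linarith) (by linarith)) (lt_min (by linarith) (by linarith)))
      (max_lt (by linarith) (by linarith))
    obtain ⟨g3, g5⟩ := max_lt_iff.1 g3
    obtain ⟨g4, g6⟩ := lt_min_iff.1 g4
    refine ⟨S₁, R₂, g1, g2, hR₂, le_rfl, Or.inr ⟨?_, ?_⟩, ?_, ?_, Or.inl (sub_self _), ?_, ?_⟩ <;>
      linarith
  -- S₂ is eliminated first: these bounds on S₁ comprise its own and those that make each lower
  -- bound on S₂ smaller than each upper bound. The hypotheses `h₁` and `h₂` enter through R₁ - a₁ <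
  -- c₂ and R₁ + R₂ - a₂ - c₁ < R₁.
  · obtain ⟨S₁, g1, g2, g3, g4⟩ := exists_mem_Icc_Ioo
      (L := max (R₁ - a₁) (R₁ + R₂ - a₂ - c₁))
      (U := min (min (d₂ - R₂) (e₂ - R₀ - R₂))
        (min c₂ (min (d₁ - R₁ + c₂ - R₂) (e₁ - R₀ - R₁ + c₂ - R₂)))) hR₁
      (lt_min (lt_min (by linarith) (by linarith))
        (lt_min (by linarith) (lt_min (by linarith) (by linarith))))
      (max_lt
        (lt_min (lt_min (by linarith) (by linarith))
          (lt_min (by linarith) (lt_min (by linarith) (by linarith))))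
        (lt_min (lt_min (by linarith) (by linarith))
          (lt_min (by linarith) (lt_min (by linarith) (by linarith)))))
      (max_lt (by linarith) (by linarith))
    obtain ⟨g3, g5⟩ := max_lt_iff.1 g3
    simp only [lt_min_iff] at g4
    obtain ⟨⟨g6, g7⟩, g8, g9, g10⟩ := g4
    -- The upper bound S₁ - R₁ + c₁ is positive because S₁ > R₁ - a₁ and a₁ ≤ c₁; it exceeds S₁ + R₂
    -- - c₂ because R₁ + R₂ < c₁ + c₂.
    obtain ⟨S₂, k1, k2, k3, k4⟩ := exists_mem_Icc_Ioo
      (L := max (R₂ - a₂) (S₁ + R₂ - c₂))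
      (U := min (min (d₁ - R₁) (e₁ - R₀ - R₁)) (S₁ - R₁ + c₁)) hR₂
      (lt_min (lt_min (by linarith) (by linarith)) (by linarith))
      (max_lt (lt_min (lt_min (by linarith) (by linarith)) (by linarith))
        (lt_min (lt_min (by linarith) (by linarith)) (by linarith)))
      (max_lt (by linarith) (by linarith))
    obtain ⟨k3, k5⟩ := max_lt_iff.1 k3
    simp only [lt_min_iff] at k4
    obtain ⟨⟨k6, k7⟩, k8⟩ := k4
    refine ⟨S₁, S₂, g1, g2, k1, k2, Or.inr ⟨?_, ?_⟩, ?_, ?_, Or.inr ⟨?_, ?_⟩, ?_, ?_⟩ <;> linarith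

end Elimination

/-! ### Conditioning reduces entropy -/

/-- Gibbs' inequality, in the form "conditioning reduces entropy". -/
theorem mean_logb_le {α : Type*} [Fintype α] {q f g : α → ℝ} (hq : IsLaw q)
    (hf : ∀ a, 0 < q a → 0 < f a) (hg : ∀ a, 0 < q a → 0 < g a)
    (h : mean q (fun a => g a / f a) ≤ 1) :
    mean q (fun a => Real.logb 2 (g a)) ≤ mean q (fun a => Real.logb 2 (f a)) := by
  have hl : 0 < Real.log 2 := Real.log_pos one_lt_two
  have h1 : mean q (fun a => Real.logb 2 (g a) - Real.logb 2 (f a)) ≤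
      mean q (fun a => (g a / f a - 1) * (1 / Real.log 2)) := by
    refine mean_mono_of_pos hq.nonneg fun a ha => ?_
    have := Real.log_le_sub_one_of_pos (div_pos (hg a ha) (hf a ha))
    rw [Real.log_div (hg a ha).ne' (hf a ha).ne'] at this
    rw [Real.logb, Real.logb, ← sub_div, mul_one_div]
    exact div_le_div_of_nonneg_right this hl.le
  rw [mean_sub, mean_mul_right, mean_sub, hq.mean_const] at h1
  have : (mean q (fun a => g a / f a) - 1) * (1 / Real.log 2) ≤ 0 :=
    mul_nonpos_of_nonpos_of_nonneg (by linarith) (by positivity)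
  linarith

/-- The left side is the g-mass of the support of f, since division by zero gives zero. -/
theorem sum_mul_div_le {α : Type*} [Fintype α] {f g : α → ℝ} (hf : ∀ a, 0 ≤ f a) (hg : IsLaw g) :
    ∑ a, f a * (g a / f a) ≤ 1 := by
  rw [← hg.sum_eq_one]
  refine Finset.sum_le_sum fun a _ => ?_
  rcases (hf a).eq_or_lt with h | h
  · rw [← h, zero_mul]; exact hg.nonneg a
  · rw [mul_div_cancel₀ _ h.ne']

namespace InputLaw

section Inequalities

variable {𝒲₀ 𝒲₁ 𝒲₂ 𝒳₁ 𝒳₂ 𝒴 : Type*} [Fintype 𝒲₀] [Fintype 𝒲₁] [Fintype 𝒲₂]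
    [Fintype 𝒳₁] [Fintype 𝒳₂] [Fintype 𝒴] (L : InputLaw 𝒲₀ 𝒲₁ 𝒲₂ 𝒳₁ 𝒳₂)
    {V : 𝒳₁ → 𝒳₂ → 𝒴 → ℝ} (hV : ∀ x₁ x₂, IsLaw (V x₁ x₂))
include hV

/-- `outWX` is also p(y|w₀w₁w₂x₁), as W₁ acts on Y only through X₁. So this compares H(Y|W₀W₁W₂X₁)
with H(Y|W₀W₁), although w₁ does not appear in `outWX`. -/
theorem negW₁_le_negWX : L.negW₁ V ≤ L.negWX V := by
  refine mean_logb_le (L.isLaw_joint hV) (fun z hz => (L.pos_of_joint_pos hV hz).1)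
    (fun z hz => (L.pos_of_joint_pos hV hz).2.2.2.1) ?_
  rw [mean_joint]
  refine L.law₀.mean_le fun w₀ => (L.law₁ _).mean_le fun w₁ => (L.lawX₁ _ _).mean_le fun x₁ =>
    (L.law₂ _).mean_le fun w₂ => ?_
  simp only [fun x₁ x₂ => mean.eq_1 (V x₁ x₂), mean_finset_sum, mean_mul_right]
  exact sum_mul_div_le (L.isLaw_outWX hV _ _ _).nonneg (L.isLaw_outW₁ hV _ _)

theorem negW₁_le_negWWW : L.negW₁ V ≤ L.negWWW V := by
  refine mean_logb_le (L.isLaw_joint hV) (fun z hz => (L.pos_of_joint_pos hV hz).2.1)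
    (fun z hz => (L.pos_of_joint_pos hV hz).2.2.2.1) ?_
  rw [mean_joint]
  refine L.law₀.mean_le fun w₀ => (L.law₁ _).mean_le fun w₁ => ?_
  rw [mean_comm]
  refine (L.law₂ _).mean_le fun w₂ => ?_
  simp only [fun x₁ x₂ => mean.eq_1 (V x₁ x₂), mean_finset_sum, mean_mul_right]
  exact sum_mul_div_le (L.isLaw_outWWW hV _ _ _).nonneg (L.isLaw_outW₁ hV _ _)

theorem negW₀_le_negW₂ : L.negW₀ V ≤ L.negW₂ V := by
  refine mean_logb_le (L.isLaw_joint hV) (fun z hz => (L.pos_of_joint_pos hV hz).2.2.1)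
    (fun z hz => (L.pos_of_joint_pos hV hz).2.2.2.2.1) ?_
  rw [mean_joint]
  refine L.law₀.mean_le fun w₀ => ?_
  simp only [mean_comm _ (L.q₂ w₀)]
  refine (L.law₂ _).mean_le fun w₂ => ?_
  simp only [fun x₁ x₂ => mean.eq_1 (V x₁ x₂), mean_finset_sum, mean_mul_right]
  exact sum_mul_div_le (L.isLaw_outW₂ hV _ _).nonneg (L.isLaw_outW₀ hV _)

end Inequalities

/-! ### Removal of the auxiliary variable W₁ -/

section Merge

variable {𝒲₀ 𝒲₁ 𝒲₂ 𝒳₁ 𝒳₂ 𝒴 : Type*} [Fintype 𝒲₀] [Fintype 𝒲₁] [Fintype 𝒲₂]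
    [Fintype 𝒳₁] [Fintype 𝒳₂] [Fintype 𝒴] (L : InputLaw 𝒲₀ 𝒲₁ 𝒲₂ 𝒳₁ 𝒳₂)

theorem mean_mixture {α β : Type*} [Fintype α] [Fintype β] (p : α → ℝ) (q : α → β → ℝ)
    (f : β → ℝ) : mean (fun b => mean p fun a => q a b) f = mean p fun a => mean (q a) f := by
  simp only [mean, Finset.sum_mul, Finset.mul_sum]
  rw [Finset.sum_comm]
  exact Finset.sum_congr rfl fun a _ => Finset.sum_congr rfl fun b _ => by ring

/-- The input law with a trivial variable in the place of `W₁`. -/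
def merge : InputLaw 𝒲₀ Unit 𝒲₂ 𝒳₁ 𝒳₂ where
  q₀ := L.q₀
  q₁ _ _ := 1
  q₂ := L.q₂
  r₁ w₀ _ x₁ := mean (L.q₁ w₀) fun w₁ => L.r₁ w₀ w₁ x₁
  r₂ := L.r₂
  law₀ := L.law₀
  law₁ _ := ⟨fun _ => zero_le_one, by simp⟩
  law₂ := L.law₂
  lawX₁ w₀ _ := ⟨fun x => mean_nonneg (L.law₁ _).nonneg fun w => (L.lawX₁ _ _).nonneg _, by
    simp only [← mean_finset_sum, (L.lawX₁ _ _).sum_eq_one, (L.law₁ _).mean_const]⟩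
  lawX₂ := L.lawX₂

theorem mean_merge_q₁ (w₀ : 𝒲₀) (f : Unit → ℝ) : mean (L.merge.q₁ w₀) f = f () := by
  simp [merge, mean]

theorem mean_merge_r₁ (w₀ : 𝒲₀) (u : Unit) (f : 𝒳₁ → ℝ) :
    mean (L.merge.r₁ w₀ u) f = mean (L.q₁ w₀) fun w₁ => mean (L.r₁ w₀ w₁) f :=
  mean_mixture _ _ _

theorem mean_joint_merge (V : 𝒳₁ → 𝒳₂ → 𝒴 → ℝ)
    (f : ((((𝒲₀ × Unit) × 𝒳₁) × 𝒲₂) × 𝒳₂) × 𝒴 → ℝ) :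
    mean (L.merge.joint V) f =
      mean (L.joint V) fun z => f (((((z.1.1.1.1.1, ()), z.1.1.1.2), z.1.1.2), z.1.2), z.2) := by
  simp only [mean_joint, mean_merge_q₁, mean_merge_r₁]
  rfl

theorem mean_joint_merge_swap (V : 𝒳₂ → 𝒳₁ → 𝒴 → ℝ)
    (f : ((((𝒲₀ × 𝒲₂) × 𝒳₂) × Unit) × 𝒳₁) × 𝒴 → ℝ) :
    mean (L.merge.swap.joint V) f = mean (L.swap.joint V) fun z =>
      f (((((z.1.1.1.1.1, z.1.1.1.1.2), z.1.1.1.2), ()), z.1.2), z.2) := by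
  simp only [mean_joint, swap, mean_merge_q₁, mean_merge_r₁]
  rfl

section
variable (V : 𝒳₁ → 𝒳₂ → 𝒴 → ℝ)

/-- For receiver 1, forgetting W₁ turns the denominator p(y|w₀w₁w₂) into p(y|w₀w₂) and p(y|w₀w₁)
into p(y|w₀), while p(y|w₀w₂x₁) is untouched. Thus a₁ becomes b₁ and c₁ becomes d₁. -/
theorem merge_outWWW (w₀ : 𝒲₀) (u : Unit) (w₂ : 𝒲₂) (y : 𝒴) :
    L.merge.outWWW V w₀ u w₂ y = L.outW₂ V w₀ w₂ y := by
  unfold outWWW; rw [mean_merge_r₁]; rfl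

theorem merge_outW₁ (w₀ : 𝒲₀) (u : Unit) (y : 𝒴) :
    L.merge.outW₁ V w₀ u y = L.outW₀ V w₀ y := by
  unfold outW₁ outW₀ outW₁
  simp only [merge_outWWW, outW₂]
  exact mean_comm _ _ _

theorem merge_out (y : 𝒴) : L.merge.out V y = L.out V y := by
  unfold out
  simp only [outW₀, mean_merge_q₁, merge_outW₁]
  rfl

theorem merge_negWX : L.merge.negWX V = L.negWX V := mean_joint_merge _ _ _

theorem merge_negWWW : L.merge.negWWW V = L.negW₂ V := by
  unfold negWWW; rw [mean_joint_merge]; simp only [merge_outWWW]; rfl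

theorem merge_negW₁ : L.merge.negW₁ V = L.negW₀ V := by
  unfold negW₁; rw [mean_joint_merge]; simp only [merge_outW₁]; rfl

theorem merge_negOut : L.merge.negOut V = L.negOut V := by
  unfold negOut; rw [mean_joint_merge]; simp only [merge_out]

end

variable (V : 𝒳₂ → 𝒳₁ → 𝒴 → ℝ)

/-- Receiver 2 can no longer resolve the interference through w₁, so its numerator is averaged over
w₁. The denominators that do not involve w₁ are unaffected. -/
theorem merge_swap_outWX (w₀ : 𝒲₀) (u : Unit) (x₂ : 𝒳₂) (y : 𝒴) :
    L.merge.swap.outWX V w₀ u x₂ y = mean (L.q₁ w₀) fun w₁ => L.swap.outWX V w₀ w₁ x₂ y :=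
  L.mean_merge_r₁ w₀ u fun x₁ => V x₂ x₁ y

theorem merge_swap_outW₁ (w₀ : 𝒲₀) (w₂ : 𝒲₂) (y : 𝒴) :
    L.merge.swap.outW₁ V w₀ w₂ y = L.swap.outW₁ V w₀ w₂ y := by
  unfold outW₁ outWWW
  simp only [merge_swap_outWX]
  exact (L.mean_merge_q₁ w₀ fun _ => mean (L.r₂ w₀ w₂) fun x₂ => mean (L.q₁ w₀) fun w₁ =>
    L.swap.outWX V w₀ w₁ x₂ y).trans (mean_comm _ _ _)

theorem merge_swap_outW₀ (w₀ : 𝒲₀) (y : 𝒴) :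
    L.merge.swap.outW₀ V w₀ y = L.swap.outW₀ V w₀ y := by
  unfold outW₀
  simp only [merge_swap_outW₁]
  rfl

theorem merge_swap_outW₂ (w₀ : 𝒲₀) (u : Unit) (y : 𝒴) :
    L.merge.swap.outW₂ V w₀ u y = L.swap.outW₀ V w₀ y := by
  rw [← merge_swap_outW₀]
  unfold outW₀ outW₂ outW₁
  congr 1
  funext w₂
  exact (mean_merge_q₁ L w₀ fun u => L.merge.swap.outWWW V w₀ w₂ u y).symm

theorem merge_swap_out (y : 𝒴) : L.merge.swap.out V y = L.swap.out V y := by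
  unfold out
  simp only [merge_swap_outW₀]
  rfl

theorem merge_swap_negW₁ : L.merge.swap.negW₁ V = L.swap.negW₁ V := by
  unfold negW₁; rw [mean_joint_merge_swap]; simp only [merge_swap_outW₁]

theorem merge_swap_negW₂ : L.merge.swap.negW₂ V = L.swap.negW₀ V := by
  unfold negW₂; rw [mean_joint_merge_swap]; simp only [merge_swap_outW₂]; rfl

theorem merge_swap_negOut : L.merge.swap.negOut V = L.swap.negOut V := by
  unfold negOut; rw [mean_joint_merge_swap]; simp only [merge_swap_out]

end Merge

/-! ### Achievability of the thirteen inequalities -/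

section Region

variable {𝒲₀ 𝒲₁ 𝒲₂ 𝒳₁ 𝒳₂ 𝒴₁ 𝒴₂ : Type*} [Fintype 𝒲₀] [Fintype 𝒲₁] [Fintype 𝒲₂]
    [Fintype 𝒳₁] [Fintype 𝒳₂] [Fintype 𝒴₁] [Fintype 𝒴₂] (L : InputLaw 𝒲₀ 𝒲₁ 𝒲₂ 𝒳₁ 𝒳₂)

/-- The thirteen inequalities for an input law and the two marginal channels. -/
def Region (V₁ : 𝒳₁ → 𝒳₂ → 𝒴₁ → ℝ) (V₂ : 𝒳₂ → 𝒳₁ → 𝒴₂ → ℝ) (R₀ R₁ R₂ : ℝ) : Prop :=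
  RateConditions (L.negWX V₁ - L.negWWW V₁) (L.negWX V₁ - L.negW₂ V₁) (L.negWX V₁ - L.negW₁ V₁)
    (L.negWX V₁ - L.negW₀ V₁) (L.negWX V₁ - L.negOut V₁)
    (L.swap.negWX V₂ - L.swap.negWWW V₂) (L.swap.negWX V₂ - L.swap.negW₂ V₂)
    (L.swap.negWX V₂ - L.swap.negW₁ V₂) (L.swap.negWX V₂ - L.swap.negW₀ V₂)
    (L.swap.negWX V₂ - L.swap.negOut V₂) R₀ R₁ R₂

variable {L} {V₁ : 𝒳₁ → 𝒳₂ → 𝒴₁ → ℝ} {V₂ : 𝒳₂ → 𝒳₁ → 𝒴₂ → ℝ} {R₀ R₁ R₂ : ℝ}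

/-- If the rate of user 1 is so large that decoder 2 does not profit from the cloud centers of
user 1, the variable `W₁` is dropped, and all of the message of user 2 is put into its cloud
centers. -/
theorem Region.randomCodable_of_le (h : L.Region V₁ V₂ R₀ R₁ R₂)
    (hV₁ : ∀ x₁ x₂, IsLaw (V₁ x₁ x₂)) (hV₂ : ∀ x₂ x₁, IsLaw (V₂ x₂ x₁)) (hR₁ : 0 ≤ R₁)
    (hR₂ : 0 ≤ R₂)
    (hle : L.negWX V₁ - L.negWWW V₁ + (L.swap.negWX V₂ - L.swap.negW₁ V₂) ≤ R₁) :
    RandomCodable V₁ V₂ R₀ R₁ R₂ := by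
  obtain ⟨h1, h2, h3, h4, h5, h6, h7, h8, h9, h10, h11, h12, h13⟩ := h
  -- This is H(Y₂|W₀W₂X₂) ≤ H(Y₂|W₀W₂); it replaces exact knowledge of the averaged numerator of
  -- receiver 2.
  have hX := L.merge.swap.negW₁_le_negWX hV₂
  rw [merge_swap_negW₁] at hX
  have := randomCodable_of_decodable L.merge hV₁ hV₂ (R₀ := R₀) (S₁ := 0) (T₁ := R₁) (S₂ := R₂)
    (T₂ := 0) le_rfl hR₁ hR₂ le_rfl
    { satellite := Or.inr (by rw [merge_negWX, merge_negWWW]; exact h1)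
      cloud := Or.inl rfl
      -- Subtracting a₁ + c₂ ≤ R₁ from 2R₁ + R₂ < a₁ + d₁ + c₂ gives R₁ + R₂ < d₁; in the same way
      -- `h12` yields the last condition R₀ + R₁ + R₂ < e₁.
      satellite_cloud := Or.inr (Or.inr (by rw [merge_negWX, merge_negW₁]; linarith))
      cloud_cloud := Or.inl rfl
      all := by rw [merge_negWX, merge_negOut]; linarith }
    { satellite := Or.inl rfl
      -- From `h5`, R₂ < a₁ + d₂ - R₁ ≤ d₂ - c₂ = I(W₂;Y₂|W₀), and `hX` bounds this by the
      -- information available after the removal of W₁. The last condition uses `h8` and e₂ - c₂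
      -- alike.
      cloud := Or.inr (by rw [merge_swap_negW₂]; linarith)
      satellite_cloud := Or.inl rfl
      cloud_cloud := Or.inr (Or.inl rfl)
      all := by rw [merge_swap_negOut]; linarith }
  simpa using this

/-- The thirteen inequalities are sufficient for reliable transmission of messages. -/
theorem Region.randomCodable (h : L.Region V₁ V₂ R₀ R₁ R₂)
    (hV₁ : ∀ x₁ x₂, IsLaw (V₁ x₁ x₂)) (hV₂ : ∀ x₂ x₁, IsLaw (V₂ x₂ x₁)) (hR₁ : 0 ≤ R₁)
    (hR₂ : 0 ≤ R₂) : RandomCodable V₁ V₂ R₀ R₁ R₂ := by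
  -- R₁ < a₁ + c₂ and R₂ < a₂ + c₁ are needed for splitting but are not among the thirteen
  -- inequalities. When one fails, the corresponding cloud variable is dropped.
  rcases le_or_gt (L.negWX V₁ - L.negWWW V₁ + (L.swap.negWX V₂ - L.swap.negW₁ V₂)) R₁ with g₁ | g₁
  · exact h.randomCodable_of_le hV₁ hV₂ hR₁ hR₂ g₁
  rcases le_or_gt (L.swap.negWX V₂ - L.swap.negWWW V₂ + (L.negWX V₁ - L.negW₁ V₁)) R₂ with g₂ | g₂
  · exact (Region.randomCodable_of_le (L := L.swap) (RateConditions.swap h) hV₂ hV₁ hR₂ hR₁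
      g₂).swap
  obtain ⟨S₁, S₂, s1, s2, s3, s4, k1, k2, k3, k4, k5, k6⟩ := h.exists_splitting hR₁ hR₂
    (by linarith [L.negW₁_le_negWWW hV₁]) (by linarith [L.swap.negW₁_le_negWWW hV₂])
    (by linarith [L.negW₀_le_negW₂ hV₁]) (by linarith [L.swap.negW₀_le_negW₂ hV₂]) g₁ g₂
  have := randomCodable_of_decodable L hV₁ hV₂ (R₀ := R₀) (S₁ := S₁) (T₁ := R₁ - S₁) (S₂ := S₂)
    (T₂ := R₂ - S₂) s1 (by linarith) s3 (by linarith)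
    { satellite := k1.imp_right And.left
      cloud := Or.inr (by linarith [h.1])
      satellite_cloud := k1.imp_right fun k => Or.inr k.2
      cloud_cloud := Or.inr (Or.inr (by linarith))
      all := by linarith }
    { satellite := k4.imp_right And.left
      cloud := Or.inr (by linarith [h.2.1])
      satellite_cloud := k4.imp_right fun k => Or.inr k.2
      cloud_cloud := Or.inr (Or.inr (by linarith))
      all := by linarith }
  simpa using this

end Region

end InputLaw

/-! ### Mutual informations as expectations -/

section Weights

variable {Ω α β γ : Type*} [Fintype Ω]

/-- The weight function of a probability mass function. -/
def weight (P : PMF Ω) : Ω → ℝ := fun ω => (P ω).toReal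

theorem isLaw_weight (P : PMF Ω) : IsLaw (weight P) where
  nonneg _ := ENNReal.toReal_nonneg
  sum_eq_one := by
    unfold weight
    rw [← ENNReal.toReal_sum fun ω _ => P.apply_ne_top ω, ← tsum_fintype (L := .unconditional Ω),
      P.tsum_coe, ENNReal.toReal_one]

theorem weight_bind_apply [Fintype α] (P : PMF α) (f : α → PMF Ω) (ω : Ω) :
    weight (P.bind f) ω = mean (weight P) fun a => weight (f a) ω := by
  unfold weight mean
  rw [PMF.bind_apply, tsum_fintype, ENNReal.toReal_sum fun a _ =>
    ENNReal.mul_ne_top (P.apply_ne_top a) ((f a).apply_ne_top ω)]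
  simp only [ENNReal.toReal_mul]

theorem mean_bind [Fintype α] (P : PMF α) (f : α → PMF Ω) (g : Ω → ℝ) :
    mean (weight (P.bind f)) g = mean (weight P) fun a => mean (weight (f a)) g := by
  have : weight (P.bind f) = fun ω => mean (weight P) fun a => weight (f a) ω :=
    funext fun ω => weight_bind_apply P f ω
  rw [this]
  exact InputLaw.mean_mixture _ _ _

theorem mean_pure (a : Ω) (g : Ω → ℝ) : mean (weight (PMF.pure a)) g = g a := by
  classical
  unfold mean weight
  simp [PMF.pure_apply, apply_ite]

open Classical in
theorem prob_eq_mean (P : PMF Ω) (X : Ω → α) (a : α) :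
    prob P X a = mean (weight P) fun ω => if X ω = a then 1 else 0 := by
  unfold prob mean weight
  rw [PMF.map_apply, tsum_fintype, ENNReal.toReal_sum]
  · refine Finset.sum_congr rfl fun ω _ => ?_
    by_cases h : X ω = a
    · simp [h]
    · simp [h, Ne.symm h]
  · intro ω _
    split_ifs
    · exact P.apply_ne_top ω
    · exact ENNReal.zero_ne_top

theorem sum_prob_mul [Fintype α] (P : PMF Ω) (X : Ω → α) (g : α → ℝ) :
    ∑ a, prob P X a * g a = mean (weight P) fun ω => g (X ω) := by
  classical
  simp only [prob_eq_mean, ← mean_mul_right, ← mean_finset_sum]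
  congr 1; funext ω
  simp

theorem prob_pos (P : PMF Ω) (X : Ω → α) {ω : Ω} (h : 0 < weight P ω) : 0 < prob P X (X ω) := by
  classical
  rw [prob_eq_mean]
  refine mean_pos_of_pos (isLaw_weight P).nonneg (fun _ => ?_) h ?_
  · positivity
  · simp

theorem prob_nonneg {Ω : Type*} (P : PMF Ω) (X : Ω → α) (a : α) : 0 ≤ prob P X a :=
  ENNReal.toReal_nonneg

theorem prob_le_one {Ω : Type*} (P : PMF Ω) (X : Ω → α) (a : α) : prob P X a ≤ 1 :=
  ENNReal.toReal_le_of_le_ofReal zero_le_one (by simpa using (P.map X).coe_le_one a)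

theorem entropy_eq_mean [Fintype α] (P : PMF Ω) (X : Ω → α) :
    entropy P X = -mean (weight P) fun ω => Real.logb 2 (prob P X (X ω)) := by
  unfold entropy
  rw [sum_prob_mul P X fun a => Real.logb 2 (prob P X a)]

theorem condEntropy_eq_mean [Fintype α] [Fintype γ] (P : PMF Ω) (X : Ω → α) (Z : Ω → γ) :
    condEntropy P X Z = -mean (weight P) fun ω =>
      Real.logb 2 (prob P (fun ω => (X ω, Z ω)) (X ω, Z ω) / prob P Z (Z ω)) := by
  unfold condEntropy
  rw [← Fintype.sum_prod_type' (f := fun a c => prob P (fun ω => (X ω, Z ω)) (a, c) *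
    Real.logb 2 (prob P (fun ω => (X ω, Z ω)) (a, c) / prob P Z c))]
  rw [sum_prob_mul P (fun ω => (X ω, Z ω)) fun a =>
    Real.logb 2 (prob P (fun ω => (X ω, Z ω)) a / prob P Z a.2)]

theorem entropy_nonneg {Ω : Type*} [Fintype α] (P : PMF Ω) (X : Ω → α) : 0 ≤ entropy P X := by
  unfold entropy
  rw [neg_nonneg]
  exact Finset.sum_nonpos fun a _ => mul_nonpos_of_nonneg_of_nonpos (prob_nonneg _ _ _)
    (Real.logb_nonpos one_lt_two (prob_nonneg _ _ _) (prob_le_one _ _ _))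

open Classical in
/-- `K` is the conditional law of `Y` given `U`. -/
def IsKernel (P : PMF Ω) (U : Ω → α) (Y : Ω → β) (K : α → β → ℝ) : Prop :=
  ∀ (G : α → ℝ) (y : β), (mean (weight P) fun ω => G (U ω) * if Y ω = y then 1 else 0) =
    mean (weight P) fun ω => G (U ω) * K (U ω) y

/-- If the conditional law depends on U only through p(U), it is the conditional law given p(U).
This serves both to discard variables and to reorder tuples. -/
theorem IsKernel.comp {P : PMF Ω} {U : Ω → α} {Y : Ω → β} {K' : α → β → ℝ}
    (h : IsKernel P U Y K') (p : α → γ) (K : γ → β → ℝ) (hK : ∀ u, K' u = K (p u)) :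
    IsKernel P (fun ω => p (U ω)) Y K := fun G y => by
  simpa only [hK] using h (fun u => G (p u)) y

theorem IsKernel.prob_eq {P : PMF Ω} {U : Ω → α} {Y : Ω → β} {K : α → β → ℝ}
    (h : IsKernel P U Y K) (u : α) (y : β) :
    (prob P (fun ω => (U ω, Y ω)) (u, y)) = prob P U u * K u y := by
  classical
  have := h (fun u' => if u' = u then 1 else 0) y
  rw [prob_eq_mean, prob_eq_mean, ← mean_mul_right]
  convert this using 2
  · funext ω
    by_cases h1 : U ω = u <;> by_cases h2 : Y ω = y <;> simp [h1, h2]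
  · funext ω
    by_cases h1 : U ω = u <;> simp [h1]

theorem prob_comp_injective {α β : Type*} (P : PMF Ω) (X : Ω → α) {e : α → β}
    (he : Function.Injective e) (a : α) : prob P (fun ω => e (X ω)) (e a) = prob P X a := by
  classical
  simp only [prob_eq_mean, he.eq_iff]

/-- Bayes' rule p(x|yz)/p(x|z) = p(y|xz)/p(y|z), applied where the weight is positive. All
informations thus become differences of output log-likelihoods, the form that the thresholds use. -/
theorem condMutualInfo_eq_of_isKernel [Fintype α] [Fintype β] [Fintype γ] {P : PMF Ω} {X : Ω → α}
    {Y : Ω → β} {Z : Ω → γ} {N : α × γ → β → ℝ} {D : γ → β → ℝ}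
    (hN : IsKernel P (fun ω => (X ω, Z ω)) Y N) (hD : IsKernel P Z Y D) :
    condMutualInfo P X Y Z = mean (weight P) (fun ω => Real.logb 2 (N (X ω, Z ω) (Y ω))) -
      mean (weight P) fun ω => Real.logb 2 (D (Z ω) (Y ω)) := by
  unfold condMutualInfo
  rw [condEntropy_eq_mean, condEntropy_eq_mean, sub_neg_eq_add, neg_add_eq_sub, ← mean_sub,
    ← mean_sub]
  refine mean_congr_of_pos (isLaw_weight P).nonneg fun ω hω => ?_
  have e1 : prob P (fun ω => (X ω, Y ω, Z ω)) (X ω, Y ω, Z ω) =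
      prob P (fun ω => (X ω, Z ω)) (X ω, Z ω) * N (X ω, Z ω) (Y ω) := by
    rw [← hN.prob_eq]
    exact prob_comp_injective P (fun ω => ((X ω, Z ω), Y ω)) (e := fun q => (q.1.1, q.2, q.1.2))
      (fun q q' h => by simp only [Prod.mk.injEq] at h; ext <;> simp [h]) ((X ω, Z ω), Y ω)
  have e2 : prob P (fun ω => (Y ω, Z ω)) (Y ω, Z ω) = prob P Z (Z ω) * D (Z ω) (Y ω) := by
    rw [← hD.prob_eq]
    exact prob_comp_injective P (fun ω => (Z ω, Y ω)) (e := Prod.swap) Prod.swap_injective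
      (Z ω, Y ω)
  have p1 := prob_pos P (fun ω => (X ω, Y ω, Z ω)) hω
  have p2 := prob_pos P (fun ω => (Y ω, Z ω)) hω
  have p3 := prob_pos P (fun ω => (X ω, Z ω)) hω
  have p4 := prob_pos P Z hω
  rw [e1] at p1
  rw [e2] at p2
  rw [e1, e2]
  have n := (pos_iff_pos_of_mul_pos p1).1 p3
  have d := (pos_iff_pos_of_mul_pos p2).1 p4
  rw [Real.logb_div p1.ne' p2.ne', Real.logb_mul p3.ne' n.ne', Real.logb_mul p4.ne' d.ne',
    Real.logb_div p3.ne' p4.ne']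
  ring

theorem mutualInfo_eq_of_isKernel [Fintype α] [Fintype β] {P : PMF Ω} {X : Ω → α}
    {Y : Ω → β} {N : α → β → ℝ} {D : β → ℝ}
    (hN : IsKernel P X Y N) (hD : IsKernel P (fun _ => ()) Y fun _ => D) :
    mutualInfo P X Y = mean (weight P) (fun ω => Real.logb 2 (N (X ω) (Y ω))) -
      mean (weight P) fun ω => Real.logb 2 (D (Y ω)) := by
  unfold mutualInfo
  rw [entropy_eq_mean, condEntropy_eq_mean, sub_neg_eq_add, neg_add_eq_sub, ← mean_sub,
    ← mean_sub]
  refine mean_congr_of_pos (isLaw_weight P).nonneg fun ω hω => ?_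
  have e1 := hN.prob_eq (X ω) (Y ω)
  have e2 : prob P Y (Y ω) = D (Y ω) := by
    have h := hD.prob_eq () (Y ω)
    have h1 : prob P (fun _ : Ω => ()) () = 1 := by
      classical
      rw [prob_eq_mean]; simpa using (isLaw_weight P).mean_const 1
    rw [h1, one_mul] at h
    rw [← h]
    exact (prob_comp_injective P Y (e := fun y => ((), y)) (fun y y' h => by simpa using h)
      (Y ω)).symm
  have p1 := prob_pos P (fun ω => (X ω, Y ω)) hω
  have p2 := prob_pos P Y hω
  have p3 := prob_pos P X hω
  rw [e1] at p1
  have n := (pos_iff_pos_of_mul_pos p1).1 p3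
  rw [e1, Real.logb_div p1.ne' p2.ne', Real.logb_mul p3.ne' n.ne', e2]
  ring

end Weights

/-! ### Mutual informations in terms of the output laws -/

section HasJoint

variable {Ω 𝒲₀ 𝒲₁ 𝒲₂ 𝒳₁ 𝒳₂ 𝒴 : Type*} [Fintype Ω] [Fintype 𝒲₀] [Fintype 𝒲₁] [Fintype 𝒲₂]
    [Fintype 𝒳₁] [Fintype 𝒳₂] [Fintype 𝒴]

/-- The random variables have the joint law given by an input law and a channel. -/
def HasJoint (P : PMF Ω) (L : InputLaw 𝒲₀ 𝒲₁ 𝒲₂ 𝒳₁ 𝒳₂) (V : 𝒳₁ → 𝒳₂ → 𝒴 → ℝ) (W₀ : Ω → 𝒲₀)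
    (W₁ : Ω → 𝒲₁) (W₂ : Ω → 𝒲₂) (X₁ : Ω → 𝒳₁) (X₂ : Ω → 𝒳₂) (Y : Ω → 𝒴) : Prop :=
  ∀ f : ((((𝒲₀ × 𝒲₁) × 𝒳₁) × 𝒲₂) × 𝒳₂) × 𝒴 → ℝ,
    (mean (weight P) fun ω => f (((((W₀ ω, W₁ ω), X₁ ω), W₂ ω), X₂ ω), Y ω)) = mean (L.joint V) f

namespace HasJoint

variable {P : PMF Ω} {L : InputLaw 𝒲₀ 𝒲₁ 𝒲₂ 𝒳₁ 𝒳₂} {V : 𝒳₁ → 𝒳₂ → 𝒴 → ℝ} {W₀ : Ω → 𝒲₀}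
    {W₁ : Ω → 𝒲₁} {W₂ : Ω → 𝒲₂} {X₁ : Ω → 𝒳₁} {X₂ : Ω → 𝒳₂} {Y : Ω → 𝒴}
    (h : HasJoint P L V W₀ W₁ W₂ X₁ X₂ Y) (hV : ∀ x₁ x₂, IsLaw (V x₁ x₂))
include h

theorem mean_eq (f : 𝒲₀ → 𝒲₁ → 𝒳₁ → 𝒲₂ → 𝒳₂ → 𝒴 → ℝ) :
    (mean (weight P) fun ω => f (W₀ ω) (W₁ ω) (X₁ ω) (W₂ ω) (X₂ ω) (Y ω)) =
      mean L.q₀ fun w₀ => mean (L.q₁ w₀) fun w₁ => mean (L.r₁ w₀ w₁) fun x₁ =>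
      mean (L.q₂ w₀) fun w₂ => mean (L.r₂ w₀ w₂) fun x₂ => mean (V x₁ x₂) fun y =>
        f w₀ w₁ x₁ w₂ x₂ y := by
  rw [← L.mean_joint V fun z => f z.1.1.1.1.1 z.1.1.1.1.2 z.1.1.1.2 z.1.1.2 z.1.2 z.2]
  exact h fun z => f z.1.1.1.1.1 z.1.1.1.1.2 z.1.1.1.2 z.1.1.2 z.1.2 z.2

theorem mean_joint_eq (f : 𝒲₀ → 𝒲₁ → 𝒳₁ → 𝒲₂ → 𝒳₂ → 𝒴 → ℝ) :
    (mean (weight P) fun ω => f (W₀ ω) (W₁ ω) (X₁ ω) (W₂ ω) (X₂ ω) (Y ω)) =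
      mean (L.joint V) fun z => f z.1.1.1.1.1 z.1.1.1.1.2 z.1.1.1.2 z.1.1.2 z.1.2 z.2 :=
  h fun z => f z.1.1.1.1.1 z.1.1.1.1.2 z.1.1.1.2 z.1.1.2 z.1.2 z.2

theorem mean_outWX :
    (mean (weight P) fun ω => Real.logb 2 (L.outWX V (W₀ ω) (W₂ ω) (X₁ ω) (Y ω))) =
      L.negWX V :=
  h.mean_joint_eq fun w₀ _ x₁ w₂ _ y => Real.logb 2 (L.outWX V w₀ w₂ x₁ y)

theorem mean_outWWW :
    (mean (weight P) fun ω => Real.logb 2 (L.outWWW V (W₀ ω) (W₁ ω) (W₂ ω) (Y ω))) =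
      L.negWWW V :=
  h.mean_joint_eq fun w₀ w₁ _ w₂ _ y => Real.logb 2 (L.outWWW V w₀ w₁ w₂ y)

theorem mean_outW₂ :
    (mean (weight P) fun ω => Real.logb 2 (L.outW₂ V (W₀ ω) (W₂ ω) (Y ω))) =
      L.negW₂ V :=
  h.mean_joint_eq fun w₀ _ _ w₂ _ y => Real.logb 2 (L.outW₂ V w₀ w₂ y)

theorem mean_outW₁ :
    (mean (weight P) fun ω => Real.logb 2 (L.outW₁ V (W₀ ω) (W₁ ω) (Y ω))) =
      L.negW₁ V :=
  h.mean_joint_eq fun w₀ w₁ _ _ _ y => Real.logb 2 (L.outW₁ V w₀ w₁ y)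

theorem mean_outW₀ :
    (mean (weight P) fun ω => Real.logb 2 (L.outW₀ V (W₀ ω) (Y ω))) =
      L.negW₀ V :=
  h.mean_joint_eq fun w₀ _ _ _ _ y => Real.logb 2 (L.outW₀ V w₀ y)

theorem mean_out :
    (mean (weight P) fun ω => Real.logb 2 (L.out V (Y ω))) =
      L.negOut V :=
  h.mean_joint_eq fun _ _ _ _ _ y => Real.logb 2 (L.out V y)

open Classical in
omit h in
theorem mean_indicator (q : 𝒴 → ℝ) (y : 𝒴) :
    (mean q fun y' => if y' = y then 1 else 0) = q y := by
  simp [mean]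

include hV

/-- W₁ is part of the condition although the kernel ignores it. By `IsKernel.comp` this single fact
then covers the conditionings with W₁ and those without. -/
theorem isKernel_outWX : IsKernel P (fun ω => (W₀ ω, W₁ ω, W₂ ω, X₁ ω)) Y
    fun u => L.outWX V u.1 u.2.2.1 u.2.2.2 := by
  classical
  intro G y
  rw [h.mean_eq fun w₀ w₁ x₁ w₂ x₂ y' => G (w₀, w₁, w₂, x₁) * if y' = y then 1 else 0,
    h.mean_eq fun w₀ w₁ x₁ w₂ x₂ y' => G (w₀, w₁, w₂, x₁) * L.outWX V w₀ w₂ x₁ y]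
  simp only [mean_mul_left, mean_indicator, (hV _ _).mean_const, (L.lawX₂ _ _).mean_const]
  rfl

theorem isKernel_outWWW : IsKernel P (fun ω => (W₀ ω, W₁ ω, W₂ ω)) Y
    fun u => L.outWWW V u.1 u.2.1 u.2.2 := by
  classical
  intro G y
  rw [h.mean_eq fun w₀ w₁ x₁ w₂ x₂ y' => G (w₀, w₁, w₂) * if y' = y then 1 else 0,
    h.mean_eq fun w₀ w₁ x₁ w₂ x₂ y' => G (w₀, w₁, w₂) * L.outWWW V w₀ w₁ w₂ y]
  simp only [mean_mul_left, mean_indicator, (hV _ _).mean_const, (L.lawX₂ _ _).mean_const,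
    fun w₀ w₁ => mean_comm (L.r₁ w₀ w₁) (L.q₂ w₀), (L.lawX₁ _ _).mean_const]
  rfl

theorem isKernel_outW₂ : IsKernel P (fun ω => (W₀ ω, W₂ ω)) Y
    fun u => L.outW₂ V u.1 u.2 := by
  classical
  intro G y
  rw [h.mean_eq fun w₀ w₁ x₁ w₂ x₂ y' => G (w₀, w₂) * if y' = y then 1 else 0,
    h.mean_eq fun w₀ w₁ x₁ w₂ x₂ y' => G (w₀, w₂) * L.outW₂ V w₀ w₂ y]
  simp only [mean_mul_left, mean_indicator, (hV _ _).mean_const, (L.lawX₂ _ _).mean_const,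
    fun w₀ w₁ => mean_comm (L.r₁ w₀ w₁) (L.q₂ w₀), (L.lawX₁ _ _).mean_const]
  -- G depends on w₂, which is therefore moved outside the average over w₁.
  simp only [fun w₀ => mean_comm (L.q₁ w₀) (L.q₂ w₀), mean_mul_left, (L.law₁ _).mean_const]
  rfl

theorem isKernel_outW₁ : IsKernel P (fun ω => (W₀ ω, W₁ ω)) Y
    fun u => L.outW₁ V u.1 u.2 := by
  classical
  intro G y
  rw [h.mean_eq fun w₀ w₁ x₁ w₂ x₂ y' => G (w₀, w₁) * if y' = y then 1 else 0,
    h.mean_eq fun w₀ w₁ x₁ w₂ x₂ y' => G (w₀, w₁) * L.outW₁ V w₀ w₁ y]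
  simp only [mean_mul_left, mean_indicator, (hV _ _).mean_const, (L.lawX₂ _ _).mean_const,
    fun w₀ w₁ => mean_comm (L.r₁ w₀ w₁) (L.q₂ w₀), (L.lawX₁ _ _).mean_const,
    (L.law₂ _).mean_const]
  rfl

theorem isKernel_outW₀ : IsKernel P W₀ Y (L.outW₀ V) := by
  classical
  intro G y
  rw [h.mean_eq fun w₀ w₁ x₁ w₂ x₂ y' => G w₀ * if y' = y then 1 else 0,
    h.mean_eq fun w₀ w₁ x₁ w₂ x₂ y' => G w₀ * L.outW₀ V w₀ y]
  simp only [mean_mul_left, mean_indicator, (hV _ _).mean_const, (L.lawX₂ _ _).mean_const,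
    fun w₀ w₁ => mean_comm (L.r₁ w₀ w₁) (L.q₂ w₀), (L.lawX₁ _ _).mean_const,
    (L.law₂ _).mean_const, (L.law₁ _).mean_const]
  rfl

theorem isKernel_out : IsKernel P (fun _ => ()) Y fun _ => L.out V := by
  classical
  intro G y
  rw [h.mean_eq fun w₀ w₁ x₁ w₂ x₂ y' => G () * if y' = y then 1 else 0,
    h.mean_eq fun w₀ w₁ x₁ w₂ x₂ y' => G () * L.out V y]
  simp only [mean_mul_left, mean_indicator, (hV _ _).mean_const, (L.lawX₂ _ _).mean_const,
    fun w₀ w₁ => mean_comm (L.r₁ w₀ w₁) (L.q₂ w₀), (L.lawX₁ _ _).mean_const,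
    (L.law₂ _).mean_const, (L.law₁ _).mean_const, L.law₀.mean_const]
  rfl

theorem condMutualInfo_WWW :
    condMutualInfo P X₁ Y (fun ω => (W₀ ω, W₁ ω, W₂ ω)) =
      L.negWX V - L.negWWW V := by
  have hN := (h.isKernel_outWX hV).comp (fun u => (u.2.2.2, u.1, u.2.1, u.2.2.1))
    (fun u => L.outWX V u.2.1 u.2.2.2 u.1) fun _ => rfl
  have hD := h.isKernel_outWWW hV
  rw [condMutualInfo_eq_of_isKernel hN hD, ← h.mean_outWX, ← h.mean_outWWW]

/-- With the users exchanged, the cloud variables appear in the opposite order in the condition. -/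
theorem condMutualInfo_WWW_symm :
    condMutualInfo P X₁ Y (fun ω => (W₀ ω, W₂ ω, W₁ ω)) =
      L.negWX V - L.negWWW V := by
  have hN := (h.isKernel_outWX hV).comp (fun u => (u.2.2.2, u.1, u.2.2.1, u.2.1))
    (fun u => L.outWX V u.2.1 u.2.2.1 u.1) fun _ => rfl
  have hD := (h.isKernel_outWWW hV).comp (fun u => (u.1, u.2.2, u.2.1))
    (fun u => L.outWWW V u.1 u.2.2 u.2.1) fun _ => rfl
  rw [condMutualInfo_eq_of_isKernel hN hD, ← h.mean_outWX, ← h.mean_outWWW]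

theorem condMutualInfo_W₂ :
    condMutualInfo P X₁ Y (fun ω => (W₀ ω, W₂ ω)) =
      L.negWX V - L.negW₂ V := by
  have hN := (h.isKernel_outWX hV).comp (fun u => (u.2.2.2, u.1, u.2.2.1))
    (fun u => L.outWX V u.2.1 u.2.2 u.1) fun _ => rfl
  have hD := h.isKernel_outW₂ hV
  rw [condMutualInfo_eq_of_isKernel hN hD, ← h.mean_outWX, ← h.mean_outW₂]

theorem condMutualInfo_W₁ :
    condMutualInfo P (fun ω => (W₂ ω, X₁ ω)) Y (fun ω => (W₀ ω, W₁ ω)) =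
      L.negWX V - L.negW₁ V := by
  have hN := (h.isKernel_outWX hV).comp (fun u => ((u.2.2.1, u.2.2.2), u.1, u.2.1))
    (fun u => L.outWX V u.2.1 u.1.1 u.1.2) fun _ => rfl
  have hD := h.isKernel_outW₁ hV
  rw [condMutualInfo_eq_of_isKernel hN hD, ← h.mean_outWX, ← h.mean_outW₁]

theorem condMutualInfo_W₀ :
    condMutualInfo P (fun ω => (W₂ ω, X₁ ω)) Y W₀ =
      L.negWX V - L.negW₀ V := by
  have hN := (h.isKernel_outWX hV).comp (fun u => ((u.2.2.1, u.2.2.2), u.1))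
    (fun u => L.outWX V u.2 u.1.1 u.1.2) fun _ => rfl
  have hD := h.isKernel_outW₀ hV
  rw [condMutualInfo_eq_of_isKernel hN hD, ← h.mean_outWX, ← h.mean_outW₀]

theorem mutualInfo_eq :
    mutualInfo P (fun ω => (W₀ ω, W₂ ω, X₁ ω)) Y =
      L.negWX V - L.negOut V := by
  have hN := (h.isKernel_outWX hV).comp (fun u => (u.1, u.2.2.1, u.2.2.2))
    (fun u => L.outWX V u.1 u.2.1 u.2.2) fun _ => rfl
  have hD := h.isKernel_out hV
  rw [mutualInfo_eq_of_isKernel hN hD, ← h.mean_outWX, ← h.mean_out]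

end HasJoint

/-- The thirteen inequalities depend only on the joint law of the variables. -/
theorem thirteenInequalities_iff {𝒴₁ 𝒴₂ : Type*} [Fintype 𝒴₁] [Fintype 𝒴₂] {P : PMF Ω}
    {L : InputLaw 𝒲₀ 𝒲₁ 𝒲₂ 𝒳₁ 𝒳₂} {V₁ : 𝒳₁ → 𝒳₂ → 𝒴₁ → ℝ} {V₂ : 𝒳₂ → 𝒳₁ → 𝒴₂ → ℝ}
    {W₀ : Ω → 𝒲₀} {W₁ : Ω → 𝒲₁} {W₂ : Ω → 𝒲₂} {X₁ : Ω → 𝒳₁} {X₂ : Ω → 𝒳₂} {Y₁ : Ω → 𝒴₁}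
    {Y₂ : Ω → 𝒴₂} (hV₁ : ∀ x₁ x₂, IsLaw (V₁ x₁ x₂)) (hV₂ : ∀ x₂ x₁, IsLaw (V₂ x₂ x₁))
    (h₁ : HasJoint P L V₁ W₀ W₁ W₂ X₁ X₂ Y₁) (h₂ : HasJoint P L.swap V₂ W₀ W₂ W₁ X₂ X₁ Y₂)
    (R₀ R₁ R₂ : ℝ) :
    ThirteenInequalities P W₀ W₁ W₂ X₁ X₂ Y₁ Y₂ R₀ R₁ R₂ ↔ L.Region V₁ V₂ R₀ R₁ R₂ := by
  unfold ThirteenInequalities InputLaw.Region RateConditions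
  rw [h₁.condMutualInfo_WWW hV₁, h₂.condMutualInfo_WWW_symm hV₂, h₁.condMutualInfo_W₂ hV₁,
    h₂.condMutualInfo_W₂ hV₂, h₁.condMutualInfo_W₁ hV₁, h₂.condMutualInfo_W₁ hV₂,
    h₁.condMutualInfo_W₀ hV₁, h₂.condMutualInfo_W₀ hV₂, h₁.mutualInfo_eq hV₁, h₂.mutualInfo_eq hV₂]

end HasJoint

/-! ### The joint laws of the theorem -/

section Laws

variable {𝒮 𝒯 𝒲₀ 𝒲₁ 𝒲₂ 𝒳₁ 𝒳₂ 𝒴₁ 𝒴₂ : Type*} [Fintype 𝒮] [Fintype 𝒯] [Fintype 𝒲₀]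
  [Fintype 𝒲₁] [Fintype 𝒲₂] [Fintype 𝒳₁] [Fintype 𝒳₂] [Fintype 𝒴₁] [Fintype 𝒴₂]

instance : Fintype (ChannelVars 𝒲₀ 𝒲₁ 𝒲₂ 𝒳₁ 𝒳₂ 𝒴₁ 𝒴₂) := by
  classical
  exact Fintype.ofSurjective (α := 𝒲₀ × 𝒲₁ × 𝒲₂ × 𝒳₁ × 𝒳₂ × 𝒴₁ × 𝒴₂)
    (fun z => ⟨z.1, z.2.1, z.2.2.1, z.2.2.2.1, z.2.2.2.2.1, z.2.2.2.2.2.1, z.2.2.2.2.2.2⟩)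
    fun c => ⟨(c.w₀, c.w₁, c.w₂, c.x₁, c.x₂, c.y₁, c.y₂), rfl⟩

instance : Fintype (AllVars 𝒮 𝒯 𝒲₀ 𝒲₁ 𝒲₂ 𝒳₁ 𝒳₂ 𝒴₁ 𝒴₂) := by
  classical
  exact Fintype.ofSurjective (α := ChannelVars 𝒲₀ 𝒲₁ 𝒲₂ 𝒳₁ 𝒳₂ 𝒴₁ 𝒴₂ × 𝒮 × 𝒯)
    (fun z => ⟨z.1, z.2.1, z.2.2⟩) fun c => ⟨(c.toChannelVars, c.s, c.t), rfl⟩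

/-- The input law given by probability mass functions. -/
def pmfInputLaw (pW₀ : PMF 𝒲₀) (pW₁ : 𝒲₀ → PMF 𝒲₁) (pW₂ : 𝒲₀ → PMF 𝒲₂)
    (pX₁ : 𝒲₀ → 𝒲₁ → PMF 𝒳₁) (pX₂ : 𝒲₀ → 𝒲₂ → PMF 𝒳₂) : InputLaw 𝒲₀ 𝒲₁ 𝒲₂ 𝒳₁ 𝒳₂ where
  q₀ := weight pW₀
  q₁ w := weight (pW₁ w)
  q₂ w := weight (pW₂ w)
  r₁ w v := weight (pX₁ w v)
  r₂ w v := weight (pX₂ w v)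
  law₀ := isLaw_weight _
  law₁ _ := isLaw_weight _
  law₂ _ := isLaw_weight _
  lawX₁ _ _ := isLaw_weight _
  lawX₂ _ _ := isLaw_weight _

/-- The marginal channel to receiver 1. -/
def marginal₁ (ch : 𝒳₁ → 𝒳₂ → PMF (𝒴₁ × 𝒴₂)) (x₁ : 𝒳₁) (x₂ : 𝒳₂) (y₁ : 𝒴₁) : ℝ :=
  ∑ y₂, weight (ch x₁ x₂) (y₁, y₂)

/-- The marginal channel to receiver 2. -/
def marginal₂ (ch : 𝒳₁ → 𝒳₂ → PMF (𝒴₁ × 𝒴₂)) (x₂ : 𝒳₂) (x₁ : 𝒳₁) (y₂ : 𝒴₂) : ℝ :=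
  ∑ y₁, weight (ch x₁ x₂) (y₁, y₂)

variable (ch : 𝒳₁ → 𝒳₂ → PMF (𝒴₁ × 𝒴₂))

theorem mean_channel_fst (x₁ : 𝒳₁) (x₂ : 𝒳₂) (g : 𝒴₁ → ℝ) :
    (mean (weight (ch x₁ x₂)) fun y => g y.1) = mean (marginal₁ ch x₁ x₂) g := by
  simp only [mean, Fintype.sum_prod_type, marginal₁, Finset.sum_mul]

theorem mean_channel_snd (x₁ : 𝒳₁) (x₂ : 𝒳₂) (g : 𝒴₂ → ℝ) :
    (mean (weight (ch x₁ x₂)) fun y => g y.2) = mean (marginal₂ ch x₂ x₁) g := by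
  simp only [mean, Fintype.sum_prod_type_right, marginal₂, Finset.sum_mul]

theorem isLaw_marginal₁ (x₁ : 𝒳₁) (x₂ : 𝒳₂) : IsLaw (marginal₁ ch x₁ x₂) where
  nonneg _ := Finset.sum_nonneg fun _ _ => (isLaw_weight _).nonneg _
  sum_eq_one := by
    have := mean_channel_fst ch x₁ x₂ fun _ => 1
    rw [(isLaw_weight _).mean_const] at this
    simpa [mean] using this.symm

theorem isLaw_marginal₂ (x₂ : 𝒳₂) (x₁ : 𝒳₁) : IsLaw (marginal₂ ch x₂ x₁) where
  nonneg _ := Finset.sum_nonneg fun _ _ => (isLaw_weight _).nonneg _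
  sum_eq_one := by
    have := mean_channel_snd ch x₁ x₂ fun _ => 1
    rw [(isLaw_weight _).mean_const] at this
    simpa [mean] using this.symm

variable (pW₀ : PMF 𝒲₀) (pW₁ : 𝒲₀ → PMF 𝒲₁) (pW₂ : 𝒲₀ → PMF 𝒲₂)
    (pX₁ : 𝒲₀ → 𝒲₁ → PMF 𝒳₁) (pX₂ : 𝒲₀ → 𝒲₂ → PMF 𝒳₂)

theorem mean_channelLaw (f : ChannelVars 𝒲₀ 𝒲₁ 𝒲₂ 𝒳₁ 𝒳₂ 𝒴₁ 𝒴₂ → ℝ) :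
    mean (weight (channelLaw pW₀ pW₁ pW₂ pX₁ pX₂ ch)) f =
      mean (weight pW₀) fun w₀ => mean (weight (pW₁ w₀)) fun w₁ => mean (weight (pW₂ w₀)) fun w₂ =>
      mean (weight (pX₁ w₀ w₁)) fun x₁ => mean (weight (pX₂ w₀ w₂)) fun x₂ =>
      mean (weight (ch x₁ x₂)) fun y => f ⟨w₀, w₁, w₂, x₁, x₂, y.1, y.2⟩ := by
  simp only [channelLaw, mean_bind, mean_pure]

/-- As the inputs ignore the source, the joint law is the product of the source law and the law of
the channel variables. -/
theorem mean_jointLaw (src : PMF (𝒮 × 𝒯)) (f : AllVars 𝒮 𝒯 𝒲₀ 𝒲₁ 𝒲₂ 𝒳₁ 𝒳₂ 𝒴₁ 𝒴₂ → ℝ) :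
    mean (weight (jointLaw src pW₀ pW₁ pW₂ (fun _ w₁ w₀ => pX₁ w₀ w₁) (fun _ w₂ w₀ => pX₂ w₀ w₂)
      ch)) f = mean (weight src) fun st =>
        mean (weight (channelLaw pW₀ pW₁ pW₂ pX₁ pX₂ ch)) fun c => f ⟨c, st.1, st.2⟩ := by
  simp only [mean_channelLaw, jointLaw, mean_bind, mean_pure]

theorem hasJoint_channelLaw₁ :
    HasJoint (channelLaw pW₀ pW₁ pW₂ pX₁ pX₂ ch) (pmfInputLaw pW₀ pW₁ pW₂ pX₁ pX₂)
      (marginal₁ ch) (fun ω => ω.w₀) (fun ω => ω.w₁) (fun ω => ω.w₂) (fun ω => ω.x₁)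
      (fun ω => ω.x₂) (fun ω => ω.y₁) := by
  intro f
  rw [mean_channelLaw, InputLaw.mean_joint]
  simp only [fun w₀ w₁ w₂ x₁ x₂ => mean_channel_fst ch x₁ x₂ fun y₁ =>
    f (((((w₀, w₁), x₁), w₂), x₂), y₁)]
  simp only [fun w₀ w₁ => mean_comm (weight (pW₂ w₀)) (weight (pX₁ w₀ w₁))]
  rfl

theorem hasJoint_channelLaw₂ :
    HasJoint (channelLaw pW₀ pW₁ pW₂ pX₁ pX₂ ch) (pmfInputLaw pW₀ pW₁ pW₂ pX₁ pX₂).swap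
      (marginal₂ ch) (fun ω => ω.w₀) (fun ω => ω.w₂) (fun ω => ω.w₁) (fun ω => ω.x₂)
      (fun ω => ω.x₁) (fun ω => ω.y₂) := by
  intro f
  rw [mean_channelLaw, InputLaw.mean_joint]
  simp only [fun w₀ w₁ w₂ x₁ x₂ => mean_channel_snd ch x₁ x₂ fun y₂ =>
    f (((((w₀, w₂), x₂), w₁), x₁), y₂)]
  simp only [fun w₀ w₁ w₂ => mean_comm (weight (pX₁ w₀ w₁)) (weight (pX₂ w₀ w₂)),
    fun w₀ => mean_comm (weight (pW₁ w₀)) (weight (pW₂ w₀)),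
    fun w₀ w₂ => mean_comm (weight (pW₁ w₀)) (weight (pX₂ w₀ w₂))]
  rfl

/-- Independence of two random variables. -/
def IndepVars {Ω α β : Type*} [Fintype Ω] (P : PMF Ω) (A : Ω → α) (T : Ω → β) : Prop :=
  ∀ f : α → β → ℝ, (mean (weight P) fun ω => f (A ω) (T ω)) =
    mean (weight P) fun ω => mean (weight P) fun ω' => f (A ω) (T ω')

/-- A variable independent of (U, Y) jointly may be added to the condition: fixing its value leaves
the law of (U, Y) unchanged. This removes S, T and K from the mutual informations. -/
theorem IsKernel.augment {Ω α β γ δ : Type*} [Fintype Ω] {P : PMF Ω} {A : Ω → α} {T : Ω → β}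
    (h : IndepVars P A T) {u : β → γ} {y : β → δ} {K : γ → δ → ℝ}
    (hK : IsKernel P (fun ω => u (T ω)) (fun ω => y (T ω)) K) :
    IsKernel P (fun ω => (A ω, u (T ω))) (fun ω => y (T ω)) fun v => K v.2 := by
  classical
  intro G z
  rw [h fun a b => G (a, u b) * if y b = z then 1 else 0, h fun a b => G (a, u b) * K (u b) z]
  congr 1
  funext ω
  exact hK (fun v => G (A ω, v)) z

theorem IndepVars.comp {Ω α β α' β' : Type*} [Fintype Ω] {P : PMF Ω} {A : Ω → α} {T : Ω → β}
    (h : IndepVars P A T) (a : α → α') (t : β → β') :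
    IndepVars P (fun ω => a (A ω)) (fun ω => t (T ω)) := fun f => h fun x z => f (a x) (t z)

theorem indepVars_jointLaw (src : PMF (𝒮 × 𝒯)) :
    IndepVars (jointLaw src pW₀ pW₁ pW₂ (fun _ w₁ w₀ => pX₁ w₀ w₁) (fun _ w₂ w₀ => pX₂ w₀ w₂) ch)
      (fun ω => (ω.s, ω.t)) (fun ω => ω.toChannelVars) := by
  intro f
  simp only [mean_jointLaw, (isLaw_weight _).mean_const]

theorem HasJoint.jointLaw (src : PMF (𝒮 × 𝒯)) {𝒱₁ 𝒱₂ 𝒰₁ 𝒰₂ 𝒴 : Type*} [Fintype 𝒱₁] [Fintype 𝒱₂]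
    [Fintype 𝒰₁] [Fintype 𝒰₂] [Fintype 𝒴] {L : InputLaw 𝒲₀ 𝒱₁ 𝒱₂ 𝒰₁ 𝒰₂} {V : 𝒰₁ → 𝒰₂ → 𝒴 → ℝ}
    {W₀ : ChannelVars 𝒲₀ 𝒲₁ 𝒲₂ 𝒳₁ 𝒳₂ 𝒴₁ 𝒴₂ → 𝒲₀} {W₁ : ChannelVars 𝒲₀ 𝒲₁ 𝒲₂ 𝒳₁ 𝒳₂ 𝒴₁ 𝒴₂ → 𝒱₁}
    {W₂ : ChannelVars 𝒲₀ 𝒲₁ 𝒲₂ 𝒳₁ 𝒳₂ 𝒴₁ 𝒴₂ → 𝒱₂} {X₁ : ChannelVars 𝒲₀ 𝒲₁ 𝒲₂ 𝒳₁ 𝒳₂ 𝒴₁ 𝒴₂ → 𝒰₁}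
    {X₂ : ChannelVars 𝒲₀ 𝒲₁ 𝒲₂ 𝒳₁ 𝒳₂ 𝒴₁ 𝒴₂ → 𝒰₂} {Y : ChannelVars 𝒲₀ 𝒲₁ 𝒲₂ 𝒳₁ 𝒳₂ 𝒴₁ 𝒴₂ → 𝒴}
    (h : HasJoint (channelLaw pW₀ pW₁ pW₂ pX₁ pX₂ ch) L V W₀ W₁ W₂ X₁ X₂ Y) :
    HasJoint (jointLaw src pW₀ pW₁ pW₂ (fun _ w₁ w₀ => pX₁ w₀ w₁) (fun _ w₂ w₀ => pX₂ w₀ w₂) ch) L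
      V (fun ω => W₀ ω.toChannelVars) (fun ω => W₁ ω.toChannelVars) (fun ω => W₂ ω.toChannelVars)
      (fun ω => X₁ ω.toChannelVars) (fun ω => X₂ ω.toChannelVars)
      (fun ω => Y ω.toChannelVars) := by
  intro f
  rw [mean_jointLaw, ← h f]
  exact (isLaw_weight src).mean_const (mean (weight (channelLaw pW₀ pW₁ pW₂ pX₁ pX₂ ch))
    fun ω => f (((((W₀ ω, W₁ ω), X₁ ω), W₂ ω), X₂ ω), Y ω))

end Laws

/-! ### Sources that are independent of the channel variables -/

namespace HasJoint

section Source

variable {Ω 𝒮 𝒦 𝒲₀ 𝒲₁ 𝒲₂ 𝒳₁ 𝒳₂ 𝒴 : Type*} [Fintype Ω] [Fintype 𝒮] [Fintype 𝒦] [Fintype 𝒲₀]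
    [Fintype 𝒲₁] [Fintype 𝒲₂] [Fintype 𝒳₁] [Fintype 𝒳₂] [Fintype 𝒴]
    {P : PMF Ω} {L : InputLaw 𝒲₀ 𝒲₁ 𝒲₂ 𝒳₁ 𝒳₂} {V : 𝒳₁ → 𝒳₂ → 𝒴 → ℝ} {W₀ : Ω → 𝒲₀}
    {W₁ : Ω → 𝒲₁} {W₂ : Ω → 𝒲₂} {X₁ : Ω → 𝒳₁} {X₂ : Ω → 𝒳₂} {Y : Ω → 𝒴}
    (h : HasJoint P L V W₀ W₁ W₂ X₁ X₂ Y) (hV : ∀ x₁ x₂, IsLaw (V x₁ x₂)) {A : Ω → 𝒮} {B : Ω → 𝒦}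
    (hA : IndepVars P (fun ω => (A ω, B ω))
      (fun ω => (((((W₀ ω, W₁ ω), X₁ ω), W₂ ω), X₂ ω), Y ω)))
include h hV hA

theorem isKernel_source : IsKernel P (fun ω => ((A ω, B ω), W₀ ω, W₁ ω, W₂ ω, X₁ ω)) Y
    fun u => L.outWX V u.2.1 u.2.2.2.1 u.2.2.2.2 :=
  IsKernel.augment (u := fun z => (z.1.1.1.1.1, z.1.1.1.1.2, z.1.1.2, z.1.1.1.2)) (y := Prod.snd)
    hA (h.isKernel_outWX hV)

theorem condMutualInfo_source_WWW :
    condMutualInfo P (fun ω => (A ω, X₁ ω)) Y (fun ω => (W₀ ω, W₁ ω, W₂ ω, B ω)) =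
      L.negWX V - L.negWWW V := by
  have hN := (h.isKernel_source hV hA).comp
    (fun u => ((u.1.1, u.2.2.2.2), u.2.1, u.2.2.1, u.2.2.2.1, u.1.2))
    (fun u => L.outWX V u.2.1 u.2.2.2.1 u.1.2) fun _ => rfl
  have hD := (IsKernel.augment (u := fun z => (z.1.1.1.1.1, z.1.1.1.1.2, z.1.1.2)) (y := Prod.snd)
    hA (h.isKernel_outWWW hV)).comp (fun u => (u.2.1, u.2.2.1, u.2.2.2, u.1.2))
    (fun u => L.outWWW V u.1 u.2.1 u.2.2.1) fun _ => rfl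
  rw [condMutualInfo_eq_of_isKernel hN hD, ← h.mean_outWX, ← h.mean_outWWW]

theorem condMutualInfo_source_WWW_symm :
    condMutualInfo P (fun ω => (A ω, X₁ ω)) Y (fun ω => (W₀ ω, W₂ ω, W₁ ω, B ω)) =
      L.negWX V - L.negWWW V := by
  have hN := (h.isKernel_source hV hA).comp
    (fun u => ((u.1.1, u.2.2.2.2), u.2.1, u.2.2.2.1, u.2.2.1, u.1.2))
    (fun u => L.outWX V u.2.1 u.2.2.1 u.1.2) fun _ => rfl
  have hD := (IsKernel.augment (u := fun z => (z.1.1.1.1.1, z.1.1.1.1.2, z.1.1.2)) (y := Prod.snd)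
    hA (h.isKernel_outWWW hV)).comp (fun u => (u.2.1, u.2.2.2, u.2.2.1, u.1.2))
    (fun u => L.outWWW V u.1 u.2.2.1 u.2.1) fun _ => rfl
  rw [condMutualInfo_eq_of_isKernel hN hD, ← h.mean_outWX, ← h.mean_outWWW]

theorem condMutualInfo_source_W₂ :
    condMutualInfo P (fun ω => (A ω, X₁ ω)) Y (fun ω => (W₀ ω, W₂ ω, B ω)) =
      L.negWX V - L.negW₂ V := by
  have hN := (h.isKernel_source hV hA).comp
    (fun u => ((u.1.1, u.2.2.2.2), u.2.1, u.2.2.2.1, u.1.2))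
    (fun u => L.outWX V u.2.1 u.2.2.1 u.1.2) fun _ => rfl
  have hD := (IsKernel.augment (u := fun z => (z.1.1.1.1.1, z.1.1.2)) (y := Prod.snd)
    hA (h.isKernel_outW₂ hV)).comp (fun u => (u.2.1, u.2.2, u.1.2))
    (fun u => L.outW₂ V u.1 u.2.1) fun _ => rfl
  rw [condMutualInfo_eq_of_isKernel hN hD, ← h.mean_outWX, ← h.mean_outW₂]

theorem condMutualInfo_source_W₁ :
    condMutualInfo P (fun ω => (A ω, W₂ ω, X₁ ω)) Y (fun ω => (W₀ ω, W₁ ω, B ω)) =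
      L.negWX V - L.negW₁ V := by
  have hN := (h.isKernel_source hV hA).comp
    (fun u => ((u.1.1, u.2.2.2.1, u.2.2.2.2), u.2.1, u.2.2.1, u.1.2))
    (fun u => L.outWX V u.2.1 u.1.2.1 u.1.2.2) fun _ => rfl
  have hD := (IsKernel.augment (u := fun z => (z.1.1.1.1.1, z.1.1.1.1.2)) (y := Prod.snd)
    hA (h.isKernel_outW₁ hV)).comp (fun u => (u.2.1, u.2.2, u.1.2))
    (fun u => L.outW₁ V u.1 u.2.1) fun _ => rfl
  rw [condMutualInfo_eq_of_isKernel hN hD, ← h.mean_outWX, ← h.mean_outW₁]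

theorem condMutualInfo_source_W₀ :
    condMutualInfo P (fun ω => (W₂ ω, A ω, X₁ ω)) Y (fun ω => (W₀ ω, B ω)) =
      L.negWX V - L.negW₀ V := by
  have hN := (h.isKernel_source hV hA).comp
    (fun u => ((u.2.2.2.1, u.1.1, u.2.2.2.2), u.2.1, u.1.2))
    (fun u => L.outWX V u.2.1 u.1.1 u.1.2.2) fun _ => rfl
  have hD := (IsKernel.augment (u := fun z => z.1.1.1.1.1) (y := Prod.snd)
    hA (h.isKernel_outW₀ hV)).comp (fun u => (u.2, u.1.2))
    (fun u => L.outW₀ V u.1) fun _ => rfl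
  rw [condMutualInfo_eq_of_isKernel hN hD, ← h.mean_outWX, ← h.mean_outW₀]

theorem mutualInfo_source :
    mutualInfo P (fun ω => (W₀ ω, W₂ ω, A ω, X₁ ω)) Y = L.negWX V - L.negOut V := by
  have hN := (h.isKernel_source hV hA).comp
    (fun u => (u.2.1, u.2.2.2.1, u.1.1, u.2.2.2.2))
    (fun u => L.outWX V u.1 u.2.1 u.2.2.2) fun _ => rfl
  rw [mutualInfo_eq_of_isKernel hN (h.isKernel_out hV), ← h.mean_outWX, ← h.mean_out]

end Source

end HasJoint

/-! ### The decomposed source -/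

section DecomposedSource

variable {𝒮' 𝒯' 𝒦 : Type*} (pS' : PMF 𝒮') (pT' : PMF 𝒯') (pK : PMF 𝒦)

theorem decomposedSource_ne_zero_iff (s : 𝒮' × 𝒦) (t : 𝒯' × 𝒦) :
    decomposedSource pS' pT' pK (s, t) ≠ 0 ↔
      s.1 ∈ pS'.support ∧ t.1 ∈ pT'.support ∧ s.2 ∈ pK.support ∧ s.2 = t.2 := by
  obtain ⟨s, k⟩ := s
  obtain ⟨t, k'⟩ := t
  rw [← PMF.mem_support_iff]
  simp only [decomposedSource, PMF.mem_support_bind_iff, PMF.support_pure, Set.mem_singleton_iff,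
    Prod.mk.injEq]
  constructor
  · rintro ⟨s1, hs, t1, ht, k1, hk, ⟨rfl, rfl⟩, rfl, rfl⟩
    exact ⟨hs, ht, hk, rfl⟩
  · rintro ⟨hs, ht, hk, rfl⟩
    exact ⟨s, hs, t, ht, k, hk, ⟨rfl, rfl⟩, rfl, rfl⟩

/-- Given K = k, every possible s' occurs with one fixed possible t₀. So f'(s', k) = g'(t₀, k),
which depends on k alone. -/
theorem isCommonPart_decomposedSource :
    IsCommonPart (decomposedSource pS' pT' pK) Prod.snd Prod.snd := by
  have hsupp := decomposedSource_ne_zero_iff pS' pT' pK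
  refine ⟨fun s t h => ((hsupp s t).1 h).2.2.2, fun f' g' hfg => ?_⟩
  obtain ⟨t₀, ht₀⟩ := pT'.support_nonempty
  refine ⟨fun k => g' (t₀, k), fun s t h => ?_⟩
  obtain ⟨hs, -, hk, -⟩ := (hsupp s t).1 h
  exact hfg s (t₀, s.2) ((hsupp _ _).2 ⟨hs, ht₀, hk, rfl⟩)

variable [Fintype 𝒮'] [Fintype 𝒯'] [Fintype 𝒦]

theorem mean_decomposedSource (f : (𝒮' × 𝒦) × (𝒯' × 𝒦) → ℝ) :
    mean (weight (decomposedSource pS' pT' pK)) f = mean (weight pS') fun s => mean (weight pT')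
      fun t => mean (weight pK) fun k => f ((s, k), (t, k)) := by
  simp only [decomposedSource, mean_bind, mean_pure]

/-- The entropy of a probability mass function. -/
def pmfEntropy {α : Type*} [Fintype α] (p : PMF α) : ℝ :=
  -mean (weight p) fun a => Real.logb 2 (weight p a)

section
variable {Ω : Type*} [Fintype Ω] {P : PMF Ω} {S : Ω → 𝒮' × 𝒦} {T : Ω → 𝒯' × 𝒦}

theorem mean_indicator_pair {α β : Type*} [Fintype α] [Fintype β] (p : α → ℝ) (q : β → ℝ) (a : α)
    (b : β) [DecidableEq α] [DecidableEq β] :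
    (mean p fun a' => mean q fun b' => if a' = a ∧ b' = b then (1 : ℝ) else 0) = p a * q b := by
  simp [mean, ite_and]

variable {pS' pT' pK}
variable (h : ∀ f : (𝒮' × 𝒦) × (𝒯' × 𝒦) → ℝ, (mean (weight P) fun ω => f (S ω, T ω)) =
    mean (weight (decomposedSource pS' pT' pK)) f)
include h

/-- F is the indicator of X = a, left in a form of the caller's choice so that it can be written as
a product over the independent components. -/
theorem prob_source {α : Type*} (X : (𝒮' × 𝒦) × (𝒯' × 𝒦) → α) (a : α) (F : 𝒮' → 𝒯' → 𝒦 → ℝ)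
    (h1 : ∀ s t k, X ((s, k), (t, k)) = a → F s t k = 1)
    (h0 : ∀ s t k, X ((s, k), (t, k)) ≠ a → F s t k = 0) :
    prob P (fun ω => X (S ω, T ω)) a = mean (weight pS') fun s => mean (weight pT') fun t =>
      mean (weight pK) fun k => F s t k := by
  classical
  have hF : ∀ s t k, F s t k = if X ((s, k), (t, k)) = a then 1 else 0 := fun s t k => by
    split_ifs with hX
    exacts [h1 s t k hX, h0 s t k hX]
  rw [prob_eq_mean]
  simp only [hF]
  refine Eq.trans ?_ ((h fun st => if X st = a then 1 else 0).trans
    (mean_decomposedSource pS' pT' pK _))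
  congr! 2

theorem prob_source_common (k : 𝒦) : prob P (fun ω => (S ω).2) k = weight pK k := by
  classical
  refine (prob_source h (fun st => st.1.2) k (fun s' t' k' => if k' = k then 1 else 0) (by simp_all)
    (by simp_all)).trans ?_
  simp only [(isLaw_weight _).mean_const, HasJoint.mean_indicator]

theorem prob_source_fst (s : 𝒮') : prob P (fun ω => (S ω).1) s = weight pS' s := by
  classical
  refine (prob_source h (fun st => st.1.1) s (fun s' t' k' => if s' = s then 1 else 0) (by simp_all)
    (by simp_all)).trans ?_
  simp only [(isLaw_weight _).mean_const, HasJoint.mean_indicator]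

theorem prob_source_snd (t : 𝒯') : prob P (fun ω => (T ω).1) t = weight pT' t := by
  classical
  refine (prob_source h (fun st => st.2.1) t (fun s' t' k' => if t' = t then 1 else 0) (by simp_all)
    (by simp_all)).trans ?_
  simp only [(isLaw_weight _).mean_const, HasJoint.mean_indicator]

theorem prob_source_S (s : 𝒮') (k : 𝒦) : prob P S (s, k) = weight pS' s * weight pK k := by
  classical
  refine (prob_source h (fun st => st.1) (s, k)
    (fun s' t' k' => if s' = s ∧ k' = k then 1 else 0) (by simp_all)
    (by simp_all)).trans ?_
  simp only [(isLaw_weight _).mean_const, mean_indicator_pair]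

theorem prob_source_T (t : 𝒯') (k : 𝒦) : prob P T (t, k) = weight pT' t * weight pK k := by
  classical
  refine (prob_source h (fun st => st.2) (t, k)
    (fun s' t' k' => if t' = t ∧ k' = k then 1 else 0) (by simp_all)
    (by simp_all)).trans ?_
  simp only [(isLaw_weight _).mean_const, mean_indicator_pair]

/-- Only matching values of K are needed: the entropies are written as expectations, which never
evaluate at a mismatch. -/
theorem prob_source_SK (s : 𝒮') (k : 𝒦) :
    prob P (fun ω => (S ω, (S ω).2)) ((s, k), k) = weight pS' s * weight pK k := by
  classical
  refine (prob_source h (fun st => (st.1, st.1.2)) ((s, k), k)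
    (fun s' t' k' => if s' = s ∧ k' = k then 1 else 0) (by simp_all)
    (by simp_all)).trans ?_
  simp only [(isLaw_weight _).mean_const, mean_indicator_pair]

theorem prob_source_TK (t : 𝒯') (k : 𝒦) :
    prob P (fun ω => (T ω, (S ω).2)) ((t, k), k) = weight pT' t * weight pK k := by
  classical
  refine (prob_source h (fun st => (st.2, st.1.2)) ((t, k), k)
    (fun s' t' k' => if t' = t ∧ k' = k then 1 else 0) (by simp_all)
    (by simp_all)).trans ?_
  simp only [(isLaw_weight _).mean_const, mean_indicator_pair]

theorem entropy_common : entropy P (fun ω => (S ω).2) = pmfEntropy pK := by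
  rw [entropy_eq_mean]
  simp only [prob_source_common h]
  rw [h fun st => Real.logb 2 (weight pK st.1.2), mean_decomposedSource]
  simp only [(isLaw_weight _).mean_const, pmfEntropy]

theorem entropy_fst : entropy P (fun ω => (S ω).1) = pmfEntropy pS' := by
  rw [entropy_eq_mean]
  simp only [prob_source_fst h]
  rw [h fun st => Real.logb 2 (weight pS' st.1.1), mean_decomposedSource]
  simp only [(isLaw_weight _).mean_const, pmfEntropy]

theorem entropy_snd : entropy P (fun ω => (T ω).1) = pmfEntropy pT' := by
  rw [entropy_eq_mean]
  simp only [prob_source_snd h]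
  rw [h fun st => Real.logb 2 (weight pT' st.2.1), mean_decomposedSource]
  simp only [(isLaw_weight _).mean_const, pmfEntropy]

omit h in
theorem mean_logb_mul {α β : Type*} [Fintype α] [Fintype β] (p : PMF α) (q : PMF β) :
    (mean (weight p) fun a => mean (weight q) fun b => Real.logb 2 (weight p a * weight q b)) =
      -(pmfEntropy p + pmfEntropy q) := by
  have : (mean (weight p) fun a => mean (weight q) fun b => Real.logb 2 (weight p a * weight q b)) =
      mean (weight p) fun a => mean (weight q) fun b =>
        (Real.logb 2 (weight p a) + Real.logb 2 (weight q b)) :=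
    mean_congr_of_pos (isLaw_weight p).nonneg fun a ha =>
      mean_congr_of_pos (isLaw_weight q).nonneg fun b hb => Real.logb_mul ha.ne' hb.ne'
  rw [this]
  simp only [mean_add, (isLaw_weight _).mean_const, pmfEntropy]
  ring

omit h in
theorem mean_logb_mul_div {α β : Type*} [Fintype α] [Fintype β] (p : PMF α) (q : PMF β) :
    (mean (weight p) fun a => mean (weight q) fun b =>
      Real.logb 2 (weight p a * weight q b / weight q b)) = -pmfEntropy p := by
  have : (mean (weight p) fun a => mean (weight q) fun b =>
      Real.logb 2 (weight p a * weight q b / weight q b)) =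
      mean (weight p) fun a => mean (weight q) fun b => Real.logb 2 (weight p a) :=
    mean_congr_of_pos (isLaw_weight p).nonneg fun a ha =>
      mean_congr_of_pos (isLaw_weight q).nonneg fun b hb => by rw [mul_div_cancel_right₀ _ hb.ne']
  rw [this]
  simp only [(isLaw_weight _).mean_const, pmfEntropy, neg_neg]

theorem entropy_S : entropy P S = pmfEntropy pS' + pmfEntropy pK := by
  rw [entropy_eq_mean, h fun st => Real.logb 2 (prob P S st.1), mean_decomposedSource]
  simp only [prob_source_S h, (isLaw_weight _).mean_const, mean_logb_mul, neg_neg]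

theorem entropy_T : entropy P T = pmfEntropy pT' + pmfEntropy pK := by
  rw [entropy_eq_mean, h fun st => Real.logb 2 (prob P T st.2), mean_decomposedSource]
  simp only [prob_source_T h, (isLaw_weight _).mean_const, mean_logb_mul, neg_neg]

theorem condEntropy_S : condEntropy P S (fun ω => (S ω).2) = pmfEntropy pS' := by
  rw [condEntropy_eq_mean, h fun st => Real.logb 2 (prob P (fun ω => (S ω, (S ω).2))
    (st.1, st.1.2) / prob P (fun ω => (S ω).2) st.1.2), mean_decomposedSource]
  simp only [prob_source_SK h, prob_source_common h, (isLaw_weight _).mean_const,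
    mean_logb_mul_div, neg_neg]

theorem condEntropy_T : condEntropy P T (fun ω => (S ω).2) = pmfEntropy pT' := by
  rw [condEntropy_eq_mean, h fun st => Real.logb 2 (prob P (fun ω => (T ω, (S ω).2))
    (st.2, st.1.2) / prob P (fun ω => (S ω).2) st.1.2), mean_decomposedSource]
  simp only [prob_source_TK h, prob_source_common h, (isLaw_weight _).mean_const,
    mean_logb_mul_div, neg_neg]

end

variable {𝒲₀ 𝒲₁ 𝒲₂ 𝒳₁ 𝒳₂ 𝒴₁ 𝒴₂ : Type*} [Fintype 𝒲₀]
  [Fintype 𝒲₁] [Fintype 𝒲₂] [Fintype 𝒳₁] [Fintype 𝒳₂] [Fintype 𝒴₁] [Fintype 𝒴₂]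
  (ch : 𝒳₁ → 𝒳₂ → PMF (𝒴₁ × 𝒴₂)) (pW₀ : PMF 𝒲₀) (pW₁ : 𝒲₀ → PMF 𝒲₁) (pW₂ : 𝒲₀ → PMF 𝒲₂)
  (pX₁ : 𝒲₀ → 𝒲₁ → PMF 𝒳₁) (pX₂ : 𝒲₀ → 𝒲₂ → PMF 𝒳₂)

theorem mean_jointLaw_source {𝒮 𝒯 : Type*} [Fintype 𝒮] [Fintype 𝒯] (src : PMF (𝒮 × 𝒯))
    (f : 𝒮 × 𝒯 → ℝ) :
    (mean (weight (jointLaw src pW₀ pW₁ pW₂ (fun _ w₁ w₀ => pX₁ w₀ w₁) (fun _ w₂ w₀ => pX₂ w₀ w₂)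
      ch)) fun ω => f (ω.s, ω.t)) = mean (weight src) f := by
  simp only [mean_jointLaw, (isLaw_weight _).mean_const]

/-- Independence of sources and inputs deletes the source variables from each information, and
H(S|K) = H(S'), H(S) = H(S') + H(K), and similarly for T, translate the left sides. -/
theorem correlatedSourceCondition_iff :
    CorrelatedSourceCondition (decomposedSource pS' pT' pK) Prod.snd Prod.snd pW₀ pW₁ pW₂
      (fun _ w₁ w₀ => pX₁ w₀ w₁) (fun _ w₂ w₀ => pX₂ w₀ w₂) ch ↔
      (pmfInputLaw pW₀ pW₁ pW₂ pX₁ pX₂).Region (marginal₁ ch) (marginal₂ ch) (pmfEntropy pK)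
        (pmfEntropy pS') (pmfEntropy pT') := by
  have h₁ := (hasJoint_channelLaw₁ ch pW₀ pW₁ pW₂ pX₁ pX₂).jointLaw _ _ _ _ _ _
    (decomposedSource pS' pT' pK)
  have h₂ := (hasJoint_channelLaw₂ ch pW₀ pW₁ pW₂ pX₁ pX₂).jointLaw _ _ _ _ _ _
    (decomposedSource pS' pT' pK)
  have hi := indepVars_jointLaw ch pW₀ pW₁ pW₂ pX₁ pX₂ (decomposedSource pS' pT' pK)
  have i₁ : IndepVars (jointLaw (decomposedSource pS' pT' pK) pW₀ pW₁ pW₂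
      (fun _ w₁ w₀ => pX₁ w₀ w₁) (fun _ w₂ w₀ => pX₂ w₀ w₂) ch) (fun ω => (ω.s, ω.s.2))
      (fun ω => (((((ω.w₀, ω.w₁), ω.x₁), ω.w₂), ω.x₂), ω.y₁)) :=
    hi.comp (fun st => (st.1, st.1.2)) fun c => (((((c.w₀, c.w₁), c.x₁), c.w₂), c.x₂), c.y₁)
  have i₂ : IndepVars (jointLaw (decomposedSource pS' pT' pK) pW₀ pW₁ pW₂
      (fun _ w₁ w₀ => pX₁ w₀ w₁) (fun _ w₂ w₀ => pX₂ w₀ w₂) ch) (fun ω => (ω.t, ω.s.2))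
      (fun ω => (((((ω.w₀, ω.w₂), ω.x₂), ω.w₁), ω.x₁), ω.y₂)) :=
    hi.comp (fun st => (st.2, st.1.2)) fun c => (((((c.w₀, c.w₂), c.x₂), c.w₁), c.x₁), c.y₂)
  have hV₁ := isLaw_marginal₁ ch
  have hV₂ := isLaw_marginal₂ ch
  have hs := mean_jointLaw_source ch pW₀ pW₁ pW₂ pX₁ pX₂ (decomposedSource pS' pT' pK)
  have hc := isCommonPart_decomposedSource pS' pT' pK
  dsimp only [CorrelatedSourceCondition, InputLaw.Region, RateConditions]
  rw [h₁.condMutualInfo_source_WWW hV₁ (A := fun ω => ω.s) (B := fun ω => ω.s.2) i₁,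
    h₂.condMutualInfo_source_WWW_symm hV₂ (A := fun ω => ω.t) (B := fun ω => ω.s.2) i₂,
    h₁.condMutualInfo_source_W₂ hV₁ (A := fun ω => ω.s) (B := fun ω => ω.s.2) i₁,
    h₂.condMutualInfo_source_W₂ hV₂ (A := fun ω => ω.t) (B := fun ω => ω.s.2) i₂,
    h₁.condMutualInfo_source_W₁ hV₁ (A := fun ω => ω.s) (B := fun ω => ω.s.2) i₁,
    h₂.condMutualInfo_source_W₁ hV₂ (A := fun ω => ω.t) (B := fun ω => ω.s.2) i₂,
    h₁.condMutualInfo_source_W₀ hV₁ (A := fun ω => ω.s) (B := fun ω => ω.s.2) i₁,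
    h₂.condMutualInfo_source_W₀ hV₂ (A := fun ω => ω.t) (B := fun ω => ω.s.2) i₂,
    h₁.mutualInfo_source hV₁ (A := fun ω => ω.s) (B := fun ω => ω.s.2) i₁,
    h₂.mutualInfo_source hV₂ (A := fun ω => ω.t) (B := fun ω => ω.s.2) i₂,
    entropy_S hs, entropy_T hs,
    condEntropy_S hs, condEntropy_T hs]
  constructor
  · rintro ⟨-, h1, h2, h3, h4, h5, h6, h7, h8, h9, h10, h11, h12, h13⟩
    refine ⟨h1, h2, ?_, ?_, h5, h6, h7, ?_, ?_, h10, h11, ?_, ?_⟩ <;> linarith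
  · rintro ⟨h1, h2, h3, h4, h5, h6, h7, h8, h9, h10, h11, h12, h13⟩
    refine ⟨hc, h1, h2, ?_, ?_, h5, h6, h7, ?_, ?_, h10, h11, ?_, ?_⟩ <;> linarith

end DecomposedSource

/-! ### Block codes for the channel with common information -/

section Codes

variable {𝒳₁ 𝒳₂ 𝒴₁ 𝒴₂ : Type*} [Fintype 𝒳₁] [Fintype 𝒳₂] [Fintype 𝒴₁] [Fintype 𝒴₂]

theorem decodeError_nonneg {𝒴 M : Type*} [Fintype 𝒴] {V : 𝒳₁ → 𝒳₂ → 𝒴 → ℝ}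
    (hV : ∀ x₁ x₂, IsLaw (V x₁ x₂)) (x₁ : 𝒳₁) (x₂ : 𝒳₂) (φ : 𝒴 → M) (m : M) :
    0 ≤ decodeError V x₁ x₂ φ m :=
  mean_nonneg (hV _ _).nonneg fun y => by split_ifs <;> norm_num

theorem decodeError_le_one {𝒴 M : Type*} [Fintype 𝒴] {V : 𝒳₁ → 𝒳₂ → 𝒴 → ℝ}
    (hV : ∀ x₁ x₂, IsLaw (V x₁ x₂)) (x₁ : 𝒳₁) (x₂ : 𝒳₂) (φ : 𝒴 → M) (m : M) :
    decodeError V x₁ x₂ φ m ≤ 1 :=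
  (hV _ _).mean_le fun y => by split_ifs <;> norm_num

theorem decodeError_comp_le {𝒴 M M' : Type*} [Fintype 𝒴] {V : 𝒳₁ → 𝒳₂ → 𝒴 → ℝ}
    (hV : ∀ x₁ x₂, IsLaw (V x₁ x₂)) (x₁ : 𝒳₁) (x₂ : 𝒳₂) (φ : 𝒴 → M) (d : M → M') (m : M) :
    decodeError V x₁ x₂ (fun y => d (φ y)) (d m) ≤ decodeError V x₁ x₂ φ m := by
  refine mean_mono (hV _ _).nonneg fun y => ?_
  by_cases hy : φ y = m
  · simp [hy]
  · simp only [ne_eq, hy, not_false_eq_true, if_true]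
    split_ifs <;> norm_num

theorem InputLaw.isLaw_channelPow {𝒴 : Type*} [Fintype 𝒴] {V : 𝒳₁ → 𝒳₂ → 𝒴 → ℝ}
    (hV : ∀ x₁ x₂, IsLaw (V x₁ x₂)) (n : ℕ) (x₁ : Fin n → 𝒳₁) (x₂ : Fin n → 𝒳₂) :
    IsLaw (InputLaw.channelPow V n x₁ x₂) := isLaw_indep fun _ => hV _ _

variable (ch : 𝒳₁ → 𝒳₂ → PMF (𝒴₁ × 𝒴₂)) {n : ℕ} (x₁ : Fin n → 𝒳₁) (x₂ : Fin n → 𝒳₂)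

theorem sum_channelWordProb_snd (y₁ : Fin n → 𝒴₁) :
    ∑ y₂, channelWordProb ch x₁ x₂ y₁ y₂ = InputLaw.channelPow (marginal₁ ch) n x₁ x₂ y₁ := by
  classical
  simp only [channelWordProb, InputLaw.channelPow, indep, marginal₁, weight]
  rw [Finset.prod_univ_sum, Fintype.piFinset_univ]

theorem sum_channelWordProb_fst (y₂ : Fin n → 𝒴₂) :
    ∑ y₁, channelWordProb ch x₁ x₂ y₁ y₂ = InputLaw.channelPow (marginal₂ ch) n x₂ x₁ y₂ := by
  classical
  simp only [channelWordProb, InputLaw.channelPow, indep, marginal₂, weight]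
  rw [Finset.prod_univ_sum, Fintype.piFinset_univ]

theorem sum_decodeError₁ {M : Type*} (φ : (Fin n → 𝒴₁) → M) (m : M)
    {D : ∀ y, Decidable (φ y ≠ m)} :
    (∑ y₁, ∑ y₂, if φ y₁ ≠ m then channelWordProb ch x₁ x₂ y₁ y₂ else 0) =
      decodeError (InputLaw.channelPow (marginal₁ ch) n) x₁ x₂ φ m := by
  unfold decodeError mean
  refine Finset.sum_congr rfl fun y₁ _ => ?_
  rw [← sum_channelWordProb_snd, Finset.sum_mul]
  refine Finset.sum_congr rfl fun y₂ _ => ?_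
  by_cases h : φ y₁ = m <;> simp [h]

theorem sum_decodeError₂ {M : Type*} (φ : (Fin n → 𝒴₂) → M) (m : M)
    {D : ∀ y, Decidable (φ y ≠ m)} :
    (∑ y₁, ∑ y₂, if φ y₂ ≠ m then channelWordProb ch x₁ x₂ y₁ y₂ else 0) =
      decodeError (InputLaw.channelPow (marginal₂ ch) n) x₂ x₁ φ m := by
  rw [Finset.sum_comm]
  unfold decodeError mean
  refine Finset.sum_congr rfl fun y₂ _ => ?_
  rw [← sum_channelWordProb_fst, Finset.sum_mul]
  refine Finset.sum_congr rfl fun y₁ _ => ?_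
  by_cases h : φ y₂ = m <;> simp [h]

theorem messageErrorProb₁_eq {M₀ M₁ M₂ : ℕ}
    (f₁ : Fin M₀ → Fin M₁ → (Fin n → 𝒳₁)) (f₂ : Fin M₀ → Fin M₂ → (Fin n → 𝒳₂))
    (φ₁ : (Fin n → 𝒴₁) → Fin M₀ × Fin M₁) :
    messageErrorProb₁ ch f₁ f₂ φ₁ =
      mean (fun _ : Fin M₀ × Fin M₁ × Fin M₂ => ((M₀ : ℝ) * M₁ * M₂)⁻¹) fun m =>
        decodeError (InputLaw.channelPow (marginal₁ ch) n) (f₁ m.1 m.2.1) (f₂ m.1 m.2.2) φ₁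
          (m.1, m.2.1) := by
  have hsum : ∀ m₀ m₁ m₂, _ = _ := fun m₀ m₁ m₂ =>
    sum_decodeError₁ ch (f₁ m₀ m₁) (f₂ m₀ m₂) φ₁ (m₀, m₁) (D := fun _ => Classical.propDecidable _)
  unfold messageErrorProb₁ mean
  rw [← Finset.mul_sum, div_eq_inv_mul, Fintype.sum_prod_type]
  simp only [Fintype.sum_prod_type, ← hsum]

theorem messageErrorProb₂_eq {M₀ M₁ M₂ : ℕ}
    (f₁ : Fin M₀ → Fin M₁ → (Fin n → 𝒳₁)) (f₂ : Fin M₀ → Fin M₂ → (Fin n → 𝒳₂))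
    (φ₂ : (Fin n → 𝒴₂) → Fin M₀ × Fin M₂) :
    messageErrorProb₂ ch f₁ f₂ φ₂ =
      mean (fun _ : Fin M₀ × Fin M₁ × Fin M₂ => ((M₀ : ℝ) * M₁ * M₂)⁻¹) fun m =>
        decodeError (InputLaw.channelPow (marginal₂ ch) n) (f₂ m.1 m.2.2) (f₁ m.1 m.2.1) φ₂
          (m.1, m.2.2) := by
  have hsum : ∀ m₀ m₁ m₂, _ = _ := fun m₀ m₁ m₂ =>
    sum_decodeError₂ ch (f₁ m₀ m₁) (f₂ m₀ m₂) φ₂ (m₀, m₂) (D := fun _ => Classical.propDecidable _)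
  unfold messageErrorProb₂ mean
  rw [← Finset.mul_sum, div_eq_inv_mul, Fintype.sum_prod_type]
  simp only [Fintype.sum_prod_type, ← hsum]

variable {ch}

theorem RandomCodable.commonInfoAchievable {R₀ R₁ R₂ : ℝ}
    (h : RandomCodable (marginal₁ ch) (marginal₂ ch) R₀ R₁ R₂) :
    CommonInfoAchievable ch R₀ R₁ R₂ := by
  intro ε hε _
  obtain ⟨N, hN⟩ := Filter.eventually_atTop.1 (h ε hε)
  refine ⟨N, fun n hn => ?_⟩
  obtain ⟨M₀, M₁, M₂, h0, h1, h2, hc⟩ := hN n hn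
  have p0 : (0 : ℝ) < M₀ := lt_of_lt_of_le (by positivity) h0
  have p1 : (0 : ℝ) < M₁ := lt_of_lt_of_le (by positivity) h1
  have p2 : (0 : ℝ) < M₂ := lt_of_lt_of_le (by positivity) h2
  have hμ : IsLaw fun _ : Fin M₀ × Fin M₁ × Fin M₂ => ((M₀ : ℝ) * M₁ * M₂)⁻¹ :=
    ⟨fun _ => by positivity, by simp; field_simp⟩
  obtain ⟨f₁, f₂, φ₁, φ₂, hf⟩ := hc _ hμ
  refine ⟨M₀, M₁, M₂, h0, h1, h2, f₁, f₂, φ₁, φ₂, max_le ?_ ?_⟩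
  · rw [messageErrorProb₁_eq]
    exact (mean_mono hμ.nonneg fun m => le_add_of_nonneg_right (decodeError_nonneg
      (InputLaw.isLaw_channelPow (isLaw_marginal₂ ch) n) _ _ _ _)).trans hf
  · rw [messageErrorProb₂_eq]
    exact (mean_mono hμ.nonneg fun m => le_add_of_nonneg_left (decodeError_nonneg
      (InputLaw.isLaw_channelPow (isLaw_marginal₁ ch) n) _ _ _ _)).trans hf

end Codes

/-! ### Source coding -/

section SourceCoding

variable {α β : Type*} [Fintype α] [Fintype β]

/-- The word `x` has probability at least `2 ^ (- n (H + δ))`. -/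
def Typical (p : PMF α) (δ : ℝ) {n : ℕ} (x : Fin n → α) : Prop :=
  (2 : ℝ) ^ ((n : ℝ) * -(pmfEntropy p + δ)) ≤ indep (fun _ => weight p) x

/-- The probabilities of the typical words sum to at most 1, so there are at most 2 ^ (n (H + δ)) of
them and they fit injectively into M indices. -/
theorem exists_compression (p : PMF α) {n M : ℕ} {δ : ℝ}
    (hM : (2 : ℝ) ^ ((n : ℝ) * (pmfEntropy p + δ)) ≤ M) :
    ∃ (enc : (Fin n → α) → Fin M) (dec : Fin M → Fin n → α), ∀ x,
      Typical p δ x → dec (enc x) = x := by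
  classical
  have hM0 : 0 < M := Nat.cast_pos.1 (lt_of_lt_of_le (by positivity) hM)
  have hl : IsLaw (indep fun _ : Fin n => weight p) := isLaw_indep fun _ => isLaw_weight p
  have : Nonempty (Fin n → α) := by
    by_contra h
    rw [not_nonempty_iff] at h
    have := hl.sum_eq_one
    simp at this
  let T : Finset (Fin n → α) := Finset.univ.filter fun x => Typical p δ x
  have hT : (T.card : ℝ) * (2 : ℝ) ^ ((n : ℝ) * -(pmfEntropy p + δ)) ≤ 1 := by
    rw [← hl.sum_eq_one, ← nsmul_eq_mul]
    exact (Finset.card_nsmul_le_sum _ _ _ fun x hx => (Finset.mem_filter.1 hx).2).trans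
      (Finset.sum_le_sum_of_subset_of_nonneg (Finset.subset_univ _) fun x _ _ => hl.nonneg x)
  rw [mul_neg, Real.rpow_neg (by norm_num), ← div_eq_mul_inv, div_le_one (by positivity)] at hT
  have hcard : Fintype.card T ≤ Fintype.card (Fin M) := by
    rw [Fintype.card_coe, Fintype.card_fin]
    exact_mod_cast hT.trans hM
  obtain ⟨e⟩ := Function.Embedding.nonempty_of_card_le hcard
  -- Atypical words share the default index 0; nothing is claimed about them.
  let enc : (Fin n → α) → Fin M := Function.extend Subtype.val e fun _ => ⟨0, hM0⟩
  have henc : ∀ x (hx : x ∈ T), enc x = e ⟨x, hx⟩ := fun x hx =>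
    Subtype.val_injective.extend_apply e _ ⟨x, hx⟩
  have hinj : Set.InjOn enc (T : Set (Fin n → α)) := by
    intro x hx y hy hxy
    rw [henc x hx, henc y hy] at hxy
    exact congrArg Subtype.val (e.injective hxy)
  exact ⟨enc, Function.invFunOn enc T, fun x hx =>
    hinj.leftInvOn_invFunOn (by simpa [T] using hx)⟩

-- The weak law for log q(X). The variable X lives on a larger space with law p, so that K, S' and
-- T' can be treated under the one law of the source pair.
open Classical in
theorem eventually_mean_atypical_le {p : β → ℝ} (hp : IsLaw p) {q : PMF α} (X : β → α)
    (hX : ∀ b, 0 < p b → X b ∈ q.support)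
    (hq : mean p (fun b => Real.logb 2 (weight q (X b))) = -pmfEntropy q) {δ ε : ℝ} (hδ : 0 < δ)
    (hε : 0 < ε) :
    ∀ᶠ n : ℕ in Filter.atTop, mean (indep fun _ : Fin n => p) (fun ω =>
      if Typical q δ (fun i => X (ω i)) then 0 else 1) ≤ ε := by
  filter_upwards [eventually_mean_lower_tail_le hp (fun b => Real.logb 2 (weight q (X b))) hδ hε]
    with n hn
  have hl : IsLaw (indep fun _ : Fin n => p) := isLaw_indep fun _ => hp
  refine le_trans (mean_mono_of_pos hl.nonneg fun ω hω => ?_) hn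
  have hpos : ∀ i, 0 < p (ω i) := fun i =>
    lt_of_le_of_ne (hp.nonneg _) fun h => hω.ne' (Finset.prod_eq_zero (Finset.mem_univ i) h.symm)
  by_cases ht : Typical q δ (fun i => X (ω i))
  · rw [if_pos ht]
    split_ifs <;> norm_num
  · have := InputLaw.sum_logb_lt (N := fun i => weight q (X (ω i))) (D := fun _ : Fin n => 1)
      (r := -(pmfEntropy q + δ))
      (fun i => ENNReal.toReal_pos (hX _ (hpos i)) (q.apply_ne_top _))
      (fun _ => one_pos)
      (by simpa only [Typical, indep, Finset.prod_const_one, mul_one] using ht)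
    rw [if_neg ht, if_pos]
    rw [hq, ← neg_add']
    simpa only [Real.logb_one, sub_zero] using this

open Classical in
/-- The law of `g` under `q`. -/
def imageLaw (q : α → ℝ) (g : α → β) (b : β) : ℝ := mean q fun a => if g a = b then 1 else 0

theorem mean_imageLaw (q : α → ℝ) (g : α → β) (f : β → ℝ) :
    mean (imageLaw q g) f = mean q fun a => f (g a) := by
  classical
  unfold imageLaw mean
  simp only [Finset.sum_mul]
  rw [Finset.sum_comm]
  refine Finset.sum_congr rfl fun a _ => ?_
  simp

theorem isLaw_imageLaw {q : α → ℝ} (hq : IsLaw q) (g : α → β) : IsLaw (imageLaw q g) where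
  nonneg b := mean_nonneg hq.nonneg fun a => by split_ifs <;> norm_num
  sum_eq_one := by
    have := (mean_imageLaw q g fun _ => 1).trans (hq.mean_const 1)
    simpa [mean] using this

end SourceCoding

/-! ### Transmission of the decomposed source -/

section Transmission

variable {𝒮 𝒯 𝒳₁ 𝒳₂ 𝒴₁ 𝒴₂ : Type*} [Fintype 𝒮] [Fintype 𝒯] [Fintype 𝒳₁]
    [Fintype 𝒳₂] [Fintype 𝒴₁] [Fintype 𝒴₂]
    (src : PMF (𝒮 × 𝒯)) (ch : 𝒳₁ → 𝒳₂ → PMF (𝒴₁ × 𝒴₂))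

theorem sum_sourceWordProb {n : ℕ} (F : (Fin n → 𝒮) → (Fin n → 𝒯) → ℝ) :
    ∑ s, ∑ t, sourceWordProb src s t * F s t =
      mean (indep fun _ : Fin n => weight src) fun ω => F (fun i => (ω i).1) fun i => (ω i).2 := by
  rw [← mean_equiv (Equiv.arrowProdEquivProdArrow (Fin n) (fun _ => 𝒮) fun _ => 𝒯).symm]
  unfold mean
  rw [Fintype.sum_prod_type]
  rfl

variable {n : ℕ} (f₁ : (Fin n → 𝒮) → (Fin n → 𝒳₁)) (f₂ : (Fin n → 𝒯) → (Fin n → 𝒳₂))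

theorem errorProb₁_eq (φ₁ : (Fin n → 𝒴₁) → (Fin n → 𝒮)) :
    errorProb₁ src ch f₁ f₂ φ₁ = mean (indep fun _ : Fin n => weight src) fun ω =>
      decodeError (InputLaw.channelPow (marginal₁ ch) n) (f₁ fun i => (ω i).1)
        (f₂ fun i => (ω i).2) φ₁ fun i => (ω i).1 := by
  rw [← sum_sourceWordProb src fun s t => decodeError (InputLaw.channelPow (marginal₁ ch) n) (f₁ s)
    (f₂ t) φ₁ s]
  exact Finset.sum_congr rfl fun _ _ => Finset.sum_congr rfl fun _ _ =>
    congrArg _ (sum_decodeError₁ ..)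

theorem errorProb₂_eq (φ₂ : (Fin n → 𝒴₂) → (Fin n → 𝒯)) :
    errorProb₂ src ch f₁ f₂ φ₂ = mean (indep fun _ : Fin n => weight src) fun ω =>
      decodeError (InputLaw.channelPow (marginal₂ ch) n) (f₂ fun i => (ω i).2)
        (f₁ fun i => (ω i).1) φ₂ fun i => (ω i).2 := by
  rw [← sum_sourceWordProb src fun s t => decodeError (InputLaw.channelPow (marginal₂ ch) n) (f₂ t)
    (f₁ s) φ₂ t]
  exact Finset.sum_congr rfl fun _ _ => Finset.sum_congr rfl fun _ _ =>
    congrArg _ (sum_decodeError₂ ..)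

end Transmission

/-! ### Separate source and channel coding -/

section Admissible

variable {𝒮' 𝒯' 𝒦 𝒳₁ 𝒳₂ 𝒴₁ 𝒴₂ : Type*} [Fintype 𝒮'] [Fintype 𝒯'] [Fintype 𝒦] [Fintype 𝒳₁]
    [Fintype 𝒳₂] [Fintype 𝒴₁] [Fintype 𝒴₂]

open Classical in
/-- A decoder that recovers the indices of the two components of a source word recovers the word
when both components are typical. -/
theorem decodeError_source_le {n M₀ M₁ : ℕ} {V : (Fin n → 𝒳₁) → (Fin n → 𝒳₂) → (Fin n → 𝒴₁) → ℝ}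
    (hV : ∀ x₁ x₂, IsLaw (V x₁ x₂)) (x₁ : Fin n → 𝒳₁) (x₂ : Fin n → 𝒳₂)
    (ψ : (Fin n → 𝒴₁) → Fin M₀ × Fin M₁) {encK : (Fin n → 𝒦) → Fin M₀}
    {decK : Fin M₀ → Fin n → 𝒦} {encS : (Fin n → 𝒮') → Fin M₁} {decS : Fin M₁ → Fin n → 𝒮'}
    (s : Fin n → 𝒮' × 𝒦) {p q : Prop} (hp : p → decK (encK fun i => (s i).2) = fun i => (s i).2)
    (hq : q → decS (encS fun i => (s i).1) = fun i => (s i).1) :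
    decodeError V x₁ x₂ (fun y i => (decS (ψ y).2 i, decK (ψ y).1 i)) s ≤
      (if p then 0 else 1) + (if q then 0 else 1) +
        decodeError V x₁ x₂ ψ (encK fun i => (s i).2, encS fun i => (s i).1) := by
  have h0 := decodeError_nonneg hV x₁ x₂ ψ (encK fun i => (s i).2, encS fun i => (s i).1)
  have h1 := decodeError_le_one hV x₁ x₂ (fun y i => (decS (ψ y).2 i, decK (ψ y).1 i)) s
  by_cases h : p ∧ q
  · rw [if_pos h.1, if_pos h.2, zero_add, zero_add]
    refine le_trans (le_of_eq ?_) (decodeError_comp_le hV x₁ x₂ ψ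
      (fun m i => (decS m.2 i, decK m.1 i)) (encK fun i => (s i).2, encS fun i => (s i).1))
    simp only [hp h.1, hq h.2]
  · split_ifs <;> first | linarith | exact absurd ⟨‹_›, ‹_›⟩ h

theorem RandomCodable.admissible {ch : 𝒳₁ → 𝒳₂ → PMF (𝒴₁ × 𝒴₂)} (pS' : PMF 𝒮') (pT' : PMF 𝒯')
    (pK : PMF 𝒦) {δ : ℝ} (hδ : 0 < δ)
    (h : RandomCodable (marginal₁ ch) (marginal₂ ch) (pmfEntropy pK + δ) (pmfEntropy pS' + δ)
      (pmfEntropy pT' + δ)) :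
    Admissible (decomposedSource pS' pT' pK) ch := by
  intro ε hε _
  -- Five contributions: atypical K at each of the two receivers, atypical S', atypical T', and the
  -- error of the channel code.
  have hε5 : 0 < ε / 5 := by positivity
  have hsrc := isLaw_weight (decomposedSource pS' pT' pK)
  have hsupp : ∀ b, 0 < weight (decomposedSource pS' pT' pK) b → _ := fun b hb =>
    (decomposedSource_ne_zero_iff pS' pT' pK b.1 b.2).1 fun h0 => hb.ne' (by simp [weight, h0])
  have aK := eventually_mean_atypical_le hsrc (q := pK) (fun b => b.1.2)
    (fun b hb => (hsupp b hb).2.2.1)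
    (by simp only [mean_decomposedSource, (isLaw_weight _).mean_const, pmfEntropy, neg_neg]) hδ hε5
  have aS := eventually_mean_atypical_le hsrc (q := pS') (fun b => b.1.1)
    (fun b hb => (hsupp b hb).1)
    (by simp only [mean_decomposedSource, (isLaw_weight _).mean_const, pmfEntropy, neg_neg]) hδ hε5
  have aT := eventually_mean_atypical_le hsrc (q := pT') (fun b => b.2.1)
    (fun b hb => (hsupp b hb).2.1)
    (by simp only [mean_decomposedSource, (isLaw_weight _).mean_const, pmfEntropy, neg_neg]) hδ hε5
  obtain ⟨N, hN⟩ := Filter.eventually_atTop.1 (((h _ hε5).and aK).and (aS.and aT))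
  refine ⟨N, fun n hn => ?_⟩
  obtain ⟨⟨⟨M₀, M₁, M₂, h0, h1, h2, hc⟩, aK⟩, aS, aT⟩ := hN n hn
  obtain ⟨encK, decK, hK⟩ := exists_compression pK h0
  obtain ⟨encS, decS, hS⟩ := exists_compression pS' h1
  obtain ⟨encT, decT, hT⟩ := exists_compression pT' h2
  have hQ : IsLaw (indep fun _ : Fin n => weight (decomposedSource pS' pT' pK)) :=
    isLaw_indep fun _ => hsrc
  -- The message law is that of the compressed indices, which need be neither uniform nor
  -- independent.
  obtain ⟨g₁, g₂, ψ₁, ψ₂, hg⟩ := hc _ (isLaw_imageLaw hQ fun ω => (encK fun i => (ω i).1.2,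
    encS fun i => (ω i).1.1, encT fun i => (ω i).2.1))
  rw [mean_imageLaw] at hg
  have hV₁ := InputLaw.isLaw_channelPow (isLaw_marginal₁ ch) n
  have hV₂ := InputLaw.isLaw_channelPow (isLaw_marginal₂ ch) n
  let f₁ : (Fin n → 𝒮' × 𝒦) → Fin n → 𝒳₁ := fun s =>
    g₁ (encK fun i => (s i).2) (encS fun i => (s i).1)
  let f₂ : (Fin n → 𝒯' × 𝒦) → Fin n → 𝒳₂ := fun t =>
    g₂ (encK fun i => (t i).2) (encT fun i => (t i).1)
  let φ₁ : (Fin n → 𝒴₁) → Fin n → 𝒮' × 𝒦 := fun y i => (decS (ψ₁ y).2 i, decK (ψ₁ y).1 i)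
  let φ₂ : (Fin n → 𝒴₂) → Fin n → 𝒯' × 𝒦 := fun y i => (decT (ψ₂ y).2 i, decK (ψ₂ y).1 i)
  refine ⟨f₁, f₂, φ₁, φ₂, ?_⟩
  have n1 : 0 ≤ errorProb₁ (decomposedSource pS' pT' pK) ch f₁ f₂ φ₁ := by
    rw [errorProb₁_eq]
    exact mean_nonneg hQ.nonneg fun ω => decodeError_nonneg hV₁ _ _ _ _
  have n2 : 0 ≤ errorProb₂ (decomposedSource pS' pT' pK) ch f₁ f₂ φ₂ := by
    rw [errorProb₂_eq]
    exact mean_nonneg hQ.nonneg fun ω => decodeError_nonneg hV₂ _ _ _ _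
  have hsum : errorProb₁ (decomposedSource pS' pT' pK) ch f₁ f₂ φ₁ +
      errorProb₂ (decomposedSource pS' pT' pK) ch f₁ f₂ φ₂ ≤ ε := by
    rw [errorProb₁_eq, errorProb₂_eq, ← mean_add]
    refine (mean_mono_of_pos hQ.nonneg fun ω hω => ?_).trans ((mean_add _ _ _).trans_le
      ((add_le_add ((mean_add _ _ _).trans_le (add_le_add ((mean_add _ _ _).trans_le
        (add_le_add ((mean_add _ _ _).trans_le (add_le_add aK aK)) aS)) aT)) hg).trans
          (by linarith)))
    have hpos : ∀ i, 0 < weight (decomposedSource pS' pT' pK) (ω i) := fun i =>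
      lt_of_le_of_ne (hsrc.nonneg _) fun h =>
        hω.ne' (Finset.prod_eq_zero (Finset.mem_univ i) h.symm)
    -- Encoder 2 computes the common index from its own copy of K; on words of positive probability
    -- it agrees with that of encoder 1.
    have hk : (fun i => (ω i).2.2) = fun i => (ω i).1.2 :=
      funext fun i => (hsupp _ (hpos i)).2.2.2.symm
    have e1 := decodeError_source_le hV₁ (f₁ fun i => (ω i).1) (f₂ fun i => (ω i).2) ψ₁
      (fun i => (ω i).1) (hK fun i => (ω i).1.2) (hS fun i => (ω i).1.1)
    have e2 := decodeError_source_le hV₂ (f₂ fun i => (ω i).2) (f₁ fun i => (ω i).1) ψ₂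
      (fun i => (ω i).2) (p := Typical pK δ fun i => (ω i).1.2)
      (by simpa only [hk] using hK fun i => (ω i).1.2) (hT fun i => (ω i).2.1)
    simp only [hk, f₁, f₂, φ₁, φ₂] at e1 e2 ⊢
    linarith
  exact max_le (by linarith) (by linarith)

end Admissible

end InterferenceChannel

end

theorem corollary2
    {𝒮' 𝒯' 𝒦 𝒲₀ 𝒲₁ 𝒲₂ 𝒳₁ 𝒳₂ 𝒴₁ 𝒴₂ : Type*}
    [Fintype 𝒮'] [Fintype 𝒯'] [Fintype 𝒦] [Fintype 𝒲₀] [Fintype 𝒲₁] [Fintype 𝒲₂]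
    [Fintype 𝒳₁] [Fintype 𝒳₂] [Fintype 𝒴₁] [Fintype 𝒴₂]
    (pS' : PMF 𝒮') (pT' : PMF 𝒯') (pK : PMF 𝒦)
    (pW₀ : PMF 𝒲₀) (pW₁ : 𝒲₀ → PMF 𝒲₁) (pW₂ : 𝒲₀ → PMF 𝒲₂)
    (pX₁ : 𝒲₀ → 𝒲₁ → PMF 𝒳₁) (pX₂ : 𝒲₀ → 𝒲₂ → PMF 𝒳₂)
    (ch : 𝒳₁ → 𝒳₂ → PMF (𝒴₁ × 𝒴₂)) :
    -- the source pair `S = (S', K)`, `T = (T', K)`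
    let src := InterferenceChannel.decomposedSource pS' pT' pK
    -- the joint law of all variables, the inputs depending only on `W₀, W₁, W₂`
    let P := InterferenceChannel.jointLaw src pW₀ pW₁ pW₂
      (fun _ w₁ w₀ => pX₁ w₀ w₁) (fun _ w₂ w₀ => pX₂ w₀ w₂) ch
    let HK := InterferenceChannel.entropy P (fun ω => ω.s.2)
    let HS' := InterferenceChannel.entropy P (fun ω => ω.s.1)
    let HT' := InterferenceChannel.entropy P (fun ω => ω.t.1)
    -- the thirteen inequalities in `H(K)`, `H(S')`, `H(T')`
    let condition := InterferenceChannel.ThirteenInequalities P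
      (fun ω => ω.w₀) (fun ω => ω.w₁) (fun ω => ω.w₂) (fun ω => ω.x₁) (fun ω => ω.x₂)
      (fun ω => ω.y₁) (fun ω => ω.y₂) HK HS' HT'
    -- they are a sufficient condition for lossless transmission
    (condition → InterferenceChannel.Admissible src ch) ∧
    -- `K` is the common part of `S` and `T`
    InterferenceChannel.IsCommonPart src Prod.snd Prod.snd ∧
    -- they are what the general condition, with common part `K`, becomes for this joint law
    (InterferenceChannel.CorrelatedSourceCondition src Prod.snd Prod.snd pW₀ pW₁ pW₂
      (fun _ w₁ w₀ => pX₁ w₀ w₁) (fun _ w₂ w₀ => pX₂ w₀ w₂) ch ↔ condition) ∧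
    -- they say that `(H(K), H(S'), H(T'))` lies in the region for common information
    (condition ↔
      (HK, HS', HT') ∈ InterferenceChannel.commonInfoRegion pW₀ pW₁ pW₂ pX₁ pX₂ ch) ∧
    -- and that region is achievable
    (∀ R₀ R₁ R₂ : ℝ,
      (R₀, R₁, R₂) ∈ InterferenceChannel.commonInfoRegion pW₀ pW₁ pW₂ pX₁ pX₂ ch →
        InterferenceChannel.CommonInfoAchievable ch R₀ R₁ R₂) := by
  intro src P HK HS' HT' condition
  have h₁ := InterferenceChannel.hasJoint_channelLaw₁ ch pW₀ pW₁ pW₂ pX₁ pX₂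
  have h₂ := InterferenceChannel.hasJoint_channelLaw₂ ch pW₀ pW₁ pW₂ pX₁ pX₂
  have hV₁ := InterferenceChannel.isLaw_marginal₁ ch
  have hV₂ := InterferenceChannel.isLaw_marginal₂ ch
  have hs := InterferenceChannel.mean_jointLaw_source ch pW₀ pW₁ pW₂ pX₁ pX₂ src
  have eK : HK = InterferenceChannel.pmfEntropy pK := InterferenceChannel.entropy_common hs
  have eS : HS' = InterferenceChannel.pmfEntropy pS' := InterferenceChannel.entropy_fst hs
  have eT : HT' = InterferenceChannel.pmfEntropy pT' := InterferenceChannel.entropy_snd hs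
  have hK : 0 ≤ HK := InterferenceChannel.entropy_nonneg _ _
  have hS : 0 ≤ HS' := InterferenceChannel.entropy_nonneg _ _
  have hT : 0 ≤ HT' := InterferenceChannel.entropy_nonneg _ _
  have hcond : condition ↔ (InterferenceChannel.pmfInputLaw pW₀ pW₁ pW₂ pX₁ pX₂).Region
      (InterferenceChannel.marginal₁ ch) (InterferenceChannel.marginal₂ ch) HK HS' HT' :=
    -- Adding the source to the sample space does not change the law of the channel variables, so
    -- both spaces yield the same inequalities.
    InterferenceChannel.thirteenInequalities_iff hV₁ hV₂ (h₁.jointLaw _ _ _ _ _ _ src)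
      (h₂.jointLaw _ _ _ _ _ _ src) _ _ _
  have hreg := InterferenceChannel.thirteenInequalities_iff hV₁ hV₂ h₁ h₂
  refine ⟨fun hc => ?_, InterferenceChannel.isCommonPart_decomposedSource pS' pT' pK, ?_, ?_, ?_⟩
  -- The code is built for rates δ above the entropies, which is what compression of the three
  -- components requires.
  · obtain ⟨δ, hδ, hslack⟩ := InterferenceChannel.RateConditions.exists_slack (hcond.1 hc)
    have hcode := InterferenceChannel.InputLaw.Region.randomCodable hslack hV₁ hV₂
      (by positivity) (by positivity)
    rw [eK, eS, eT] at hcode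
    exact hcode.admissible pS' pT' pK hδ
  · rw [hcond, eK, eS, eT]
    exact InterferenceChannel.correlatedSourceCondition_iff pS' pT' pK ch pW₀ pW₁ pW₂ pX₁ pX₂
  · exact ⟨fun hc => ⟨hK, hS, hT, (hreg _ _ _).2 (hcond.1 hc)⟩,
      fun hc => hcond.2 ((hreg _ _ _).1 hc.2.2.2)⟩
  · rintro R₀ R₁ R₂ ⟨-, hR₁, hR₂, hR⟩
    exact (((hreg _ _ _).1 hR).randomCodable hV₁ hV₂ hR₁ hR₂).commonInfoAchievable
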